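/- Subspaces of $\mathrm{PG}(n-1,q)$ are identified with linear subspaces of $\mathbb{F}_q^n$, and $\dim$ denotes linear dimension, so points are $1$-dimensional and hyperplanes are $(n-1)$-dimensional. An \emph{affine vector space partition} (avsp) of $\mathrm{PG}(n-1,q)$ is a finite set $\mathcal{U}$ of subspaces with $1\le\dim(U)\le n-1$ for all $U\in\mathcal{U}$, for which there is a hyperplane $H_\infty$ such that no $U\in\mathcal{U}$ is contained in $H_\infty$ and every point not contained in $H_\infty$ lies in exactly one $U\in\mathcal{U}$. It is \emph{tight} if no point lies in all of its elements. It is \emph{reducible} if there are a subspace $W$ with $\dim(W)<n$ and a proper subset $\mathcal{S}\subsetneq\mathcal{U}$ with $\#\mathcal{S}>1$ such that $\mathcal{S}$ is an avsp of $W$ (the same definition with $W$ as the ambient space); otherwise it is \emph{irreducible}. Its \emph{type} is $(n-1)^{m_{n-1}}\cdots 2^{m_2}1^{m_1}$, where $m_d$ is the number of elements of dimension $d$; entries with $m_d=0$ may be omitted. Its \emph{size} is $\#\mathcal{U}$. \textbf{Proposition.} Every tight irreducible avsp of $\mathrm{PG}(6,2)$ has one of the following types, where $i,j\ge 0$ are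 integers: \begin{itemize} \item $5^2\,4^i\,3^j\,2^{16-2j-4i}$ with $i\in\{0,1,2\}$, $0\le j\le 8-2i$, $j+2i\ne 7$ and $(i,j)\ne(2,4)$; \item $5^1\,4^i\,3^j\,2^{24-2j-4i}$ with $0\le i\le 4$, $0\le j\le 12-2i$ and $j+2i\ne 11$; \item $4^i\,3^j\,2^{32-2j-4i}$ with $0\le i\le 8$, $0\le j\le 16-2i$, $j+2i\ne 15$ and $i\ne 7$. \end{itemize} Conversely, each of these types is the type of some tight irreducible avsp of $\mathrm{PG}(6,2)$. Consequently, the minimum size of a tight irreducible avsp of $\mathrm{PG}(6,2)$ is $8$, and every tight irreducible avsp of $\mathrm{PG}(6,2)$ of size $8$ has type $4^8$. -/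

import Mathlib

open Module

section AVSP

variable {K V : Type*} [Field K] [AddCommGroup V] [Module K V]

/-- `𝒰` is an affine vector space partition (avsp) of the projective space of the subspace `W`.
Subspaces of the projective space are linear subspaces, dimensions are linear dimensions, points
are the `1`-dimensional subspaces and hyperplanes of `W` are the subspaces of codimension `1`. -/
def IsAVSPOf (W : Submodule K V) (𝒰 : Finset (Submodule K V)) : Prop :=
  (∀ U ∈ 𝒰, U ≤ W ∧ 1 ≤ finrank K U ∧ finrank K U < finrank K W) ∧
  ∃ H : Submodule K V, H ≤ W ∧ finrank K H + 1 = finrank K W ∧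
    (∀ U ∈ 𝒰, ¬ U ≤ H) ∧
    ∀ P : Submodule K V, P ≤ W → finrank K P = 1 → ¬ P ≤ H → ∃! U, U ∈ 𝒰 ∧ P ≤ U

/-- An avsp of the whole projective space of `V`. -/
def IsAVSP (𝒰 : Finset (Submodule K V)) : Prop :=
  IsAVSPOf ⊤ 𝒰

/-- Some proper subset with more than one element is an avsp of a proper subspace. -/
def IsReducibleAVSP (𝒰 : Finset (Submodule K V)) : Prop :=
  ∃ (W : Submodule K V) (S : Finset (Submodule K V)),
    S ⊂ 𝒰 ∧ finrank K W < finrank K V ∧ 1 < S.card ∧ IsAVSPOf W S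

/-- The intersection of all elements contains no point. -/
def IsTightAVSP (𝒰 : Finset (Submodule K V)) : Prop :=
  ¬ ∃ P : Submodule K V, finrank K P = 1 ∧ ∀ U ∈ 𝒰, P ≤ U

/-- A tight irreducible avsp of the projective space of `V`. -/
def IsTightIrreducibleAVSP (𝒰 : Finset (Submodule K V)) : Prop :=
  IsAVSP 𝒰 ∧ IsTightAVSP 𝒰 ∧ ¬ IsReducibleAVSP 𝒰

/-- The type of `𝒰`: the number `m_d` of elements of dimension `d`, for every `d`. -/
noncomputable def avspType (𝒰 : Finset (Submodule K V)) (d : ℕ) : ℕ :=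
  (𝒰.filter fun U : Submodule K V => finrank K U = d).card

end AVSP

/-- The type `5^{m₅} 4^{m₄} 3^{m₃} 2^{m₂}`; all other multiplicities are `0`. -/
def typeFiveToTwo (m₅ m₄ m₃ m₂ : ℕ) : ℕ → ℕ
  | 5 => m₅
  | 4 => m₄
  | 3 => m₃
  | 2 => m₂
  | _ => 0

/-- The listed types: `5^2 4^i 3^j 2^{16-2j-4i}`, `5^1 4^i 3^j 2^{24-2j-4i}` and
`4^i 3^j 2^{32-2j-4i}`. The subtractions never truncate, by the bounds on `j + 2 * i`. -/
inductive IsListedType : (ℕ → ℕ) → Prop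
  | two_five (i j : ℕ) (hi : i ≤ 2) (hj : j + 2 * i ≤ 8) (h7 : j + 2 * i ≠ 7)
      (hne : (i, j) ≠ (2, 4)) : IsListedType (typeFiveToTwo 2 i j (16 - 2 * j - 4 * i))
  | one_five (i j : ℕ) (hi : i ≤ 4) (hj : j + 2 * i ≤ 12) (h11 : j + 2 * i ≠ 11) :
      IsListedType (typeFiveToTwo 1 i j (24 - 2 * j - 4 * i))
  | no_five (i j : ℕ) (hi : i ≤ 8) (hj : j + 2 * i ≤ 16) (h15 : j + 2 * i ≠ 15)
      (h7 : i ≠ 7) : IsListedType (typeFiveToTwo 0 i j (32 - 2 * j - 4 * i))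

/-!
Over the field with two elements, the points off the hyperplane at infinity `h = 0` are the vectors
`v` with `h v = 1`. An avsp of `PG(6,2)` is a partition of the `64` vectors of this affine space
into flats, where an element of dimension `d` has `2 ^ (d - 1)` vectors. It is irreducible when no
nontrivial flat is a union of at least two elements, and tight when the elements have no common
direction. This translation is made by `IsTightIrreducibleAVSP.exists_functional` and its converse
`IsAffinePartition.isTightIrreducibleAVSP`.

*Necessity.* As a binary codeword, an element of dimension at least `d + 1` is orthogonal to the
Reed–Muller code of order `d - 1`, and so is the set of all points. Hence this holds for the union
of the elements of dimension at most `d`, which therefore has at least `2 ^ d` points, with equality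
only for a flat, and irreducibility excludes equality (`IsAffineIrreducible.two_pow_lt_sum`). With
the count `∑ 2 ^ (d - 1) = 64` this leaves the listed types and those in which all dimensions are at
least five, as well as `5^1 4^6`, `5^2 4^4` and `5^2 4^2 3^4`.

If all dimensions are at least five, then a dimension count yields a common direction. For
`5^1 4^6`, let `A` be the element of dimension five and `T` the space of its directions. The points
outside of `A` form three classes modulo `T`, each element has points in at most two of them, and
the elements with points in a common class have a common direction in `T`. For two elements `A` and
`B` of dimension five, let `T` be their three-dimensional intersection; the remaining points form
four classes modulo `T`, and again each element has points in at most two of them, because three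
points in different classes sum to a point of `A` or `B`. In all cases, the directions in `T` of two
elements that meet a common class are so closely related (`IsAffinePartition.add_notMem_sup`) that
there is a common direction, a flat that is a union of elements, or a pair of parallel elements. The
union of two parallel elements is a flat.

*Existence.* For each listed type, an explicit partition of the numbers below `64`, read as binary
vectors, is verified by evaluation in the kernel. Irreducibility is verified on pairs of elements:
a flat that contains both elements of a pair contains a point of a third element with which one of
them forms a pair that is already settled, or else joining elements that are met leads to the whole
space (`IsFlatPred.of_pairsGenerate`).

The size is the sum of the multiplicities, so that the last two assertions follow from the list of
types.
-/

/-! ### Linear algebra over the field with two elements -/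

section CharTwo

variable {V : Type*} [AddCommGroup V] [Module (ZMod 2) V]

theorem add_add_cancel_self_two (x y : V) : x + (x + y) = y := by
  rw [← add_assoc, ZModModule.add_self, zero_add]

theorem eq_of_add_eq_zero_two {x y : V} (h : x + y = 0) : x = y := by
  have := add_add_cancel_self_two x y
  rw [h, add_zero] at this
  exact this

theorem zmod_two_eq_zero_or_one (a : ZMod 2) : a = 0 ∨ a = 1 := by
  revert a; decide

theorem zmod_two_ne_one {a : ZMod 2} : ¬ a = 1 ↔ a = 0 := by
  revert a; decide

theorem zmod_two_ne_zero {a : ZMod 2} : ¬ a = 0 ↔ a = 1 := by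
  revert a; decide

theorem mem_sup_span_singleton_two {D : Submodule (ZMod 2) V} {t u : V}
    (h : u ∈ D ⊔ Submodule.span (ZMod 2) {t}) : u ∈ D ∨ t + u ∈ D := by
  obtain ⟨a, ha, b, hb, rfl⟩ := Submodule.mem_sup.1 h
  obtain ⟨c, rfl⟩ := Submodule.mem_span_singleton.1 hb
  rcases zmod_two_eq_zero_or_one c with rfl | rfl
  · left; simpa using ha
  · right
    rw [one_smul, add_comm a t, add_add_cancel_self_two]; exact ha

/-- In characteristic two, a subspace whose complement has all its sums of two vectors in the
subspace has codimension at most one. -/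
theorem finrank_le_of_index_two [Finite V] {D' D : Submodule (ZMod 2) V}
    (h : ∀ t ∈ D, t ∉ D' → ∀ u ∈ D, u ∉ D' → t + u ∈ D') :
    finrank (ZMod 2) D ≤ finrank (ZMod 2) D' + 1 := by
  by_cases hD : D ≤ D'
  · exact (Submodule.finrank_mono hD).trans (Nat.le_succ _)
  · obtain ⟨t, ht, ht'⟩ := SetLike.not_le_iff_exists.1 hD
    have hle : D ≤ D' ⊔ Submodule.span (ZMod 2) {t} := by
      intro u hu
      by_cases hu' : u ∈ D'
      · exact Submodule.mem_sup_left hu'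
      · have := h t ht ht' u hu hu'
        rw [← add_add_cancel_self_two t u, add_comm]
        exact Submodule.add_mem_sup this (Submodule.mem_span_singleton_self t)
    have h1 := Submodule.finrank_mono hle
    have h2 := Submodule.finrank_add_le_finrank_add_finrank D' (Submodule.span (ZMod 2) {t})
    have h3 : finrank (ZMod 2) (Submodule.span (ZMod 2) {t}) ≤ 1 := by
      simpa using finrank_span_le_card (R := ZMod 2) ({t} : Set V)
    omega

theorem add_mem_of_finrank_le [Finite V] {D' D : Submodule (ZMod 2) V} (hle : D' ≤ D)
    (h : finrank (ZMod 2) D ≤ finrank (ZMod 2) D' + 1) {t u : V} (ht : t ∈ D) (ht' : t ∉ D')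
    (hu : u ∈ D) (hu' : u ∉ D') : t + u ∈ D' := by
  have hlt : D' < D' ⊔ Submodule.span (ZMod 2) {t} :=
    left_lt_sup.2 fun hh => ht' (hh (Submodule.mem_span_singleton_self t))
  have h1 := Submodule.finrank_lt_finrank_of_lt hlt
  have hle2 : D' ⊔ Submodule.span (ZMod 2) {t} ≤ D :=
    sup_le hle (by simpa [Submodule.span_le] using ht)
  have h2 := Submodule.finrank_mono hle2
  have heq := Submodule.eq_of_le_of_finrank_eq hle2 (by omega)
  rw [← heq] at hu
  exact (mem_sup_span_singleton_two hu).resolve_left hu'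

theorem finrank_lt_of_mem_notMem [Finite V] {D' D : Submodule (ZMod 2) V} (hle : D' ≤ D) {t : V}
    (ht : t ∈ D) (ht' : t ∉ D') : finrank (ZMod 2) D' < finrank (ZMod 2) D :=
  Submodule.finrank_lt_finrank_of_lt (lt_of_le_of_ne hle fun h => ht' (h ▸ ht))

theorem exists_mem_ne_zero_of_finrank [Finite V] {D : Submodule (ZMod 2) V}
    (h : 0 < finrank (ZMod 2) D) : ∃ t ∈ D, t ≠ 0 := by
  have : D ≠ ⊥ := by rintro rfl; simp at h
  exact (Submodule.ne_bot_iff D).1 this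

theorem one_le_finrank_of_mem [Finite V] {D : Submodule (ZMod 2) V} {t : V} (ht : t ∈ D)
    (h0 : t ≠ 0) : 1 ≤ finrank (ZMod 2) D := by
  have : finrank (ZMod 2) (⊥ : Submodule (ZMod 2) V) < finrank (ZMod 2) D :=
    finrank_lt_of_mem_notMem bot_le ht (by simpa using h0)
  omega

/-- A subspace of dimension at most one has at most one nonzero vector. -/
theorem eq_of_finrank_le_one [Finite V] {D : Submodule (ZMod 2) V}
    (h : finrank (ZMod 2) D ≤ 1) {t u : V} (ht : t ∈ D) (hu : u ∈ D) (ht0 : t ≠ 0) (hu0 : u ≠ 0) :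
    t = u := by
  have := add_mem_of_finrank_le (D' := ⊥) bot_le (by simpa using h) ht (by simpa using ht0) hu
    (by simpa using hu0)
  exact eq_of_add_eq_zero_two (by simpa using this)

/-- The nonzero vectors of a plane are any two of them and their sum. -/
theorem mem_of_finrank_le_two [Finite V] {D : Submodule (ZMod 2) V}
    (h : finrank (ZMod 2) D ≤ 2) {a b t : V} (ha : a ∈ D) (hb : b ∈ D) (ha0 : a ≠ 0) (hb0 : b ≠ 0)
    (hab : a ≠ b) (ht : t ∈ D) : t = 0 ∨ t = a ∨ t = b ∨ t = a + b := by
  have hle : Submodule.span (ZMod 2) {a} ≤ D := by simpa [Submodule.span_le] using ha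
  have ha' : a ∈ Submodule.span (ZMod 2) {a} := Submodule.mem_span_singleton_self a
  have h1 := one_le_finrank_of_mem ha' ha0
  have key : ∀ v, v ∈ Submodule.span (ZMod 2) {a} → v = 0 ∨ v = a := by
    intro v hv
    obtain ⟨c, rfl⟩ := Submodule.mem_span_singleton.1 hv
    rcases zmod_two_eq_zero_or_one c with rfl | rfl <;> simp
  by_cases hta : t ∈ Submodule.span (ZMod 2) {a}
  · rcases key t hta with h | h <;> simp [h]
  · have hba : b ∉ Submodule.span (ZMod 2) {a} := fun hh => by
      rcases key b hh with h | h
      · exact hb0 h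
      · exact hab h.symm
    have := add_mem_of_finrank_le hle (by omega) hb hba ht hta
    rcases key _ this with h | h
    · right; right; left; exact (eq_of_add_eq_zero_two h).symm
    · right; right; right
      rw [← h, add_comm b t, add_assoc, ZModModule.add_self, add_zero]

/-- Modulo a subspace of codimension two, there are only three nonzero classes, and they sum to
zero. -/
theorem add_mem_of_codim_two [Finite V] {A : Submodule (ZMod 2) V}
    (hA : finrank (ZMod 2) V ≤ finrank (ZMod 2) A + 2) {u v w : V} (hu : u ∉ A) (hv : v ∉ A)
    (hw : w ∉ A) : u + v ∈ A ∨ u + w ∈ A ∨ v + w ∈ A ∨ u + v + w ∈ A := by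
  have h1 : finrank (ZMod 2) A <
      finrank (ZMod 2) (A ⊔ Submodule.span (ZMod 2) {u} : Submodule (ZMod 2) V) :=
    finrank_lt_of_mem_notMem le_sup_left
      (Submodule.mem_sup_right (Submodule.mem_span_singleton_self u)) hu
  by_cases hv' : v ∈ A ⊔ Submodule.span (ZMod 2) {u}
  · exact Or.inl ((mem_sup_span_singleton_two hv').resolve_left hv)
  by_cases hw' : w ∈ A ⊔ Submodule.span (ZMod 2) {u}
  · exact Or.inr (Or.inl ((mem_sup_span_singleton_two hw').resolve_left hw))
  have h2 := add_mem_of_finrank_le (le_top : A ⊔ Submodule.span (ZMod 2) {u} ≤ ⊤)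
    (by rw [finrank_top]; omega) Submodule.mem_top hv' Submodule.mem_top hw'
  rcases mem_sup_span_singleton_two h2 with h3 | h3
  · exact Or.inr (Or.inr (Or.inl h3))
  · exact Or.inr (Or.inr (Or.inr (by rwa [add_assoc])))

/-- A functional that vanishes on a subspace and takes the value one at a vector outside of it. -/
theorem exists_functional_eq_one {D : Submodule (ZMod 2) V} {t : V} (ht : t ∉ D) :
    ∃ f : V →ₗ[ZMod 2] ZMod 2, f t = 1 ∧ ∀ u ∈ D, f u = 0 := by
  obtain ⟨f, hf, hD⟩ := Submodule.exists_le_ker_of_notMem ht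
  exact ⟨f, zmod_two_ne_zero.1 hf, fun u hu => hD hu⟩

theorem finrank_inf_ker_le [Finite V] (U : Submodule (ZMod 2) V) (f : V →ₗ[ZMod 2] ZMod 2) :
    finrank (ZMod 2) U ≤ finrank (ZMod 2) (U ⊓ LinearMap.ker f : Submodule (ZMod 2) V) + 1 := by
  refine finrank_le_of_index_two fun t ht ht' u hu hu' => ?_
  simp only [Submodule.mem_inf, ht, hu, true_and, LinearMap.mem_ker, zmod_two_ne_zero] at ht' hu'
  refine ⟨U.add_mem ht hu, ?_⟩
  exact LinearMap.mem_ker.2 (by rw [map_add, ht', hu']; decide)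

theorem finrank_inf_ker_add_one [Finite V] {U : Submodule (ZMod 2) V} {f : V →ₗ[ZMod 2] ZMod 2}
    {v : V} (hv : v ∈ U) (hf : f v = 1) :
    finrank (ZMod 2) (U ⊓ LinearMap.ker f : Submodule (ZMod 2) V) + 1 = finrank (ZMod 2) U := by
  have h1 := finrank_inf_ker_le U f
  have h2 : finrank (ZMod 2) (U ⊓ LinearMap.ker f : Submodule (ZMod 2) V) < finrank (ZMod 2) U :=
    finrank_lt_of_mem_notMem inf_le_left hv (by simp [hf])
  omega

/-- A subspace that is not contained in a hyperplane of an ambient subspace meets it in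
codimension one. -/
theorem finrank_inf_add_one_of_not_le [Finite V] {U W H : Submodule (ZMod 2) V} (hUW : U ≤ W)
    (hHW : H ≤ W) (hH : finrank (ZMod 2) H + 1 = finrank (ZMod 2) W) (hU : ¬ U ≤ H) :
    finrank (ZMod 2) (U ⊓ H : Submodule (ZMod 2) V) + 1 = finrank (ZMod 2) U := by
  obtain ⟨v, hv, hv'⟩ := SetLike.not_le_iff_exists.1 hU
  have h1 : finrank (ZMod 2) U ≤ finrank (ZMod 2) (U ⊓ H : Submodule (ZMod 2) V) + 1 := by
    refine finrank_le_of_index_two fun t ht ht' u hu hu' => ?_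
    simp only [Submodule.mem_inf, ht, hu, true_and] at ht' hu'
    exact ⟨U.add_mem ht hu, add_mem_of_finrank_le hHW hH.ge (hUW ht) ht' (hUW hu) hu'⟩
  have h2 : finrank (ZMod 2) (U ⊓ H : Submodule (ZMod 2) V) < finrank (ZMod 2) U :=
    finrank_lt_of_mem_notMem inf_le_left hv (by simp [hv'])
  omega

open Classical in
theorem card_filter_mem [Fintype V] (U : Submodule (ZMod 2) V) :
    (Finset.univ.filter fun v : V => v ∈ U).card = 2 ^ finrank (ZMod 2) U := by
  have h := Module.card_eq_pow_finrank (K := ZMod 2) (V := U)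
  rw [ZMod.card] at h
  rw [← h, Fintype.card_subtype]

open Classical in
theorem card_filter_mem_notMem [Fintype V] {U H : Submodule (ZMod 2) V}
    (h : finrank (ZMod 2) (U ⊓ H : Submodule (ZMod 2) V) + 1 = finrank (ZMod 2) U) :
    (Finset.univ.filter fun v : V => v ∈ U ∧ v ∉ H).card = 2 ^ (finrank (ZMod 2) U - 1) := by
  have h1 := card_filter_mem U
  have h2 := card_filter_mem (U ⊓ H)
  have h3 := Finset.card_filter_add_card_filter_not (s := Finset.univ.filter fun v : V => v ∈ U)
    (fun v => v ∈ H)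
  rw [Finset.filter_filter, Finset.filter_filter] at h3
  simp only [Submodule.mem_inf] at h2
  rw [h1, h2, ← h, pow_succ] at h3
  rw [← h, Nat.add_sub_cancel]
  omega

open Classical in
/-- A subspace with a point off the hyperplane `h = 0` has half of its vectors there. -/
theorem card_filter_mem_eq_one [Fintype V] {U : Submodule (ZMod 2) V} {h : V →ₗ[ZMod 2] ZMod 2}
    {v : V} (hv : v ∈ U) (hh : h v = 1) :
    (Finset.univ.filter fun v : V => v ∈ U ∧ h v = 1).card = 2 ^ (finrank (ZMod 2) U - 1) := by
  rw [← card_filter_mem_notMem (finrank_inf_ker_add_one hv hh)]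
  congr 1; ext v
  simp [zmod_two_ne_zero]

/-- A set of points off a hyperplane that is closed under the sum of three of its points consists of
all such points of the subspace it spans. -/
theorem mem_span_iff_of_ternary {h : V →ₗ[ZMod 2] ZMod 2} {S : Set V} (hS : ∀ v ∈ S, h v = 1)
    (hS3 : ∀ x ∈ S, ∀ y ∈ S, ∀ z ∈ S, x + y + z ∈ S) {v : V} (hv : h v = 1) :
    v ∈ Submodule.span (ZMod 2) S ↔ v ∈ S := by
  refine ⟨fun hmem => ?_, fun hmem => Submodule.subset_span hmem⟩
  have key : ∀ w ∈ Submodule.span (ZMod 2) S,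
      (h w = 1 ∧ w ∈ S) ∨ (h w = 0 ∧ ∀ s ∈ S, s + w ∈ S) := by
    intro w hw
    induction hw using Submodule.span_induction with
    | mem x hx => exact Or.inl ⟨hS x hx, hx⟩
    | zero => exact Or.inr ⟨map_zero h, fun s hs => by simpa using hs⟩
    | add x y _ _ hx hy =>
      rcases hx with ⟨hx, hx'⟩ | ⟨hx, hx'⟩ <;> rcases hy with ⟨hy, hy'⟩ | ⟨hy, hy'⟩
      · refine Or.inr ⟨by rw [map_add, hx, hy]; decide, fun s hs => ?_⟩
        rw [← add_assoc]; exact hS3 s hs x hx' y hy'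
      · exact Or.inl ⟨by rw [map_add, hx, hy]; decide, hy' x hx'⟩
      · exact Or.inl ⟨by rw [map_add, hx, hy]; decide, by rw [add_comm]; exact hx' y hy'⟩
      · refine Or.inr ⟨by rw [map_add, hx, hy]; decide, fun s hs => ?_⟩
        rw [← add_assoc]; exact hy' _ (hx' s hs)
    | smul c x _ hx =>
      rcases zmod_two_eq_zero_or_one c with rfl | rfl
      · exact Or.inr ⟨by simp, fun s hs => by simpa using hs⟩
      · simpa using hx
  rcases key v hmem with h' | h'
  · exact h'.2
  · exact absurd (hv.symm.trans h'.1) (by decide)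

end CharTwo

/-! ### Partitions of an affine space into flats -/

section Partition

variable {V : Type*} [AddCommGroup V] [Module (ZMod 2) V]

/-- The elements of `𝒰` partition the affine space `{v | h v = 1}`: over the field with two
elements, the points off the hyperplane `h = 0` are the vectors `v` with `h v = 1`. No element is
the whole space. -/
structure IsAffinePartition (h : V →ₗ[ZMod 2] ZMod 2) (𝒰 : Finset (Submodule (ZMod 2) V)) :
    Prop where
  exists_point : ∀ U ∈ 𝒰, ∃ v ∈ U, h v = 1
  exists_mem : ∀ v, h v = 1 → ∃ U ∈ 𝒰, v ∈ U
  eq_of_mem : ∀ U ∈ 𝒰, ∀ U' ∈ 𝒰, ∀ v, h v = 1 → v ∈ U → v ∈ U' → U = U'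
  exists_notMem : ∀ U ∈ 𝒰, ∃ v, h v = 1 ∧ v ∉ U

/-- Every flat of the affine space `{v | h v = 1}` that is a union of at least two elements of `𝒰`
is the whole affine space. Flats are sets of points closed under the sum of three points. -/
def IsAffineIrreducible (h : V →ₗ[ZMod 2] ZMod 2) (𝒰 : Finset (Submodule (ZMod 2) V)) : Prop :=
  ∀ S : Set V, (∀ v ∈ S, h v = 1) → (∀ x ∈ S, ∀ y ∈ S, ∀ z ∈ S, x + y + z ∈ S) →
    (∀ U ∈ 𝒰, ∀ v ∈ U, v ∈ S → ∀ w ∈ U, h w = 1 → w ∈ S) →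
    ∀ U ∈ 𝒰, ∀ U' ∈ 𝒰, U ≠ U' → ∀ u ∈ U, ∀ u' ∈ U', u ∈ S → u' ∈ S → ∀ v, h v = 1 → v ∈ S

/-- The one-dimensional subspaces are the spans of their nonzero vectors. -/
theorem eq_span_singleton_of_finrank_one [Finite V] {P : Submodule (ZMod 2) V}
    (hP : finrank (ZMod 2) P = 1) {v : V} (hv : v ∈ P) (hv0 : v ≠ 0) :
    P = Submodule.span (ZMod 2) {v} := by
  refine (Submodule.eq_of_le_of_finrank_eq ?_ ?_).symm
  · simpa [Submodule.span_le] using hv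
  · rw [finrank_span_singleton hv0, hP]

theorem ne_zero_of_map_eq_one {h : V →ₗ[ZMod 2] ZMod 2} {v : V} (hv : h v = 1) : v ≠ 0 := by
  rintro rfl
  rw [map_zero] at hv
  exact absurd hv (by decide)

theorem point_add_point {h : V →ₗ[ZMod 2] ZMod 2} {u v : V} (hu : h u = 1) (hv : h v = 1) :
    h (u + v) = 0 := by
  rw [map_add, hu, hv]; decide

theorem point_add_direction {h : V →ₗ[ZMod 2] ZMod 2} {u v : V} (hu : h u = 1) (hv : h v = 0) :
    h (u + v) = 1 := by
  rw [map_add, hu, hv]; decide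

theorem point_add_point_add_point {h : V →ₗ[ZMod 2] ZMod 2} {u v w : V} (hu : h u = 1)
    (hv : h v = 1) (hw : h w = 1) : h (u + v + w) = 1 := by
  rw [map_add, map_add, hu, hv, hw]; decide

/-- A subspace with a point off the hyperplane `h = 0` is spanned by such points. -/
theorem le_of_forall_point_mem {h : V →ₗ[ZMod 2] ZMod 2} {U W : Submodule (ZMod 2) V} {u : V}
    (hu : u ∈ U) (hu1 : h u = 1) (hUW : ∀ w ∈ U, h w = 1 → w ∈ W) : U ≤ W := by
  intro t ht
  rcases zmod_two_eq_zero_or_one (h t) with h0 | h1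
  · have h2 := W.add_mem (hUW u hu hu1) (hUW (u + t) (U.add_mem hu ht) (point_add_direction hu1 h0))
    rwa [add_add_cancel_self_two] at h2
  · exact hUW t ht h1

open Classical in
/-- For an irreducible avsp, the flats that are unions of at least two elements are trivial. -/
theorem isAffineIrreducible_of_not_reducible [Finite V] {h : V →ₗ[ZMod 2] ZMod 2}
    {𝒰 : Finset (Submodule (ZMod 2) V)} (hp : IsAffinePartition h 𝒰)
    (hred : ¬ IsReducibleAVSP 𝒰) : IsAffineIrreducible h 𝒰 := by
  intro S hS hS3 hsat U hU U' hU' hne u hu u' hu' huS hu'S v0 hv0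
  by_contra hv0S
  apply hred
  set W := Submodule.span (ZMod 2) S with hW
  have hmem : ∀ v, h v = 1 → (v ∈ W ↔ v ∈ S) := fun v hv => mem_span_iff_of_ternary hS hS3 hv
  have hle : ∀ X ∈ 𝒰, ∀ x ∈ X, x ∈ S → X ≤ W := fun X hX x hx hxS =>
    le_of_forall_point_mem hx (hS x hxS) fun w hw hw1 =>
      (hmem w hw1).2 (hsat X hX x hx hxS w hw hw1)
  refine ⟨W, 𝒰.filter (· ≤ W), ?_, ?_, ?_, ?_, W ⊓ LinearMap.ker h, inf_le_left, ?_, ?_, ?_⟩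
  · refine Finset.filter_ssubset.2 ?_
    obtain ⟨X, hX, hv0X⟩ := hp.exists_mem v0 hv0
    exact ⟨X, hX, fun hXW => hv0S ((hmem v0 hv0).1 (hXW hv0X))⟩
  · rw [← finrank_top (ZMod 2) V]
    exact finrank_lt_of_mem_notMem le_top (Submodule.mem_top (x := v0))
      fun hh => hv0S ((hmem v0 hv0).1 hh)
  · exact Finset.one_lt_card.2 ⟨U, by simp [hU, hle U hU u hu huS], U',
      by simp [hU', hle U' hU' u' hu' hu'S], hne⟩
  · intro X hX
    obtain ⟨hX, hXW⟩ := Finset.mem_filter.1 hX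
    obtain ⟨x, hx, hx1⟩ := hp.exists_point X hX
    refine ⟨hXW, one_le_finrank_of_mem hx (ne_zero_of_map_eq_one hx1),
      Submodule.finrank_lt_finrank_of_lt (lt_of_le_of_ne hXW ?_)⟩
    intro hXW'
    have h1 := hp.eq_of_mem X hX U hU u (hS u huS) (hXW' ▸ (hmem u (hS u huS)).2 huS) hu
    have h2 := hp.eq_of_mem X hX U' hU' u' (hS u' hu'S)
      (hXW' ▸ (hmem u' (hS u' hu'S)).2 hu'S) hu'
    exact hne (h1.symm.trans h2)
  · exact finrank_inf_ker_add_one ((hmem u (hS u huS)).2 huS) (hS u huS)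
  · intro X hX hXH
    obtain ⟨x, hx, hx1⟩ := hp.exists_point X (Finset.mem_filter.1 hX).1
    have := LinearMap.mem_ker.1 (hXH hx).2
    rw [hx1] at this
    exact absurd this (by decide)
  · intro P hPW hP1 hPH
    obtain ⟨v, hv, hvH⟩ := SetLike.not_le_iff_exists.1 hPH
    have hv1 : h v = 1 := by
      simpa [hPW hv, zmod_two_ne_zero] using hvH
    have hPv := eq_span_singleton_of_finrank_one hP1 hv (ne_zero_of_map_eq_one hv1)
    have hiff : ∀ X : Submodule (ZMod 2) V, P ≤ X ↔ v ∈ X := fun X => by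
      rw [hPv]; simp [Submodule.span_le]
    obtain ⟨X, hX, hvX⟩ := hp.exists_mem v hv1
    refine ⟨X, ⟨Finset.mem_filter.2 ⟨hX, hle X hX v hvX ((hmem v hv1).1 (hPW hv))⟩,
      (hiff X).2 hvX⟩, fun Y hY => ?_⟩
    exact hp.eq_of_mem Y (Finset.mem_filter.1 hY.1).1 X hX v hv1 ((hiff Y).1 hY.2) hvX

/-- The affine form of a tight irreducible avsp. -/
theorem IsTightIrreducibleAVSP.exists_functional [Finite V]
    {𝒰 : Finset (Submodule (ZMod 2) V)} (h𝒰 : IsTightIrreducibleAVSP 𝒰) :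
    ∃ h : V →ₗ[ZMod 2] ZMod 2, IsAffinePartition h 𝒰 ∧ IsAffineIrreducible h 𝒰 ∧
      (∃ v, h v = 1) ∧ ∀ t ≠ 0, ∃ U ∈ 𝒰, t ∉ U := by
  obtain ⟨⟨hdim, H, -, hH, hUH, hcov⟩, htight, hred⟩ := h𝒰
  rw [finrank_top] at hH
  have hHtop : H < ⊤ := by
    rw [lt_top_iff_ne_top]; rintro rfl
    rw [finrank_top] at hH; omega
  obtain ⟨x, -, hx⟩ := SetLike.exists_of_lt hHtop
  obtain ⟨h, hx1, hHh⟩ := exists_functional_eq_one hx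
  have hker : H = LinearMap.ker h := by
    refine Submodule.eq_of_le_of_finrank_eq hHh ?_
    have := finrank_inf_ker_add_one (Submodule.mem_top (R := ZMod 2) (x := x)) hx1
    rw [finrank_top, top_inf_eq] at this
    omega
  have hmem : ∀ v, v ∉ H ↔ h v = 1 := fun v => by rw [hker, LinearMap.mem_ker, zmod_two_ne_zero]
  have hspan : ∀ (v : V) (U : Submodule (ZMod 2) V),
      Submodule.span (ZMod 2) {v} ≤ U ↔ v ∈ U := fun v U => by simp [Submodule.span_le]
  have hcov' : ∀ v, h v = 1 → ∃! U, U ∈ 𝒰 ∧ v ∈ U := by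
    intro v hv
    simpa only [hspan] using hcov (Submodule.span (ZMod 2) {v}) le_top
      (finrank_span_singleton (ne_zero_of_map_eq_one hv)) (by rw [hspan, hmem]; exact hv)
  have hp : IsAffinePartition h 𝒰 := by
    refine ⟨fun U hU => ?_, fun v hv => ?_, fun U hU U' hU' v hv hvU hvU' => ?_, fun U hU => ?_⟩
    · obtain ⟨v, hv, hv'⟩ := SetLike.not_le_iff_exists.1 (hUH U hU)
      exact ⟨v, hv, (hmem v).1 hv'⟩
    · obtain ⟨U, hU, -⟩ := hcov' v hv
      exact ⟨U, hU⟩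
    · exact (hcov' v hv).unique ⟨hU, hvU⟩ ⟨hU', hvU'⟩
    · by_contra! hcon
      have : (⊤ : Submodule (ZMod 2) V) ≤ U :=
        le_of_forall_point_mem (Submodule.mem_top (x := x)) hx1 fun w _ hw => hcon w hw
      have h1 := (hdim U hU).2.2
      have h2 := Submodule.finrank_mono this
      omega
  refine ⟨h, hp, isAffineIrreducible_of_not_reducible hp hred, ⟨x, hx1⟩, fun t ht => ?_⟩
  by_contra! hcon
  exact htight ⟨Submodule.span (ZMod 2) {t}, finrank_span_singleton ht,
    fun U hU => (hspan t U).2 (hcon U hU)⟩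

open Classical in
/-- An affine partition without a common direction and without nontrivial flats that are unions of
elements is a tight irreducible avsp. In a reducible avsp, the hyperplane at infinity of the
subspace may differ from the one induced by `h`; comparing the numbers of points off the two
hyperplanes shows that the elements also cover all points of the subspace off `h = 0`. -/
theorem IsAffinePartition.isTightIrreducibleAVSP [Fintype V] {h : V →ₗ[ZMod 2] ZMod 2}
    {𝒰 : Finset (Submodule (ZMod 2) V)} (hp : IsAffinePartition h 𝒰)
    (hirr : IsAffineIrreducible h 𝒰) (hx : ∃ v, h v = 1) (ht : ∀ t ≠ 0, ∃ U ∈ 𝒰, t ∉ U) :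
    IsTightIrreducibleAVSP 𝒰 := by
  obtain ⟨x, hx⟩ := hx
  refine ⟨⟨fun U hU => ⟨le_top, ?_, ?_⟩, LinearMap.ker h, le_top, ?_, fun U hU hUH => ?_,
    fun P _ hP1 hPH => ?_⟩, ?_, ?_⟩
  · obtain ⟨v, hv, hv1⟩ := hp.exists_point U hU
    exact one_le_finrank_of_mem hv (ne_zero_of_map_eq_one hv1)
  · obtain ⟨v, -, hvU⟩ := hp.exists_notMem U hU
    exact finrank_lt_of_mem_notMem le_top (Submodule.mem_top (x := v)) hvU
  · have := finrank_inf_ker_add_one (Submodule.mem_top (R := ZMod 2) (x := x)) hx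
    rwa [top_inf_eq] at this
  · obtain ⟨v, hv, hv1⟩ := hp.exists_point U hU
    have := hUH hv
    rw [LinearMap.mem_ker, hv1] at this
    exact absurd this (by decide)
  · obtain ⟨v, hv, hvH⟩ := SetLike.not_le_iff_exists.1 hPH
    rw [LinearMap.mem_ker, zmod_two_ne_zero] at hvH
    have hPv := eq_span_singleton_of_finrank_one hP1 hv (ne_zero_of_map_eq_one hvH)
    have hiff : ∀ X : Submodule (ZMod 2) V, P ≤ X ↔ v ∈ X := fun X => by
      rw [hPv]; simp [Submodule.span_le]
    obtain ⟨X, hX, hvX⟩ := hp.exists_mem v hvH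
    exact ⟨X, ⟨hX, (hiff X).2 hvX⟩, fun Y hY =>
      hp.eq_of_mem Y hY.1 X hX v hvH ((hiff Y).1 hY.2) hvX⟩
  · rintro ⟨P, hP1, hP⟩
    obtain ⟨t, htP, ht0⟩ := exists_mem_ne_zero_of_finrank (D := P) (by omega)
    obtain ⟨U, hU, htU⟩ := ht t ht0
    exact htU (hP U hU htP)
  · rintro ⟨W, T, hT𝒰, hWlt, hTcard, hTdim, H, hHW, hH, hTH, hTcov⟩
    obtain ⟨U, hU, U', hU', hne⟩ := Finset.one_lt_card.1 hTcard
    have hT : ∀ X ∈ T, X ∈ 𝒰 := fun X hX => hT𝒰.1 hX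
    obtain ⟨u, hu, hu1⟩ := hp.exists_point U (hT U hU)
    obtain ⟨u', hu', hu'1⟩ := hp.exists_point U' (hT U' hU')
    have hcard : ∀ X ∈ T, (Finset.univ.filter fun v : V => v ∈ X ∧ v ∉ H).card =
        (Finset.univ.filter fun v : V => v ∈ X ∧ h v = 1).card := by
      intro X hX
      obtain ⟨v, hv, hv1⟩ := hp.exists_point X (hT X hX)
      rw [card_filter_mem_eq_one hv hv1, card_filter_mem_notMem
        (finrank_inf_add_one_of_not_le (hTdim X hX).1 hHW hH (hTH X hX))]
    -- The points of `W` off `H` lie in elements of `T`.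
    have hWH : (Finset.univ.filter fun v : V => v ∈ W ∧ v ∉ H) ⊆
        T.biUnion fun X => Finset.univ.filter fun v : V => v ∈ X ∧ v ∉ H := by
      intro v hv
      simp only [Finset.mem_filter, Finset.mem_univ, true_and] at hv
      have hv0 : v ≠ 0 := by rintro rfl; exact hv.2 H.zero_mem
      have hspan : ∀ X : Submodule (ZMod 2) V, Submodule.span (ZMod 2) {v} ≤ X ↔ v ∈ X :=
        fun X => by simp [Submodule.span_le]
      obtain ⟨X, ⟨hX, hvX⟩, -⟩ := hTcov (Submodule.span (ZMod 2) {v}) ((hspan W).2 hv.1)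
        (finrank_span_singleton hv0) (by rw [hspan]; exact hv.2)
      simp only [Finset.mem_biUnion, Finset.mem_filter, Finset.mem_univ, true_and]
      exact ⟨X, hX, (hspan X).1 hvX, hv.2⟩
    have hWne : ¬ W ≤ H := fun hh => hTH U hU ((hTdim U hU).1.trans hh)
    have hle : (Finset.univ.filter fun v : V => v ∈ W ∧ h v = 1).card ≤
        (T.biUnion fun X => Finset.univ.filter fun v : V => v ∈ X ∧ h v = 1).card := by
      calc _ = (Finset.univ.filter fun v : V => v ∈ W ∧ v ∉ H).card := by
            rw [card_filter_mem_eq_one ((hTdim U hU).1 hu) hu1, card_filter_mem_notMem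
              (finrank_inf_add_one_of_not_le le_rfl hHW hH hWne)]
        _ ≤ _ := Finset.card_le_card hWH
        _ ≤ ∑ X ∈ T, (Finset.univ.filter fun v : V => v ∈ X ∧ v ∉ H).card :=
            Finset.card_biUnion_le
        _ = ∑ X ∈ T, (Finset.univ.filter fun v : V => v ∈ X ∧ h v = 1).card :=
            Finset.sum_congr rfl hcard
        _ = _ := by
            refine (Finset.card_biUnion fun X hX Y hY hXY => ?_).symm
            refine Finset.disjoint_left.2 fun v hvX hvY => hXY ?_
            simp only [Finset.mem_filter, Finset.mem_univ, true_and] at hvX hvY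
            exact hp.eq_of_mem X (hT X hX) Y (hT Y hY) v hvX.2 hvX.1 hvY.1
    have hsub : (T.biUnion fun X => Finset.univ.filter fun v : V => v ∈ X ∧ h v = 1) ⊆
        Finset.univ.filter fun v : V => v ∈ W ∧ h v = 1 := by
      intro v hv
      simp only [Finset.mem_biUnion, Finset.mem_filter, Finset.mem_univ, true_and] at hv ⊢
      obtain ⟨X, hX, hvX, hv1⟩ := hv
      exact ⟨(hTdim X hX).1 hvX, hv1⟩
    have heq := Finset.eq_of_subset_of_card_le hsub hle
    have hcovW : ∀ v ∈ W, h v = 1 → ∃ X ∈ T, v ∈ X := by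
      intro v hv hv1
      have : v ∈ Finset.univ.filter fun v : V => v ∈ W ∧ h v = 1 := by simp [hv, hv1]
      rw [← heq] at this
      simp only [Finset.mem_biUnion, Finset.mem_filter, Finset.mem_univ, true_and] at this
      obtain ⟨X, hX, hvX, -⟩ := this
      exact ⟨X, hX, hvX⟩
    have hall := hirr {v | v ∈ W ∧ h v = 1} (fun v hv => hv.2)
      (fun a ha b hb c hc => ⟨W.add_mem (W.add_mem ha.1 hb.1) hc.1,
        point_add_point_add_point ha.2 hb.2 hc.2⟩)
      (fun X hX v hvX hv w hw hw1 => ⟨by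
        obtain ⟨Y, hY, hvY⟩ := hcovW v hv.1 hv.2
        rw [hp.eq_of_mem X hX Y (hT Y hY) v hv.2 hvX hvY] at hw
        exact (hTdim Y hY).1 hw, hw1⟩)
      U (hT U hU) U' (hT U' hU') hne u hu u' hu' ⟨(hTdim U hU).1 hu, hu1⟩
      ⟨(hTdim U' hU').1 hu', hu'1⟩
    have htop : (⊤ : Submodule (ZMod 2) V) ≤ W :=
      le_of_forall_point_mem (Submodule.mem_top (x := x)) hx fun w _ hw => (hall w hw).1
    have := Submodule.finrank_mono htop
    rw [finrank_top] at this
    omega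

end Partition

/-! ### Point counts and subspaces of large codimension -/

section Counting

variable {V : Type*} [AddCommGroup V] [Module (ZMod 2) V]

/-- Equalities up to characteristic two, in the form in which `match_scalars` sees the scalars of
`ZMod 2`. -/
theorem eq_of_one_smul_eq {v w : V} (h : (1 : ZMod 2) • v = (1 : ZMod 2) • w) : v = w := by
  simpa using h

theorem mem_of_one_smul_eq {U : Submodule (ZMod 2) V} {v w : V} (hw : w ∈ U)
    (h : (1 : ZMod 2) • v = (1 : ZMod 2) • w) : v ∈ U :=
  eq_of_one_smul_eq h ▸ hw

/-- Two elements with the same directions form a flat, which is not the whole space as soon as there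
is a third element. -/
theorem IsAffineIrreducible.not_parallel {h : V →ₗ[ZMod 2] ZMod 2}
    {𝒰 : Finset (Submodule (ZMod 2) V)} (hirr : IsAffineIrreducible h 𝒰)
    (hp : IsAffinePartition h 𝒰) {U U' X : Submodule (ZMod 2) V} (hU : U ∈ 𝒰) (hU' : U' ∈ 𝒰)
    (hX : X ∈ 𝒰) (hne : U ≠ U') (hXU : X ≠ U) (hXU' : X ≠ U')
    (hdir : ∀ t, h t = 0 → (t ∈ U ↔ t ∈ U')) : False := by
  obtain ⟨u, hu, hu1⟩ := hp.exists_point U hU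
  obtain ⟨u', hu', hu'1⟩ := hp.exists_point U' hU'
  obtain ⟨x, hx, hx1⟩ := hp.exists_point X hX
  have hd : ∀ a ∈ U, ∀ b ∈ U, h a = 1 → h b = 1 → a + b ∈ U' := fun a ha b hb ha1 hb1 =>
    (hdir _ (point_add_point ha1 hb1)).1 (U.add_mem ha hb)
  have hd' : ∀ a ∈ U', ∀ b ∈ U', h a = 1 → h b = 1 → a + b ∈ U := fun a ha b hb ha1 hb1 =>
    (hdir _ (point_add_point ha1 hb1)).2 (U'.add_mem ha hb)
  have := hirr {v | h v = 1 ∧ (v ∈ U ∨ v ∈ U')} (fun v hv => hv.1) ?_ ?_ U hU U' hU' hne u hu u' hu'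
    ⟨hu1, Or.inl hu⟩ ⟨hu'1, Or.inr hu'⟩ x hx1
  · rcases this.2 with h1 | h1
    · exact hXU (hp.eq_of_mem X hX U hU x hx1 hx h1)
    · exact hXU' (hp.eq_of_mem X hX U' hU' x hx1 hx h1)
  · rintro a ⟨ha1, ha⟩ b ⟨hb1, hb⟩ c ⟨hc1, hc⟩
    refine ⟨point_add_point_add_point ha1 hb1 hc1, ?_⟩
    rcases ha with ha | ha <;> rcases hb with hb | hb <;> rcases hc with hc | hc
    · exact Or.inl (U.add_mem (U.add_mem ha hb) hc)
    · exact Or.inr (U'.add_mem (hd a ha b hb ha1 hb1) hc)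
    · refine Or.inr (mem_of_one_smul_eq (U'.add_mem (hd a ha c hc ha1 hc1) hb) ?_)
      match_scalars <;> decide
    · refine Or.inl (mem_of_one_smul_eq (U.add_mem (hd' b hb c hc hb1 hc1) ha) ?_)
      match_scalars <;> decide
    · refine Or.inr (mem_of_one_smul_eq (U'.add_mem (hd b hb c hc hb1 hc1) ha) ?_)
      match_scalars <;> decide
    · refine Or.inl (mem_of_one_smul_eq (U.add_mem (hd' a ha c hc ha1 hc1) hb) ?_)
      match_scalars <;> decide
    · exact Or.inl (U.add_mem (hd' a ha b hb ha1 hb1) hc)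
    · exact Or.inr (U'.add_mem (U'.add_mem ha hb) hc)
  · rintro Y hY v hvY ⟨hv1, hv⟩ w hw hw1
    refine ⟨hw1, ?_⟩
    rcases hv with hv | hv
    · exact Or.inl (hp.eq_of_mem Y hY U hU v hv1 hvY hv ▸ hw)
    · exact Or.inr (hp.eq_of_mem Y hY U' hU' v hv1 hvY hv ▸ hw)

theorem exists_functional_ne {x y : V} (hxy : x ≠ y) :
    ∃ f : V →ₗ[ZMod 2] ZMod 2, f x ≠ f y := by
  obtain ⟨f, hf, -⟩ := exists_functional_eq_one (D := (⊥ : Submodule (ZMod 2) V)) (t := x + y)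
    (fun h0 => hxy (eq_of_add_eq_zero_two (by simpa using h0)))
  refine ⟨f, fun he => ?_⟩
  rw [map_add, he, ZModModule.add_self] at hf
  exact absurd hf (by decide)

theorem exists_functional_separating {x y z w : V} (hwx : w ≠ x) (hwy : w ≠ y) (hwz : w ≠ z)
    (hw : w ≠ x + y + z) : ∃ f : V →ₗ[ZMod 2] ZMod 2, f y = f x ∧ f z = f x ∧ f w ≠ f x := by
  have hD : w + x ∉ Submodule.span (ZMod 2) {x + y, x + z} := by
    intro hmem
    obtain ⟨a, b, hab⟩ := Submodule.mem_span_pair.1 hmem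
    have hw' : w = x + (a • (x + y) + b • (x + z)) := by
      rw [hab, add_comm w, add_add_cancel_self_two]
    rcases zmod_two_eq_zero_or_one a with rfl | rfl <;>
      rcases zmod_two_eq_zero_or_one b with rfl | rfl
    · exact hwx (by simpa using hw')
    · exact hwz (by simpa [add_add_cancel_self_two] using hw')
    · exact hwy (by simpa [add_add_cancel_self_two] using hw')
    · refine hw (hw'.trans (eq_of_one_smul_eq ?_))
      match_scalars <;> decide
  obtain ⟨f, hf, hf0⟩ := exists_functional_eq_one hD
  have key : ∀ v, f (x + v) = 0 → f v = f x := fun v hv => by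
    rw [map_add] at hv
    exact (eq_of_add_eq_zero_two hv).symm
  refine ⟨f, key y (hf0 _ (Submodule.subset_span (by simp))),
    key z (hf0 _ (Submodule.subset_span (by simp))), fun he => ?_⟩
  rw [map_add, he, ZModModule.add_self] at hf
  exact absurd hf (by decide)

theorem zmod_two_eq_of_ne {a b c : ZMod 2} (hab : a ≠ c) (hbc : b ≠ c) : a = b := by
  revert a b c; decide

variable [Fintype V]

open Classical in
theorem IsAffinePartition.sum_card_filter {h : V →ₗ[ZMod 2] ZMod 2}
    {𝒰 : Finset (Submodule (ZMod 2) V)} (hp : IsAffinePartition h 𝒰)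
    {𝒮 : Finset (Submodule (ZMod 2) V)} (h𝒮 : 𝒮 ⊆ 𝒰) (P : V → Prop) :
    ∑ U ∈ 𝒮, (Finset.univ.filter fun v : V => (v ∈ U ∧ h v = 1) ∧ P v).card =
      (Finset.univ.filter fun v : V => (h v = 1 ∧ ∃ U ∈ 𝒮, v ∈ U) ∧ P v).card := by
  rw [← Finset.card_biUnion]
  · congr 1
    ext v
    simp only [Finset.mem_biUnion, Finset.mem_filter, Finset.mem_univ, true_and]
    constructor
    · rintro ⟨U, hU, ⟨hv, hv1⟩, hP⟩
      exact ⟨⟨hv1, U, hU, hv⟩, hP⟩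
    · rintro ⟨⟨hv1, U, hU, hv⟩, hP⟩
      exact ⟨U, hU, ⟨hv, hv1⟩, hP⟩
  · intro U hU U' hU' hne
    refine Finset.disjoint_left.2 fun v hv hv' => hne ?_
    simp only [Finset.mem_filter, Finset.mem_univ, true_and] at hv hv'
    exact hp.eq_of_mem U (h𝒮 hU) U' (h𝒮 hU') v hv.1.2 hv.1.1 hv'.1.1

/-- The number of points of some of the elements. -/
theorem IsAffinePartition.sum_two_pow {h : V →ₗ[ZMod 2] ZMod 2}
    {𝒰 : Finset (Submodule (ZMod 2) V)} (hp : IsAffinePartition h 𝒰)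
    {𝒮 : Finset (Submodule (ZMod 2) V)} (h𝒮 : 𝒮 ⊆ 𝒰) :
    ∑ U ∈ 𝒮, 2 ^ (finrank (ZMod 2) U - 1) =
      by classical exact (Finset.univ.filter fun v : V => h v = 1 ∧ ∃ U ∈ 𝒮, v ∈ U).card := by
  classical
  have := hp.sum_card_filter h𝒮 fun _ => True
  simp only [and_true] at this
  refine Eq.trans (Finset.sum_congr rfl fun U hU => ?_) this
  obtain ⟨v, hv, hv1⟩ := hp.exists_point U (h𝒮 hU)
  exact (card_filter_mem_eq_one hv hv1).symm

open Classical in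
/-- A set of vectors meets every subspace of codimension at most `k` in an even number of vectors:
as a binary codeword, it is orthogonal to the Reed–Muller code of order `k`. -/
def MeetsEvenly (k : ℕ) (S : Finset V) : Prop :=
  ∀ K : Submodule (ZMod 2) V, finrank (ZMod 2) V ≤ finrank (ZMod 2) K + k →
    Even (S.filter (· ∈ K)).card

theorem MeetsEvenly.filter_functional {h : V →ₗ[ZMod 2] ZMod 2} {k : ℕ} {S : Finset V}
    (hS : ∀ v ∈ S, h v = 1) (hev : MeetsEvenly (k + 1) S) (f : V →ₗ[ZMod 2] ZMod 2) (c : ZMod 2) :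
    MeetsEvenly k (S.filter fun v => f v = c) := by
  classical
  intro K hK
  rcases zmod_two_eq_zero_or_one c with rfl | rfl
  · have h1 := finrank_inf_ker_le K f
    convert hev (K ⊓ LinearMap.ker f) (by omega) using 2
    ext v
    simp only [Finset.mem_filter, Submodule.mem_inf, LinearMap.mem_ker]
    tauto
  · have h1 := finrank_inf_ker_le K (f + h)
    convert hev (K ⊓ LinearMap.ker (f + h)) (by omega) using 2
    ext v
    simp only [Finset.mem_filter, Submodule.mem_inf, LinearMap.mem_ker, LinearMap.add_apply]
    constructor
    · rintro ⟨⟨hv, hf⟩, hvK⟩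
      exact ⟨hv, hvK, by rw [hf, hS v hv]; decide⟩
    · rintro ⟨hv, hvK, hf⟩
      rw [hS v hv] at hf
      exact ⟨⟨hv, by revert hf; generalize f v = c; revert c; decide⟩, hvK⟩

/-- The minimum distance of the Reed–Muller codes, with the first step of the description of the
codewords of minimum weight: they are flats. -/
theorem MeetsEvenly.two_pow_le_card {h : V →ₗ[ZMod 2] ZMod 2} (k : ℕ) :
    ∀ {S : Finset V}, (∀ v ∈ S, h v = 1) → MeetsEvenly k S → S.Nonempty →
      2 ^ (k + 1) ≤ S.card ∧ (S.card = 2 ^ (k + 1) →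
        ∀ x ∈ S, ∀ y ∈ S, ∀ z ∈ S, x + y + z ∈ S) := by
  classical
  have hpair : ∀ {k : ℕ} {S : Finset V}, MeetsEvenly k S → S.Nonempty → 2 ≤ S.card := by
    intro k S hev hne
    have h1 := hev ⊤ (by rw [finrank_top]; omega)
    simp only [Submodule.mem_top, Finset.filter_true] at h1
    have := hne.card_pos
    obtain ⟨r, hr⟩ := h1
    omega
  induction k with
  | zero =>
    intro S hS hev hne
    refine ⟨by simpa using hpair hev hne, fun hcard x hx y hy z hz => ?_⟩
    have hsub : ¬ ({x, y, z} : Finset V).card = 3 := fun h3 => by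
      have := Finset.card_le_card (show ({x, y, z} : Finset V) ⊆ S by
        intro v hv; simp only [Finset.mem_insert, Finset.mem_singleton] at hv
        rcases hv with rfl | rfl | rfl <;> assumption)
      omega
    by_cases hxy : x = y
    · subst hxy; rwa [ZModModule.add_self, zero_add]
    by_cases hxz : x = z
    · subst hxz; rwa [add_comm x y, add_assoc, ZModModule.add_self, add_zero]
    by_cases hyz : y = z
    · subst hyz; rwa [add_assoc, ZModModule.add_self, add_zero]
    exact absurd (Finset.card_eq_three.2 ⟨x, y, z, hxy, hxz, hyz, rfl⟩) hsub
  | succ k ih =>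
    intro S hS hev hne
    have hhalf : ∀ f : V →ₗ[ZMod 2] ZMod 2, ∀ v ∈ S, ∀ w ∈ S, f w ≠ f v →
        2 ^ (k + 1) ≤ (S.filter fun u => f u = f w).card ∧
        (S.filter fun u => f u = f v).card + (S.filter fun u => f u = f w).card = S.card := by
      intro f v hv w hw hvw
      refine ⟨(ih (fun u hu => hS u (Finset.mem_filter.1 hu).1) (hev.filter_functional hS f _)
        ⟨w, Finset.mem_filter.2 ⟨hw, rfl⟩⟩).1, ?_⟩
      rw [← Finset.card_filter_add_card_filter_not (s := S) (fun u => f u = f v)]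
      congr 2
      ext u
      simp only [Finset.mem_filter, and_congr_right_iff]
      intro _
      exact ⟨fun hu hu' => hvw (hu.symm.trans hu'), fun hu => zmod_two_eq_of_ne hu hvw⟩
    refine ⟨?_, fun hcard x hx y hy z hz => ?_⟩
    · obtain ⟨x, hx, y, hy, hxy⟩ := Finset.one_lt_card.1 (hpair hev hne)
      obtain ⟨f, hf⟩ := exists_functional_ne hxy
      have h1 := hhalf f x hx y hy hf.symm
      have h2 := hhalf f y hy x hx hf
      rw [pow_succ]
      omega
    · by_cases hsub : S ⊆ {x, y, z, x + y + z}
      · have h4 : ({x, y, z, x + y + z} : Finset V).card ≤ S.card := by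
          refine Finset.card_le_four.trans ?_
          rw [hcard, pow_succ, pow_succ]
          have := Nat.one_le_two_pow (n := k)
          omega
        rw [Finset.eq_of_subset_of_card_le hsub h4]
        simp
      · obtain ⟨w, hw, hw'⟩ := Finset.not_subset.1 hsub
        simp only [Finset.mem_insert, Finset.mem_singleton, not_or] at hw'
        obtain ⟨f, hfy, hfz, hfw⟩ := exists_functional_separating hw'.1 hw'.2.1 hw'.2.2.1 hw'.2.2.2
        have h1 := hhalf f x hx w hw hfw
        have h2 := hhalf f w hw x hx hfw.symm
        have h3 := ih (fun u hu => hS u (Finset.mem_filter.1 hu).1) 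
          (hev.filter_functional hS f (f x)) ⟨x, Finset.mem_filter.2 ⟨hx, rfl⟩⟩
        rw [pow_succ] at hcard
        exact (Finset.mem_filter.1 (h3.2 (by omega) x (Finset.mem_filter.2 ⟨hx, rfl⟩)
          y (Finset.mem_filter.2 ⟨hy, hfy⟩) z (Finset.mem_filter.2 ⟨hz, hfz⟩))).1

open Classical in
/-- A subspace of dimension at least `k + 2` meets the subspaces of codimension `k` in dimension at
least two, hence in an even number of points. -/
theorem even_card_filter_mem {h : V →ₗ[ZMod 2] ZMod 2} {k : ℕ} {U K : Submodule (ZMod 2) V}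
    (hU : k + 2 ≤ finrank (ZMod 2) U) (hK : finrank (ZMod 2) V ≤ finrank (ZMod 2) K + k) :
    Even (Finset.univ.filter fun v : V => (v ∈ U ∧ h v = 1) ∧ v ∈ K).card := by
  have h1 := Submodule.finrank_sup_add_finrank_inf_eq U K
  have h2 := Submodule.finrank_le (U ⊔ K)
  have heq : (Finset.univ.filter fun v : V => (v ∈ U ∧ h v = 1) ∧ v ∈ K) =
      Finset.univ.filter fun v : V => v ∈ U ⊓ K ∧ h v = 1 := by
    ext v
    simp only [Finset.mem_filter, Submodule.mem_inf]
    tauto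
  rw [heq]
  by_cases hv : ∃ v ∈ U ⊓ K, h v = 1
  · obtain ⟨v, hv, hv1⟩ := hv
    rw [card_filter_mem_eq_one hv hv1]
    exact (Nat.even_pow).2 ⟨even_two, by omega⟩
  · rw [Finset.filter_eq_empty_iff.2 fun v _ hh => hv ⟨v, hh⟩]
    simp

/-- The numbers of points of the elements of dimension at most `d` of an irreducible partition: if
there are such elements, then they have more than `2 ^ d` points. -/
theorem IsAffineIrreducible.two_pow_lt_sum {h : V →ₗ[ZMod 2] ZMod 2}
    {𝒰 : Finset (Submodule (ZMod 2) V)} (hirr : IsAffineIrreducible h 𝒰)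
    (hp : IsAffinePartition h 𝒰) {d : ℕ} (hd : 1 ≤ d) (hdV : d + 2 ≤ finrank (ZMod 2) V)
    (hh : ∃ v, h v = 1) {U : Submodule (ZMod 2) V} (hU : U ∈ 𝒰) (hUd : finrank (ZMod 2) U ≤ d) :
    2 ^ d < ∑ X ∈ 𝒰.filter (fun X : Submodule (ZMod 2) V => finrank (ZMod 2) X ≤ d),
      2 ^ (finrank (ZMod 2) X - 1) := by
  classical
  obtain ⟨k, rfl⟩ : ∃ k, d = k + 1 := ⟨d - 1, by omega⟩
  set 𝒮 := 𝒰.filter fun X : Submodule (ZMod 2) V => finrank (ZMod 2) X ≤ k + 1 with h𝒮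
  set S := Finset.univ.filter fun v : V => h v = 1 ∧ ∃ X ∈ 𝒮, v ∈ X with hSdef
  have hsum : ∑ X ∈ 𝒮, 2 ^ (finrank (ZMod 2) X - 1) = S.card :=
    (hp.sum_two_pow (Finset.filter_subset _ _)).trans (by congr!)
  have hS : ∀ v ∈ S, h v = 1 := fun v hv => (Finset.mem_filter.1 hv).2.1
  have hev : MeetsEvenly k S := by
    intro K hK
    have h1 := hp.sum_card_filter (Finset.Subset.refl 𝒰) (· ∈ K)
    rw [← Finset.sum_filter_add_sum_filter_not 𝒰
      (fun X : Submodule (ZMod 2) V => finrank (ZMod 2) X ≤ k + 1), ← h𝒮,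
      hp.sum_card_filter (Finset.filter_subset _ _)] at h1
    have h2 : Even (∑ X ∈ 𝒰.filter fun X : Submodule (ZMod 2) V => ¬ finrank (ZMod 2) X ≤ k + 1,
        (Finset.univ.filter fun v : V => (v ∈ X ∧ h v = 1) ∧ v ∈ K).card) :=
      Finset.even_sum _ fun X hX => even_card_filter_mem
        (by have := (Finset.mem_filter.1 hX).2; omega) hK
    have h3 : Even (Finset.univ.filter fun v : V => (h v = 1 ∧ ∃ X ∈ 𝒰, v ∈ X) ∧ v ∈ K).card := by
      convert even_card_filter_mem (h := h) (U := ⊤) (K := K) (k := k)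
        (by rw [finrank_top]; omega) hK using 4 with v
      constructor
      · exact fun hv => ⟨Submodule.mem_top, hv.1⟩
      · exact fun hv => ⟨hv.2, hp.exists_mem v hv.2⟩
    rw [← h1] at h3
    rw [hSdef, Finset.filter_filter]
    exact (Nat.even_add.1 h3).2 h2
  obtain ⟨u, hu, hu1⟩ := hp.exists_point U hU
  have hUS : U ∈ 𝒮 := Finset.mem_filter.2 ⟨hU, hUd⟩
  have huS : u ∈ S := Finset.mem_filter.2 ⟨Finset.mem_univ _, hu1, U, hUS, hu⟩
  have hmin := hev.two_pow_le_card k hS ⟨u, huS⟩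
  rw [hsum]
  refine lt_of_le_of_ne hmin.1 fun hcard => ?_
  -- a single element of dimension at most `d` has at most `2 ^ (d - 1)` points
  have htwo : ∃ X ∈ 𝒮, X ≠ U := by
    by_contra! hcon
    have : 𝒮 = {U} := Finset.eq_singleton_iff_unique_mem.2 ⟨hUS, hcon⟩
    rw [this, Finset.sum_singleton] at hsum
    have h1 : 2 ^ (finrank (ZMod 2) U - 1) < 2 ^ (k + 1) :=
      Nat.pow_lt_pow_right one_lt_two (by omega)
    omega
  obtain ⟨X, hX, hXU⟩ := htwo
  obtain ⟨x, hx, hx1⟩ := hp.exists_point X (Finset.mem_filter.1 hX).1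
  obtain ⟨v, hv⟩ := hh
  have hall := hirr {v | v ∈ S} hS (hmin.2 hcard.symm)
    (fun Y hY v hvY hvS w hw hw1 => by
      obtain ⟨-, hv1, Z, hZ, hvZ⟩ := Finset.mem_filter.1 hvS
      have := hp.eq_of_mem Y hY Z (Finset.mem_filter.1 hZ).1 v hv1 hvY hvZ
      exact Finset.mem_filter.2 ⟨Finset.mem_univ _, hw1, Z, hZ, this ▸ hw⟩)
    X (Finset.mem_filter.1 hX).1 U hU hXU x hx u hu
    (Finset.mem_filter.2 ⟨Finset.mem_univ _, hx1, X, hX, hx⟩) huS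
  have hcV := card_filter_mem_eq_one (Submodule.mem_top (R := ZMod 2) (x := v)) hv
  have hle := Finset.card_le_card (show (Finset.univ.filter fun v : V =>
    v ∈ (⊤ : Submodule (ZMod 2) V) ∧ h v = 1) ⊆ S from
      fun w hw => hall w (Finset.mem_filter.1 hw).2.2)
  rw [hcV, finrank_top, ← hcard] at hle
  have := (Nat.pow_le_pow_iff_right one_lt_two).1 hle
  omega

end Counting

/-! ### Elements of a partition modulo a space of directions -/

section Classes

variable {V : Type*} [AddCommGroup V] [Module (ZMod 2) V] {h : V →ₗ[ZMod 2] ZMod 2}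
  {𝒰 : Finset (Submodule (ZMod 2) V)}

/-- If two different elements have points in the same class modulo `T`, then the difference of these
points is no sum of directions of the elements, as otherwise the elements would meet. -/
theorem IsAffinePartition.add_notMem_sup (hp : IsAffinePartition h 𝒰) {T : Submodule (ZMod 2) V}
    (hT : ∀ t ∈ T, h t = 0) {E E' : Submodule (ZMod 2) V} (hE : E ∈ 𝒰) (hE' : E' ∈ 𝒰)
    (hne : E ≠ E') {x y : V} (hx : x ∈ E) (hx1 : h x = 1) (hy : y ∈ E') :
    x + y ∉ E ⊓ T ⊔ E' ⊓ T := by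
  intro hmem
  obtain ⟨d, hd, d', hd', hdd⟩ := Submodule.mem_sup.1 hmem
  refine hne (hp.eq_of_mem E hE E' hE' (x + d) (point_add_direction hx1 (hT d hd.2))
    (E.add_mem hx hd.1) (mem_of_one_smul_eq (E'.add_mem hy hd'.1) ?_))
  have : x = d + d' + y := by rw [hdd, add_assoc, ZModModule.add_self, add_zero]
  rw [this]
  match_scalars <;> decide

variable [Fintype V]

/-- The half lemma: an element with half of the directions of `T` contains the directions in `T` of
the other elements that have a point in the same class. -/
theorem IsAffinePartition.mem_of_codim_one (hp : IsAffinePartition h 𝒰)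
    {T : Submodule (ZMod 2) V} (hT : ∀ t ∈ T, h t = 0) {E E' : Submodule (ZMod 2) V} (hE : E ∈ 𝒰)
    (hE' : E' ∈ 𝒰) (hET : finrank (ZMod 2) T ≤ finrank (ZMod 2) (E ⊓ T : Submodule (ZMod 2) V) + 1)
    {x y : V} (hx : x ∈ E) (hx1 : h x = 1) (hy : y ∈ E') (hxy : x + y ∈ T) {t : V}
    (ht : t ∈ E') (htT : t ∈ T) : t ∈ E := by
  rcases eq_or_ne E E' with rfl | hne
  · exact ht
  by_contra htE
  have hsup := hp.add_notMem_sup hT hE hE' hne hx hx1 hy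
  have h1 := add_mem_of_finrank_le (D' := E ⊓ T) inf_le_right hET htT (fun hh => htE hh.1) hxy
    (fun hh => hsup (Submodule.mem_sup_left hh))
  refine hsup (mem_of_one_smul_eq (Submodule.add_mem_sup h1
    (show t ∈ E' ⊓ T from ⟨ht, htT⟩)) ?_)
  match_scalars <;> decide

theorem IsAffinePartition.exists_mem_inf (hp : IsAffinePartition h 𝒰)
    {T : Submodule (ZMod 2) V} (hT : ∀ t ∈ T, h t = 0) {E E' : Submodule (ZMod 2) V} (hE : E ∈ 𝒰)
    (hE' : E' ∈ 𝒰) (hET : finrank (ZMod 2) T ≤ finrank (ZMod 2) (E ⊓ T : Submodule (ZMod 2) V) +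
      finrank (ZMod 2) (E' ⊓ T : Submodule (ZMod 2) V))
    (hT0 : 0 < finrank (ZMod 2) (E ⊓ T : Submodule (ZMod 2) V))
    {x y : V} (hx : x ∈ E) (hx1 : h x = 1) (hy : y ∈ E') (hxy : x + y ∈ T) :
    ∃ t ∈ T, t ≠ 0 ∧ t ∈ E ∧ t ∈ E' := by
  rcases eq_or_ne E E' with rfl | hne
  · obtain ⟨t, ht, ht0⟩ := exists_mem_ne_zero_of_finrank hT0
    exact ⟨t, ht.2, ht0, ht.1, ht.1⟩
  have h1 := Submodule.finrank_sup_add_finrank_inf_eq (E ⊓ T) (E' ⊓ T)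
  have h2 : finrank (ZMod 2) (E ⊓ T ⊔ E' ⊓ T : Submodule (ZMod 2) V) < finrank (ZMod 2) T :=
    finrank_lt_of_mem_notMem (sup_le inf_le_right inf_le_right) hxy
      (hp.add_notMem_sup hT hE hE' hne hx hx1 hy)
  obtain ⟨t, ht, ht0⟩ := exists_mem_ne_zero_of_finrank
    (D := (E ⊓ T ⊓ (E' ⊓ T) : Submodule (ZMod 2) V)) (by omega)
  exact ⟨t, ht.1.2, ht0, ht.1.1, ht.2.1⟩

/-- Elements with at least `2 ^ r` points in the same class modulo `T`. -/
theorem IsAffinePartition.card_mul_two_pow_le (hp : IsAffinePartition h 𝒰)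
    {T : Submodule (ZMod 2) V} (hT : ∀ t ∈ T, h t = 0) {s : Finset (Submodule (ZMod 2) V)}
    (hs : s ⊆ 𝒰) {r : ℕ} {x : V}
    (hr : ∀ E ∈ s, r ≤ finrank (ZMod 2) (E ⊓ T : Submodule (ZMod 2) V) ∧
      ∃ y ∈ E, h y = 1 ∧ x + y ∈ T) :
    s.card * 2 ^ r ≤ 2 ^ finrank (ZMod 2) T := by
  classical
  calc s.card * 2 ^ r
      ≤ ∑ E ∈ s, (Finset.univ.filter fun v : V => (v ∈ E ∧ h v = 1) ∧ x + v ∈ T).card := by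
        rw [← smul_eq_mul]
        refine Finset.card_nsmul_le_sum _ _ _ fun E hE => ?_
        obtain ⟨hrE, y, hy, hy1, hxy⟩ := hr E hE
        refine (Nat.pow_le_pow_right two_pos hrE).trans ?_
        rw [← card_filter_mem]
        refine Finset.card_le_card_of_injOn (fun t => y + t) ?_
          (fun a _ b _ hab => add_left_cancel hab)
        intro t ht
        have ht : t ∈ E ⊓ T := by simpa using ht
        simp only [Finset.coe_filter, Finset.mem_univ, true_and, Set.mem_ofPred_eq]
        exact ⟨⟨E.add_mem hy ht.1, point_add_direction hy1 (hT t ht.2)⟩, by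
          rw [← add_assoc]; exact T.add_mem hxy ht.2⟩
    _ = _ := hp.sum_card_filter hs _
    _ ≤ 2 ^ finrank (ZMod 2) T := by
        rw [← card_filter_mem]
        refine Finset.card_le_card_of_injOn (fun v => x + v) ?_
          (fun a _ b _ hab => add_left_cancel hab)
        intro v hv
        simp only [Finset.coe_filter, Finset.mem_univ, true_and, Set.mem_ofPred_eq] at hv ⊢
        exact hv.2

/-- If at most four elements have points in a class modulo `T`, and any two of them have a common
nonzero direction in `T`, then all of them do: the traces of the elements on the directions in `T`
of any one of them form a chain. -/
theorem IsAffinePartition.exists_common_direction (hp : IsAffinePartition h 𝒰)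
    {T : Submodule (ZMod 2) V} (hT : ∀ t ∈ T, h t = 0) {s : Finset (Submodule (ZMod 2) V)}
    (hs : s ⊆ 𝒰) {x : V} (hsx : ∀ E ∈ s, ∃ y ∈ E, h y = 1 ∧ x + y ∈ T)
    (hsx' : ∀ E ∈ 𝒰, ∀ y ∈ E, h y = 1 → x + y ∈ T → E ∈ s) (hcard : s.card ≤ 4)
    (hmeet : ∀ E ∈ s, ∀ E' ∈ s, ∃ t ∈ T, t ≠ 0 ∧ t ∈ E ∧ t ∈ E') (hne : s.Nonempty) :
    ∃ p ∈ T, p ≠ 0 ∧ ∀ E ∈ s, p ∈ E := by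
  classical
  obtain ⟨E₁, hE₁⟩ := hne
  obtain ⟨E₂, hE₂, hmin⟩ := Finset.exists_min_image s
    (fun E => finrank (ZMod 2) (E₁ ⊓ T ⊓ E : Submodule (ZMod 2) V)) ⟨E₁, hE₁⟩
  obtain ⟨p, hpT, hp0, hpE₁, hpE₂⟩ := hmeet E₁ hE₁ E₂ hE₂
  refine ⟨p, hpT, hp0, fun E₃ hE₃ => ?_⟩
  by_contra hpE₃
  -- the points `z + c` and `z + b + c`, for a point `z` of `E`, belong to further elements
  have key : ∀ E ∈ s, ∀ E' ∈ s, ∀ b ∈ T, ∀ c ∈ T, b ∈ E₁ → c ∈ E₁ → b ∈ E → b ∉ E' → c ∈ E' →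
      c ∉ E → ∃ G ∈ s, ∃ G' ∈ s, ∃ z, z + c ∈ G ∧ z + b + c ∈ G' ∧ (G ≠ E ∧ G ≠ E' ∧ G ≠ E₁) ∧
        (G' ≠ E ∧ G' ≠ E' ∧ G' ≠ E₁) ∧ z ∈ E ∧ h z = 1 := by
    intro E hE E' hE' b hbT c hcT hb₁ hc₁ hbE hbE' hcE' hcE
    obtain ⟨z, hz, hz1, hxz⟩ := hsx E hE
    have hoff : ∀ w ∈ E, h w = 1 → ∀ X ∈ s, w + c ∈ X → X ≠ E ∧ X ≠ E' ∧ X ≠ E₁ := by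
      intro w hw hw1 X hX hwX
      have hcan : w + c + c = w := by rw [add_assoc, ZModModule.add_self, add_zero]
      refine ⟨?_, ?_, ?_⟩
      · rintro rfl
        exact hcE (add_add_cancel_self_two w c ▸ X.add_mem hw hwX)
      · rintro rfl
        have hwX' : w ∈ X := hcan ▸ X.add_mem hwX hcE'
        have := hp.eq_of_mem E (hs hE) X (hs hX) w hw1 hw hwX'
        exact hbE' (this ▸ hbE)
      · rintro rfl
        have hwX' : w ∈ X := hcan ▸ X.add_mem hwX hc₁
        have := hp.eq_of_mem E (hs hE) X (hs hX) w hw1 hw hwX'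
        exact hcE (this ▸ hc₁)
    have hzc1 : h (z + c) = 1 := point_add_direction hz1 (hT c hcT)
    have hzb1 : h (z + b) = 1 := point_add_direction hz1 (hT b hbT)
    have hzbc1 : h (z + b + c) = 1 := point_add_direction hzb1 (hT c hcT)
    obtain ⟨G, hG, hzG⟩ := hp.exists_mem _ hzc1
    obtain ⟨G', hG', hzG'⟩ := hp.exists_mem _ hzbc1
    have hGs := hsx' G hG _ hzG hzc1 (by rw [← add_assoc]; exact T.add_mem hxz hcT)
    have hGs' := hsx' G' hG' _ hzG' hzbc1 (by
      rw [← add_assoc, ← add_assoc]; exact T.add_mem (T.add_mem hxz hbT) hcT)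
    exact ⟨G, hGs, G', hGs', z, hzG, hzG', hoff z hz hz1 G hGs hzG,
      hoff (z + b) (E.add_mem hz hbE) hzb1 G' hGs' hzG', hz, hz1⟩
  have hc : ∃ c ∈ T, c ∈ E₁ ∧ c ∈ E₃ ∧ c ∉ E₂ := by
    by_contra! hcon
    have hle : E₁ ⊓ T ⊓ E₃ ≤ E₁ ⊓ T ⊓ E₂ := fun c hc => ⟨hc.1, hcon c hc.1.2 hc.1.1 hc.2⟩
    have := finrank_lt_of_mem_notMem (D' := E₁ ⊓ T ⊓ E₃) (D := E₁ ⊓ T ⊓ E₂) hle (t := p)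
      ⟨⟨hpE₁, hpT⟩, hpE₂⟩ (fun hh => hpE₃ hh.2)
    have := hmin E₃ hE₃
    omega
  obtain ⟨c, hcT, hcE₁, hcE₃, hcE₂⟩ := hc
  have h12 : E₁ ≠ E₂ := by rintro rfl; exact hcE₂ hcE₁
  have h13 : E₁ ≠ E₃ := by rintro rfl; exact hpE₃ hpE₁
  have h23 : E₂ ≠ E₃ := by rintro rfl; exact hpE₃ hpE₂
  -- there is at most one element besides the three
  have huniq : ∀ G ∈ s, G ≠ E₁ → G ≠ E₂ → G ≠ E₃ → ∀ G' ∈ s, G' ≠ E₁ → G' ≠ E₂ → G' ≠ E₃ →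
      G = G' := by
    intro G hG h1 h2 h3 G' hG' h1' h2' h3'
    by_contra hGG'
    have h5 : ({E₁, E₂, E₃, G, G'} : Finset (Submodule (ZMod 2) V)).card = 5 := by
      simp [*, h1.symm, h2.symm, h3.symm, h1'.symm, h2'.symm, h3'.symm]
    have hsub : ({E₁, E₂, E₃, G, G'} : Finset (Submodule (ZMod 2) V)) ⊆ s := by
      intro X hX
      simp only [Finset.mem_insert, Finset.mem_singleton] at hX
      rcases hX with rfl | rfl | rfl | rfl | rfl <;> assumption
    have := Finset.card_le_card hsub
    omega
  obtain ⟨G, hG, G', hG', z, hzG, hzG', ⟨hG2, hG3, hG1⟩, ⟨hG2', hG3', hG1'⟩, hz, hz1⟩ :=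
    key E₂ hE₂ E₃ hE₃ p hpT c hcT hpE₁ hcE₁ hpE₂ hpE₃ hcE₃ hcE₂
  obtain ⟨J, hJ, J', hJ', w, hwJ, hwJ', ⟨hJ3, hJ2, hJ1⟩, ⟨hJ3', hJ2', hJ1'⟩, hw, hw1⟩ :=
    key E₃ hE₃ E₂ hE₂ c hcT p hpT hcE₁ hpE₁ hcE₃ hcE₂ hpE₂ hpE₃
  obtain rfl := huniq G hG hG1 hG2 hG3 G' hG' hG1' hG2' hG3'
  obtain rfl := huniq G hG hG1 hG2 hG3 J hJ hJ1 hJ2 hJ3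
  obtain rfl := huniq G hG hG1 hG2 hG3 J' hJ' hJ1' hJ2' hJ3'
  have hcG : c ∈ G := mem_of_one_smul_eq (G.add_mem hwJ hwJ') (by match_scalars <;> decide)
  have hzG2 : z ∈ G := mem_of_one_smul_eq (G.add_mem hzG hcG) (by match_scalars <;> decide)
  exact hG2 (hp.eq_of_mem G (hs hG) E₂ (hs hE₂) z hz1 hzG2 hz)

/-- An element with points in at most two classes modulo `T` has its directions in `T` up to
codimension one. -/
theorem finrank_le_of_two_classes {T X : Submodule (ZMod 2) V} {x : V}
    (hx : x ∈ X) (hx1 : h x = 1)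
    (hX : ∀ y ∈ X, h y = 1 → ∀ z ∈ X, h z = 1 → x + y ∈ T ∨ x + z ∈ T ∨ y + z ∈ T) :
    finrank (ZMod 2) (X ⊓ LinearMap.ker h : Submodule (ZMod 2) V) ≤
      finrank (ZMod 2) (X ⊓ T : Submodule (ZMod 2) V) + 1 := by
  refine finrank_le_of_index_two fun t ht ht' u hu hu' => ⟨X.add_mem ht.1 hu.1, ?_⟩
  have ht1 : t ∉ T := fun hh => ht' ⟨ht.1, hh⟩
  have hu1 : u ∉ T := fun hh => hu' ⟨hu.1, hh⟩
  rcases hX (x + t) (X.add_mem hx ht.1) (point_add_direction hx1 ht.2) (x + u)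
    (X.add_mem hx hu.1) (point_add_direction hx1 hu.2) with h1 | h1 | h1
  · exact absurd (add_add_cancel_self_two x t ▸ h1) ht1
  · exact absurd (add_add_cancel_self_two x u ▸ h1) hu1
  · exact mem_of_one_smul_eq h1 (by match_scalars <;> decide)

/-- An element with too few directions in `T` has points in different classes. -/
theorem exists_add_notMem {T X : Submodule (ZMod 2) V} {x : V} (hx : x ∈ X) (hx1 : h x = 1)
    (hX : finrank (ZMod 2) (X ⊓ T : Submodule (ZMod 2) V) + 2 ≤ finrank (ZMod 2) X) :
    ∃ y ∈ X, h y = 1 ∧ x + y ∉ T := by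
  by_contra! hcon
  have h1 : X ⊓ LinearMap.ker h ≤ X ⊓ T := fun t ht => ⟨ht.1, by
    have := hcon (x + t) (X.add_mem hx ht.1) (point_add_direction hx1 ht.2)
    rwa [add_add_cancel_self_two] at this⟩
  have h2 := Submodule.finrank_mono h1
  have h3 := finrank_inf_ker_add_one hx hx1
  omega

/-- Two elements of the same dimension are equal if one of them has a direction outside of `T` in
common with the other and its directions in `T` belong to the other: they would be parallel. -/
theorem IsAffineIrreducible.eq_of_directions (hirr : IsAffineIrreducible h 𝒰)
    (hp : IsAffinePartition h 𝒰) {T G G' X : Submodule (ZMod 2) V} (hG : G ∈ 𝒰)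
    (hG' : G' ∈ 𝒰) (hX : X ∈ 𝒰) (hXG : X ≠ G) (hXG' : X ≠ G')
    (hdim : finrank (ZMod 2) G' = finrank (ZMod 2) G)
    (hGT : finrank (ZMod 2) G ≤ finrank (ZMod 2) (G ⊓ T : Submodule (ZMod 2) V) + 2)
    (hT : ∀ t ∈ T, h t = 0) (hd : ∀ t ∈ G, t ∈ T → t ∈ G') {u : V} (hu : u ∈ G) (hu0 : h u = 0)
    (huT : u ∉ T) (huG' : u ∈ G') : G = G' := by
  by_contra hne
  obtain ⟨g, hg, hg1⟩ := hp.exists_point G hG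
  obtain ⟨g', hg', hg'1⟩ := hp.exists_point G' hG'
  have h1 := finrank_inf_ker_add_one hg hg1
  have h2 := finrank_inf_ker_add_one hg' hg'1
  have hle : G ⊓ LinearMap.ker h ≤ G' ⊓ LinearMap.ker h := by
    intro t ht
    refine ⟨?_, ht.2⟩
    by_cases htT : t ∈ T
    · exact hd t ht.1 htT
    · have h3 : t + u ∈ G ⊓ T := add_mem_of_finrank_le (D' := G ⊓ T) (D := G ⊓ LinearMap.ker h)
        (fun v hv => ⟨hv.1, hT v hv.2⟩) (by omega) ht (fun hh => htT hh.2) ⟨hu, hu0⟩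
        (fun hh => huT hh.2)
      exact mem_of_one_smul_eq (G'.add_mem (hd _ h3.1 h3.2) huG') (by match_scalars <;> decide)
  have heq := Submodule.eq_of_le_of_finrank_eq hle (by omega)
  refine hirr.not_parallel hp hG hG' hX hne hXG hXG' fun t ht => ⟨fun htG => ?_, fun htG => ?_⟩
  · exact (hle ⟨htG, ht⟩).1
  · have : t ∈ G' ⊓ LinearMap.ker h := ⟨htG, ht⟩
    rw [← heq] at this
    exact this.1

end Classes

/-! ### One element of dimension five and otherwise elements of dimension four -/

section OneFive

variable {V : Type*} [AddCommGroup V] [Module (ZMod 2) V] [Fintype V]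
  {h : V →ₗ[ZMod 2] ZMod 2} {𝒰 : Finset (Submodule (ZMod 2) V)}

/-- There is no tight irreducible avsp of type `5^1 4^6`. With respect to the element `A` of
dimension five, the other points form three classes, and the elements with points in the `i`-th
class have a common direction `p i` in `A`. By tightness, any two of the three classes are met by
some element that avoids the third, and this forces two parallel elements. -/
theorem IsAffineIrreducible.false_of_one_five (hirr : IsAffineIrreducible h 𝒰)
    (hp : IsAffinePartition h 𝒰) (htight : ∀ t ≠ 0, ∃ U ∈ 𝒰, t ∉ U)
    (hV : finrank (ZMod 2) V = 7) {A : Submodule (ZMod 2) V} (hA : A ∈ 𝒰)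
    (hA5 : finrank (ZMod 2) A = 5) (h4 : ∀ E ∈ 𝒰, E ≠ A → finrank (ZMod 2) E = 4) : False := by
  classical
  obtain ⟨a, ha, ha1⟩ := hp.exists_point A hA
  set T := A ⊓ LinearMap.ker h with hTdef
  have hT4 : finrank (ZMod 2) T = 4 := by
    have : finrank (ZMod 2) T + 1 = finrank (ZMod 2) A := finrank_inf_ker_add_one ha ha1
    omega
  have hT : ∀ t ∈ T, h t = 0 := fun t ht => ht.2
  have hTA : ∀ t ∈ T, t ∈ A := fun t ht => ht.1
  have hsum : ∀ {x y}, h x = 1 → h y = 1 → x + y ∈ A → x + y ∈ T := fun hx hy hxy =>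
    ⟨hxy, point_add_point hx hy⟩
  have hoff : ∀ {x y}, x ∉ A → x + y ∈ T → y ∉ A := fun {x y} hx hxy hy =>
    hx (mem_of_one_smul_eq (A.add_mem (hTA _ hxy) hy) (by match_scalars <;> decide))
  have hEoff : ∀ {E}, E ∈ 𝒰 → E ≠ A → ∀ {x}, x ∈ E → h x = 1 → x ∉ A :=
    fun {E} hE hEA x hx hx1 hxA => hEA (hp.eq_of_mem E hE A hA x hx1 hx hxA)
  have hneA : ∀ {E}, ∀ {x}, x ∈ E → x ∉ A → E ≠ A := by
    rintro E x hx hxA rfl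
    exact hxA hx
  have hclass : ∀ {E}, E ∈ 𝒰 → E ≠ A → ∀ x ∈ E, h x = 1 → ∀ y ∈ E, h y = 1 → ∀ z ∈ E, h z = 1 →
      x + y ∈ T ∨ x + z ∈ T ∨ y + z ∈ T := by
    intro E hE hEA x hx hx1 y hy hy1 z hz hz1
    rcases add_mem_of_codim_two (by omega) (hEoff hE hEA hx hx1) (hEoff hE hEA hy hy1)
      (hEoff hE hEA hz hz1) with h1 | h1 | h1 | h1
    · exact Or.inl (hsum hx1 hy1 h1)
    · exact Or.inr (Or.inl (hsum hx1 hz1 h1))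
    · exact Or.inr (Or.inr (hsum hy1 hz1 h1))
    · exact absurd h1 (hEoff hE hEA (E.add_mem (E.add_mem hx hy) hz)
        (point_add_point_add_point hx1 hy1 hz1))
  have hrank : ∀ {E}, E ∈ 𝒰 → E ≠ A →
      2 ≤ finrank (ZMod 2) (E ⊓ T : Submodule (ZMod 2) V) := by
    intro E hE hEA
    obtain ⟨x, hx, hx1⟩ := hp.exists_point E hE
    have h1 := finrank_le_of_two_classes hx hx1 (hclass hE hEA x hx hx1)
    have h2 := finrank_inf_ker_add_one hx hx1
    have h3 := h4 E hE hEA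
    omega
  have hcard : ∀ {s : Finset (Submodule (ZMod 2) V)} {x : V}, x ∉ A → s ⊆ 𝒰 →
      (∀ E ∈ s, ∃ y ∈ E, h y = 1 ∧ x + y ∈ T) → s.card ≤ 4 := by
    intro s x hxA hs hsx
    have := hp.card_mul_two_pow_le hT hs (r := 2) (x := x) fun E hE => by
      obtain ⟨y, hy, hy1, hxy⟩ := hsx E hE
      exact ⟨hrank (hs hE) (hneA hy (hoff hxA hxy)), y, hy, hy1, hxy⟩
    rw [hT4] at this
    omega
  -- the common direction of the elements with points in the class of `x`
  have hcommon : ∀ x, h x = 1 → x ∉ A → ∃ p ∈ T, p ≠ 0 ∧ ∀ E ∈ 𝒰, ∀ y ∈ E, h y = 1 → x + y ∈ T →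
      p ∈ E := by
    intro x hx1 hxA
    have hs : 𝒰.filter (fun E => ∃ y ∈ E, h y = 1 ∧ x + y ∈ T) ⊆ 𝒰 := Finset.filter_subset _ _
    obtain ⟨X, hX, hxX⟩ := hp.exists_mem x hx1
    obtain ⟨p, hpT, hp0, hpE⟩ := hp.exists_common_direction hT hs (x := x)
      (fun E hE => (Finset.mem_filter.1 hE).2)
      (fun E hE y hy hy1 hxy => Finset.mem_filter.2 ⟨hE, y, hy, hy1, hxy⟩)
      (hcard hxA hs fun E hE => (Finset.mem_filter.1 hE).2)
      (fun E hE E' hE' => by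
        obtain ⟨hE, y, hy, hy1, hxy⟩ := Finset.mem_filter.1 hE
        obtain ⟨hE', y', hy', hy'1, hxy'⟩ := Finset.mem_filter.1 hE'
        have h1 := hrank hE (hneA hy (hoff hxA hxy))
        have h2 := hrank hE' (hneA hy' (hoff hxA hxy'))
        exact hp.exists_mem_inf hT hE hE' (by omega) (by omega) hy hy1 hy'
          (mem_of_one_smul_eq (T.add_mem hxy hxy') (by match_scalars <;> decide)))
      ⟨X, Finset.mem_filter.2 ⟨hX, x, hxX, hx1, by rw [ZModModule.add_self]; exact T.zero_mem⟩⟩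
    exact ⟨p, hpT, hp0, fun E hE y hy hy1 hxy =>
      hpE E (Finset.mem_filter.2 ⟨hE, y, hy, hy1, hxy⟩)⟩
  -- an element within one class contains the directions in `T` of the other elements in this class
  have hhalf : ∀ {S E}, S ∈ 𝒰 → E ∈ 𝒰 → 3 ≤ finrank (ZMod 2) (S ⊓ T : Submodule (ZMod 2) V) →
      ∀ {x y}, x ∈ S → h x = 1 → y ∈ E → x + y ∈ T → ∀ {t}, t ∈ E → t ∈ T → t ∈ S :=
    fun hS hE hS3 x y hx hx1 hy hxy t ht htT =>
      hp.mem_of_codim_one hT hS hE (by omega) hx hx1 hy hxy ht htT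
  have hdouble : ∀ {S}, S ∈ 𝒰 → S ≠ A → ∀ {x}, x ∈ S → h x = 1 →
      ∃ E ∈ 𝒰, finrank (ZMod 2) (E ⊓ T : Submodule (ZMod 2) V) ≤ 2 ∧ ∃ y ∈ E, h y = 1 ∧
        x + y ∈ T := by
    intro S hS hSA x hx hx1
    by_contra! hcon
    have hxA := hEoff hS hSA hx hx1
    obtain ⟨t, htT, htS⟩ : ∃ t ∈ T, t ∉ S := by
      by_contra! hle
      have h1 := finrank_lt_of_mem_notMem (D' := T) (D := S) hle hx fun hh => by
        rw [hT x hh] at hx1; exact absurd hx1 (by decide)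
      have := h4 S hS hSA
      omega
    have hxt1 := point_add_direction hx1 (hT t htT)
    obtain ⟨S', hS', hxt⟩ := hp.exists_mem _ hxt1
    have := hirr {v | h v = 1 ∧ x + v ∈ T} (fun v hv => hv.1)
      (fun u hu v hv w hw => ⟨point_add_point_add_point hu.1 hv.1 hw.1,
        mem_of_one_smul_eq (T.add_mem (T.add_mem hu.2 hv.2) hw.2) (by match_scalars <;> decide)⟩)
      (fun E hE v hvE hv w hw hw1 => by
        refine ⟨hw1, ?_⟩
        by_contra hxw
        have h1 := hcon E hE
        have hEA := hneA hvE (hoff hxA hv.2)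
        have h2 := finrank_inf_ker_add_one hvE hv.1
        have h3 := h4 E hE hEA
        by_cases h5 : finrank (ZMod 2) (E ⊓ T : Submodule (ZMod 2) V) ≤ 2
        · exact h1 h5 v hvE hv.1 hv.2
        · have h6 : (E ⊓ T : Submodule (ZMod 2) V) < E ⊓ LinearMap.ker h := by
            refine SetLike.lt_iff_le_and_exists.2 ⟨fun u hu => ⟨hu.1, hT u hu.2⟩, v + w,
              ⟨E.add_mem hvE hw, point_add_point hv.1 hw1⟩, fun hh => hxw ?_⟩
            exact mem_of_one_smul_eq (T.add_mem hv.2 hh.2) (by match_scalars <;> decide)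
          have := Submodule.finrank_lt_finrank_of_lt h6
          omega)
      S hS S' hS' (by rintro rfl; exact htS (add_add_cancel_self_two x t ▸ S.add_mem hx hxt))
      x hx (x + t) hxt ⟨hx1, by rw [ZModModule.add_self]; exact T.zero_mem⟩
      ⟨hxt1, by rwa [add_add_cancel_self_two]⟩ a ha1
    exact hoff hxA this.2 ha
  have htight' : ∀ t ∈ T, t ≠ 0 → ∃ E ∈ 𝒰, E ≠ A ∧ t ∉ E ∧
      finrank (ZMod 2) (E ⊓ T : Submodule (ZMod 2) V) ≤ 2 := by
    intro t htT ht0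
    obtain ⟨S, hS, htS⟩ := htight t ht0
    have hSA : S ≠ A := by rintro rfl; exact htS (hTA t htT)
    by_cases hS2 : finrank (ZMod 2) (S ⊓ T : Submodule (ZMod 2) V) ≤ 2
    · exact ⟨S, hS, hSA, htS, hS2⟩
    obtain ⟨x, hx, hx1⟩ := hp.exists_point S hS
    obtain ⟨E, hE, hE2, y, hy, hy1, hxy⟩ := hdouble hS hSA hx hx1
    exact ⟨E, hE, hneA hy (hoff (hEoff hS hSA hx hx1) hxy),
      fun htE => htS (hhalf hS hE (by omega) hx hx1 hy hxy htE htT), hE2⟩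
  obtain ⟨x₁, hx₁, hx₁A⟩ := hp.exists_notMem A hA
  obtain ⟨p₁, hp₁T, hp₁0, hp₁⟩ := hcommon x₁ hx₁ hx₁A
  obtain ⟨E, hE, hEA, hp₁E, hE2⟩ := htight' p₁ hp₁T hp₁0
  obtain ⟨x₂, hx₂E, hx₂⟩ := hp.exists_point E hE
  obtain ⟨x₃, hx₃E, hx₃, hx₂₃⟩ := exists_add_notMem (T := T) hx₂E hx₂ (by rw [h4 E hE hEA]; omega)
  have hx₂A := hEoff hE hEA hx₂E hx₂
  have hx₃A := hEoff hE hEA hx₃E hx₃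
  have hx₁₂ : x₁ + x₂ ∉ T := fun hh => hp₁E (hp₁ E hE x₂ hx₂E hx₂ hh)
  have hx₁₃ : x₁ + x₃ ∉ T := fun hh => hp₁E (hp₁ E hE x₃ hx₃E hx₃ hh)
  obtain ⟨p₂, hp₂T, hp₂0, hp₂⟩ := hcommon x₂ hx₂ hx₂A
  obtain ⟨p₃, hp₃T, hp₃0, hp₃⟩ := hcommon x₃ hx₃ hx₃A
  have hself : ∀ x : V, x + x ∈ T := fun x => by rw [ZModModule.add_self]; exact T.zero_mem
  have hp₂E := hp₂ E hE x₂ hx₂E hx₂ (hself _)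
  have hp₃E := hp₃ E hE x₃ hx₃E hx₃ (hself _)
  have hcover : ∀ z, h z = 1 → z ∉ A → x₁ + z ∈ T ∨ x₂ + z ∈ T ∨ x₃ + z ∈ T := by
    intro z hz hzA
    rcases add_mem_of_codim_two (by omega) hx₁A hx₂A hzA with h1 | h1 | h1 | h1
    · exact absurd (hsum hx₁ hx₂ h1) hx₁₂
    · exact Or.inl (hsum hx₁ hz h1)
    · exact Or.inr (Or.inl (hsum hx₂ hz h1))
    rcases add_mem_of_codim_two (by omega) hx₁A hx₂A hx₃A with h2 | h2 | h2 | h2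
    · exact absurd (hsum hx₁ hx₂ h2) hx₁₂
    · exact absurd (hsum hx₁ hx₃ h2) hx₁₃
    · exact absurd (hsum hx₂ hx₃ h2) hx₂₃
    · exact Or.inr (Or.inr (hsum hx₃ hz
        (mem_of_one_smul_eq (A.add_mem h2 h1) (by match_scalars <;> decide))))
  have htwo : ∀ {G}, G ∈ 𝒰 → G ≠ A → finrank (ZMod 2) (G ⊓ T : Submodule (ZMod 2) V) ≤ 2 →
      ∃ y ∈ G, h y = 1 ∧ ∃ z ∈ G, h z = 1 ∧ ((x₁ + y ∈ T ∧ x₂ + z ∈ T) ∨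
        (x₁ + y ∈ T ∧ x₃ + z ∈ T) ∨ (x₂ + y ∈ T ∧ x₃ + z ∈ T)) := by
    intro G hG hGA hG2
    obtain ⟨y, hy, hy1⟩ := hp.exists_point G hG
    obtain ⟨z, hz, hz1, hyz⟩ := exists_add_notMem (T := T) hy hy1 (by rw [h4 G hG hGA]; omega)
    have hdiff : ∀ x, x + y ∈ T → x + z ∉ T := fun x h1 h2 =>
      hyz (mem_of_one_smul_eq (T.add_mem h1 h2) (by match_scalars <;> decide))
    rcases hcover y hy1 (hEoff hG hGA hy hy1) with h1 | h1 | h1 <;>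
      rcases hcover z hz1 (hEoff hG hGA hz hz1) with h2 | h2 | h2
    · exact absurd h2 (hdiff _ h1)
    · exact ⟨y, hy, hy1, z, hz, hz1, Or.inl ⟨h1, h2⟩⟩
    · exact ⟨y, hy, hy1, z, hz, hz1, Or.inr (Or.inl ⟨h1, h2⟩)⟩
    · exact ⟨z, hz, hz1, y, hy, hy1, Or.inl ⟨h2, h1⟩⟩
    · exact absurd h2 (hdiff _ h1)
    · exact ⟨y, hy, hy1, z, hz, hz1, Or.inr (Or.inr ⟨h1, h2⟩)⟩
    · exact ⟨z, hz, hz1, y, hy, hy1, Or.inr (Or.inl ⟨h2, h1⟩)⟩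
    · exact ⟨z, hz, hz1, y, hy, hy1, Or.inr (Or.inr ⟨h2, h1⟩)⟩
    · exact absurd h2 (hdiff _ h1)
  -- the elements that avoid the third class
  have hthree : ∀ {G}, G ∈ 𝒰 → G ≠ A → finrank (ZMod 2) (G ⊓ T : Submodule (ZMod 2) V) ≤ 2 →
      p₃ ∉ G → p₁ ∈ G ∧ p₂ ∈ G ∧ ∃ y ∈ G, h y = 1 ∧ x₁ + y ∈ T ∧ ∃ z ∈ G, h z = 1 ∧ x₂ + z ∈ T := by
    intro G hG hGA hG2 hp₃G
    obtain ⟨y, hy, hy1, z, hz, hz1, ⟨h1, h2⟩ | ⟨h1, h2⟩ | ⟨h1, h2⟩⟩ := htwo hG hGA hG2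
    · exact ⟨hp₁ G hG y hy hy1 h1, hp₂ G hG z hz hz1 h2, y, hy, hy1, h1, z, hz, hz1, h2⟩
    · exact absurd (hp₃ G hG z hz hz1 h2) hp₃G
    · exact absurd (hp₃ G hG z hz hz1 h2) hp₃G
  obtain ⟨F, hF, hFA, hp₂F, hF2⟩ := htight' p₂ hp₂T hp₂0
  obtain ⟨w, hw, hw1, hxw, hp₃F⟩ : ∃ w ∈ F, h w = 1 ∧ x₁ + w ∈ T ∧ p₃ ∈ F := by
    obtain ⟨y, hy, hy1, z, hz, hz1, ⟨h1, h2⟩ | ⟨h1, h2⟩ | ⟨h1, h2⟩⟩ := htwo hF hFA hF2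
    · exact absurd (hp₂ F hF z hz hz1 h2) hp₂F
    · exact ⟨y, hy, hy1, h1, hp₃ F hF z hz hz1 h2⟩
    · exact absurd (hp₂ F hF y hy hy1 h1) hp₂F
  obtain ⟨G, hG, hGA, hp₃G, hG2⟩ := htight' p₃ hp₃T hp₃0
  obtain ⟨hp₁G, hp₂G, x, hx, hx1, hxx, y, hy, hy1, hxy⟩ := hthree hG hGA hG2 hp₃G
  -- translating an element `G` that avoids `p` by `p` leads to elements that avoid `p`
  have htrans : ∀ {G z p}, G ∈ 𝒰 → G ≠ A → z ∈ G → h z = 1 → p ∈ T → p ∉ G →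
      ∃ G' ∈ 𝒰, G' ≠ A ∧ z + p ∈ G' ∧ p ∉ G' ∧ G ≠ G' ∧ h (z + p) = 1 := by
    intro G z p hG hGA hz hz1 hpT hpG
    have hzp := point_add_direction hz1 (hT p hpT)
    obtain ⟨G', hG', hzG'⟩ := hp.exists_mem _ hzp
    have hpG' : p ∉ G' := fun hh => by
      have : z ∈ G' := mem_of_one_smul_eq (G'.add_mem hzG' hh) (by match_scalars <;> decide)
      exact hpG (hp.eq_of_mem G hG G' hG' z hz1 hz this ▸ hh)
    refine ⟨G', hG', hneA hzG' fun hh => ?_, hzG', hpG', ?_, hzp⟩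
    · exact hEoff hG hGA hz hz1 (mem_of_one_smul_eq (A.add_mem hh (hTA p hpT))
        (by match_scalars <;> decide))
    · rintro rfl
      exact hpG (add_add_cancel_self_two z p ▸ G.add_mem hz hzG')
  obtain ⟨G₁, hG₁, hG₁A, hxG₁, hp₃G₁, hGG₁, hxp⟩ := htrans hG hGA hx hx1 hp₃T hp₃G
  obtain ⟨G₂, hG₂, hG₂A, hyG₂, hp₃G₂, hGG₂, hyp⟩ := htrans hG hGA hy hy1 hp₃T hp₃G
  obtain ⟨F₁, hF₁, hF₁A, hwF₁, hp₂F₁, hFF₁, hwp⟩ := htrans hF hFA hw hw1 hp₂T hp₂F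
  have hG₁2 : finrank (ZMod 2) (G₁ ⊓ T : Submodule (ZMod 2) V) ≤ 2 := by
    by_contra hcon
    refine hp₃G₁ (hhalf hG₁ hF (by omega) hxG₁ hxp hw ?_ hp₃F hp₃T)
    exact mem_of_one_smul_eq (T.add_mem (T.add_mem hxx hxw) hp₃T) (by match_scalars <;> decide)
  have hG₂2 : finrank (ZMod 2) (G₂ ⊓ T : Submodule (ZMod 2) V) ≤ 2 := by
    by_contra hcon
    refine hp₃G₂ (hhalf hG₂ hE (by omega) hyG₂ hyp hx₂E ?_ hp₃E hp₃T)
    exact mem_of_one_smul_eq (T.add_mem hxy hp₃T) (by match_scalars <;> decide)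
  obtain ⟨hp₁G₁, hp₂G₁, y₁, hy₁, hy₁1, hxy₁, -⟩ := hthree hG₁ hG₁A hG₁2 hp₃G₁
  obtain ⟨-, hp₂G₂, y₂, hy₂, hy₂1, hxy₂, -⟩ := hthree hG₂ hG₂A hG₂2 hp₃G₂
  have hG₁₂ : G₁ = G₂ := by
    by_contra hne
    have hFG : ∀ {X Y : Submodule (ZMod 2) V}, p₂ ∈ X → p₂ ∉ Y → X ≠ Y := by
      rintro X Y hX hY rfl
      exact hY hX
    have h5 : ({G, G₁, G₂, F, F₁} : Finset (Submodule (ZMod 2) V)).card = 5 := by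
      simp [hne, hGG₁, hGG₂, hFF₁, hFG hp₂G hp₂F, hFG hp₂G hp₂F₁, hFG hp₂G₁ hp₂F,
        hFG hp₂G₁ hp₂F₁, hFG hp₂G₂ hp₂F, hFG hp₂G₂ hp₂F₁]
    have := hcard (s := {G, G₁, G₂, F, F₁}) hx₁A
      (by
        intro X hX
        simp only [Finset.mem_insert, Finset.mem_singleton] at hX
        rcases hX with rfl | rfl | rfl | rfl | rfl <;> assumption)
      (by
        intro X hX
        simp only [Finset.mem_insert, Finset.mem_singleton] at hX
        rcases hX with rfl | rfl | rfl | rfl | rfl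
        · exact ⟨x, hx, hx1, hxx⟩
        · exact ⟨y₁, hy₁, hy₁1, hxy₁⟩
        · exact ⟨y₂, hy₂, hy₂1, hxy₂⟩
        · exact ⟨w, hw, hw1, hxw⟩
        · exact ⟨w + p₂, hwF₁, hwp, by rw [← add_assoc]; exact T.add_mem hxw hp₂T⟩)
    omega
  subst hG₁₂
  refine hGG₁ (hirr.eq_of_directions hp (T := T) hG hG₁ hA hGA.symm hG₁A.symm
    ((h4 G₁ hG₁ hG₁A).trans (h4 G hG hGA).symm)
    (by have := hrank hG hGA; have := h4 G hG hGA; omega) hT (fun t htG htT => ?_)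
    (u := x + y) (G.add_mem hx hy) (point_add_point hx1 hy1) (fun hh => hx₁₂ ?_)
    (mem_of_one_smul_eq (G₁.add_mem hxG₁ hyG₂) (by match_scalars <;> decide)))
  · rcases mem_of_finrank_le_two hG2 (t := t) ⟨hp₁G, hp₁T⟩ ⟨hp₂G, hp₂T⟩ hp₁0 hp₂0
      (by rintro rfl; exact hp₁E hp₂E) ⟨htG, htT⟩ with rfl | rfl | rfl | rfl
    · exact G₁.zero_mem
    · exact hp₁G₁
    · exact hp₂G₁
    · exact G₁.add_mem hp₁G₁ hp₂G₁
  · exact mem_of_one_smul_eq (T.add_mem (T.add_mem hxx hxy) hh) (by match_scalars <;> decide)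

end OneFive

/-! ### Two elements of dimension five -/

section TwoFive

variable {V : Type*} [AddCommGroup V] [Module (ZMod 2) V]
  {h : V →ₗ[ZMod 2] ZMod 2} {𝒰 : Finset (Submodule (ZMod 2) V)}

/-- The points outside of the two elements `A` and `B` that contain `T`, distributed to four classes
modulo `T` by the function `c`. Three points in different classes sum to a point of `A` or `B`. -/
structure IsFourClasses (h : V →ₗ[ZMod 2] ZMod 2) (𝒰 : Finset (Submodule (ZMod 2) V))
    (A B T : Submodule (ZMod 2) V) (c : V → Fin 4) : Prop where
  isAffinePartition : IsAffinePartition h 𝒰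
  left_mem : A ∈ 𝒰
  right_mem : B ∈ 𝒰
  le_left : T ≤ A
  le_right : T ≤ B
  map_eq_zero : ∀ t ∈ T, h t = 0
  finrank_eq : finrank (ZMod 2) T = 3
  class_eq_iff : ∀ x y, h x = 1 → x ∉ A → x ∉ B → h y = 1 → y ∉ A → y ∉ B →
    (c x = c y ↔ x + y ∈ T)
  sum_mem : ∀ x y z, h x = 1 → x ∉ A → x ∉ B → h y = 1 → y ∉ A → y ∉ B → h z = 1 → z ∉ A →
    z ∉ B → c x ≠ c y → c x ≠ c z → c y ≠ c z → x + y + z ∈ A ∨ x + y + z ∈ B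
  exists_class : ∀ i, ∃ x, h x = 1 ∧ x ∉ A ∧ x ∉ B ∧ c x = i

theorem exists_isFourClasses [Fintype V] (hirr : IsAffineIrreducible h 𝒰)
    (hp : IsAffinePartition h 𝒰) (hV : finrank (ZMod 2) V = 7) {A B X : Submodule (ZMod 2) V}
    (hA : A ∈ 𝒰) (hB : B ∈ 𝒰) (hX : X ∈ 𝒰) (hAB : A ≠ B) (hXA : X ≠ A) (hXB : X ≠ B)
    (hA5 : finrank (ZMod 2) A = 5) (hB5 : finrank (ZMod 2) B = 5) :
    ∃ c, IsFourClasses h 𝒰 A B (A ⊓ B) c := by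
  classical
  have hne : ∀ v, h v = 1 → v ∈ A → v ∈ B → False := fun v hv hvA hvB =>
    hAB (hp.eq_of_mem A hA B hB v hv hvA hvB)
  have hT : ∀ t ∈ A ⊓ B, h t = 0 := fun t ht => zmod_two_ne_one.1 fun h1 => hne t h1 ht.1 ht.2
  obtain ⟨a, ha, ha1⟩ := hp.exists_point A hA
  obtain ⟨b, hb, hb1⟩ := hp.exists_point B hB
  have hA4 := finrank_inf_ker_add_one ha ha1
  have hB4 := finrank_inf_ker_add_one hb hb1
  have hs : ∃ s ∈ A, h s = 0 ∧ s ∉ B := by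
    by_contra! hcon
    have h1 : A ⊓ LinearMap.ker h ≤ B ⊓ LinearMap.ker h := fun s hs => ⟨hcon s hs.1 hs.2, hs.2⟩
    have h2 := Submodule.eq_of_le_of_finrank_eq h1 (by omega)
    exact hirr.not_parallel hp hA hB hX hAB hXA hXB fun t ht =>
      ⟨fun htA => (h1 ⟨htA, ht⟩).1, fun htB => (h2.ge ⟨htB, ht⟩).1⟩
  obtain ⟨s, hsA, hs0, hsB⟩ := hs
  have hT3 : finrank (ZMod 2) (A ⊓ B : Submodule (ZMod 2) V) = 3 := by
    have h1 := Submodule.finrank_sup_add_finrank_inf_eq A B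
    have h2 := Submodule.finrank_le (A ⊔ B)
    have h3 := finrank_lt_of_mem_notMem (D' := A ⊓ B) (D := A ⊓ LinearMap.ker h)
      (fun v hv => ⟨hv.1, hT v hv⟩) ⟨hsA, hs0⟩ (fun hh => hsB hh.2)
    omega
  obtain ⟨t, htB, ht0, htA⟩ : ∃ t ∈ B, h t = 0 ∧ t ∉ A := by
    by_contra! hcon
    have h1 : B ⊓ LinearMap.ker h ≤ A ⊓ B := fun s hs => ⟨hcon s hs.1 hs.2, hs.1⟩
    have := Submodule.finrank_mono h1
    omega
  -- the directions of `A` and `B` modulo `T` have order two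
  have hmodA : ∀ v, h v = 0 → v ∈ A → v ∈ B ∨ v + s ∈ B := by
    intro v hv hvA
    by_cases hvB : v ∈ B
    · exact Or.inl hvB
    · exact Or.inr (add_mem_of_finrank_le (D' := A ⊓ B) (D := A ⊓ LinearMap.ker h)
        (fun v hv => ⟨hv.1, hT v hv⟩) (by omega) ⟨hvA, hv⟩ (fun hh => hvB hh.2) ⟨hsA, hs0⟩
        (fun hh => hsB hh.2)).2
  have hmodB : ∀ v, h v = 0 → v ∈ B → v ∈ A ∨ v + t ∈ A := by
    intro v hv hvB
    by_cases hvA : v ∈ A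
    · exact Or.inl hvA
    · exact Or.inr (add_mem_of_finrank_le (D' := A ⊓ B) (D := B ⊓ LinearMap.ker h)
        (fun v hv => ⟨hv.2, hT v hv⟩) (by omega) ⟨hvB, hv⟩ (fun hh => hvA hh.1) ⟨htB, ht0⟩
        (fun hh => htA hh.1)).1
  have hbA : b ∉ A := fun hh => hne b hb1 hh hb
  have haB : a ∉ B := fun hh => hne a ha1 ha hh
  have hbtA : b + t ∉ A := fun hh => hne _ (point_add_direction hb1 ht0) hh (B.add_mem hb htB)
  have hasB : a + s ∉ B := fun hh => hne _ (point_add_direction ha1 hs0) (A.add_mem ha hsA) hh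
  have hcodim : ∀ {A : Submodule (ZMod 2) V} {u v w : V}, finrank (ZMod 2) A = 5 → u ∉ A → v ∉ A →
      u + v ∉ A → w ∉ A → u + w ∈ A ∨ v + w ∈ A ∨ u + v + w ∈ A := by
    intro A u v w hA5 hu hv huv hw
    rcases add_mem_of_codim_two (by omega) hu hv hw with h1 | h1 | h1 | h1
    · exact absurd h1 huv
    · exact Or.inl h1
    · exact Or.inr (Or.inl h1)
    · exact Or.inr (Or.inr h1)
  -- representatives of the four classes
  obtain ⟨w, hw₀, hw₁, hw₂, hw₃⟩ : ∃ w : Fin 4 → V, w 0 = a + t ∧ w 1 = a + s + t ∧ w 2 = b + s ∧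
      w 3 = b + s + t := ⟨![a + t, a + s + t, b + s, b + s + t], rfl, rfl, rfl, rfl⟩
  have hw : ∀ x, h x = 1 → x ∉ A → x ∉ B → ∃ i, x + w i ∈ A ⊓ B := by
    intro x hx hxA hxB
    have key : ∀ v, h v = 0 → (v ∈ A → v + s ∈ B → v + s ∈ A ⊓ B) ∧
        (v ∈ B → v + t ∈ A → v + t ∈ A ⊓ B) := fun v hv =>
      ⟨fun h1 h2 => ⟨A.add_mem h1 hsA, h2⟩, fun h1 h2 => ⟨h2, B.add_mem h1 htB⟩⟩
    rcases hcodim hA5 htA hbA (by rwa [add_comm]) hxA with h1 | h1 | h1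
    · rcases hcodim hB5 hsB haB (by rwa [add_comm]) hxB with h2 | h2 | h2
      · exact (hne (s + t + x) (by rw [map_add, map_add, hs0, ht0, hx]; decide)
          (mem_of_one_smul_eq (A.add_mem h1 hsA) (by match_scalars <;> decide))
          (mem_of_one_smul_eq (B.add_mem h2 htB) (by match_scalars <;> decide))).elim
      · rcases hmodB _ (point_add_point ha1 hx) h2 with h3 | h3
        · exact absurd (mem_of_one_smul_eq (A.add_mem h3 ha) (by match_scalars <;> decide)) hxA
        · refine ⟨0, mem_of_one_smul_eq (show a + x + t ∈ A ⊓ B from ⟨h3, B.add_mem h2 htB⟩) ?_⟩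
          rw [hw₀]; match_scalars <;> decide
      · have h4 : h (s + a + x) = 0 := by rw [map_add, map_add, hs0, ha1, hx]; decide
        rcases hmodB _ h4 h2 with h3 | h3
        · exact absurd (mem_of_one_smul_eq (A.add_mem h3 (A.add_mem hsA ha))
            (by match_scalars <;> decide)) hxA
        · refine ⟨1, mem_of_one_smul_eq (show s + a + x + t ∈ A ⊓ B from
            ⟨h3, B.add_mem h2 htB⟩) ?_⟩
          rw [hw₁]; match_scalars <;> decide
    · rcases hmodA _ (point_add_point hb1 hx) h1 with h3 | h3
      · exact absurd (mem_of_one_smul_eq (B.add_mem h3 hb) (by match_scalars <;> decide)) hxB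
      · refine ⟨2, mem_of_one_smul_eq (show b + x + s ∈ A ⊓ B from ⟨A.add_mem h1 hsA, h3⟩) ?_⟩
        rw [hw₂]; match_scalars <;> decide
    · have h4 : h (t + b + x) = 0 := by rw [map_add, map_add, ht0, hb1, hx]; decide
      rcases hmodA _ h4 h1 with h3 | h3
      · exact absurd (mem_of_one_smul_eq (B.add_mem h3 (B.add_mem htB hb))
          (by match_scalars <;> decide)) hxB
      · refine ⟨3, mem_of_one_smul_eq (show t + b + x + s ∈ A ⊓ B from
          ⟨A.add_mem h1 hsA, h3⟩) ?_⟩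
        rw [hw₃]; match_scalars <;> decide
  -- a common point of `A` and `B` arises if two representatives from different pairs are congruent
  have hab : ∀ a' ∈ A, h a' = 1 → ∀ b' ∈ B, a' + b' ∉ A ⊓ B := fun a' ha' ha'1 b' hb' hh =>
    hne a' ha'1 ha' (mem_of_one_smul_eq (B.add_mem hh.2 hb') (by match_scalars <;> decide))
  have has1 := point_add_direction ha1 hs0
  have h01 : w 0 + w 1 ∉ A ⊓ B := fun hh => hsB
    (mem_of_one_smul_eq hh.2 (by rw [hw₀, hw₁]; match_scalars <;> decide))
  have h23 : w 2 + w 3 ∉ A ⊓ B := fun hh => htA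
    (mem_of_one_smul_eq hh.1 (by rw [hw₂, hw₃]; match_scalars <;> decide))
  have h02 : w 0 + w 2 ∉ A ⊓ B := fun hh => hab (a + s) (A.add_mem ha hsA) has1 (b + t)
    (B.add_mem hb htB) (mem_of_one_smul_eq hh (by rw [hw₀, hw₂]; match_scalars <;> decide))
  have h03 : w 0 + w 3 ∉ A ⊓ B := fun hh => hab (a + s) (A.add_mem ha hsA) has1 b
    hb (mem_of_one_smul_eq hh (by rw [hw₀, hw₃]; match_scalars <;> decide))
  have h12 : w 1 + w 2 ∉ A ⊓ B := fun hh => hab a ha ha1 (b + t)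
    (B.add_mem hb htB) (mem_of_one_smul_eq hh (by rw [hw₁, hw₂]; match_scalars <;> decide))
  have h13 : w 1 + w 3 ∉ A ⊓ B := fun hh => hab a ha ha1 b
    hb (mem_of_one_smul_eq hh (by rw [hw₁, hw₃]; match_scalars <;> decide))
  have hwne : ∀ i j, w i + w j ∈ A ⊓ B → i = j := by
    intro i j hij
    have hji := hij
    rw [add_comm] at hji
    fin_cases i <;> fin_cases j <;> first | rfl | exact absurd hij (by assumption) |
      exact absurd hji (by assumption)
  have h012 : w 0 + w 1 + w 2 ∈ B :=
    mem_of_one_smul_eq hb (by rw [hw₀, hw₁, hw₂]; match_scalars <;> decide)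
  have h013 : w 0 + w 1 + w 3 ∈ B :=
    mem_of_one_smul_eq (B.add_mem hb htB) (by rw [hw₀, hw₁, hw₃]; match_scalars <;> decide)
  have h023 : w 0 + w 2 + w 3 ∈ A :=
    mem_of_one_smul_eq ha (by rw [hw₀, hw₂, hw₃]; match_scalars <;> decide)
  have h123 : w 1 + w 2 + w 3 ∈ A :=
    mem_of_one_smul_eq (A.add_mem ha hsA) (by rw [hw₁, hw₂, hw₃]; match_scalars <;> decide)
  have hwsum : ∀ i j k, i ≠ j → i ≠ k → j ≠ k → w i + w j + w k ∈ A ∨ w i + w j + w k ∈ B := by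
    have hperm : ∀ i j k, w i + w j + w k ∈ A ∨ w i + w j + w k ∈ B →
        ∀ x, x = w i + w j + w k → x ∈ A ∨ x ∈ B := by
      rintro i j k hh x rfl
      exact hh
    intro i j k hij hik hjk
    have : (({i, j, k} : Finset (Fin 4)) = {0, 1, 2} ∨ ({i, j, k} : Finset (Fin 4)) = {0, 1, 3} ∨
        ({i, j, k} : Finset (Fin 4)) = {0, 2, 3} ∨ ({i, j, k} : Finset (Fin 4)) = {1, 2, 3}) := by
      revert i j k; decide
    have hsum : w i + w j + w k = ∑ l ∈ ({i, j, k} : Finset (Fin 4)), w l := by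
      rw [Finset.sum_insert (by simp [hij, hik]), Finset.sum_insert (by simp [hjk]),
        Finset.sum_singleton, add_assoc]
    rw [hsum]
    rcases this with h1 | h1 | h1 | h1 <;> rw [h1]
    · exact Or.inr (by simpa [add_assoc] using h012)
    · exact Or.inr (by simpa [add_assoc] using h013)
    · exact Or.inl (by simpa [add_assoc] using h023)
    · exact Or.inl (by simpa [add_assoc] using h123)
  have hwoff : ∀ i, h (w i) = 1 ∧ w i ∉ A ∧ w i ∉ B := by
    have hAs : ∀ {v}, v ∉ A → v + s ∉ A := fun hv hh => hv
      (mem_of_one_smul_eq (A.add_mem hh hsA) (by match_scalars <;> decide))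
    have hBt : ∀ {v}, v ∉ B → v + t ∉ B := fun hv hh => hv
      (mem_of_one_smul_eq (B.add_mem hh htB) (by match_scalars <;> decide))
    have hat : a + t ∉ A := fun hh => htA
      (mem_of_one_smul_eq (A.add_mem hh ha) (by match_scalars <;> decide))
    have hbs : b + s ∉ B := fun hh => hsB
      (mem_of_one_smul_eq (B.add_mem hh hb) (by match_scalars <;> decide))
    intro i
    fin_cases i
    · exact hw₀ ▸ ⟨point_add_direction ha1 ht0, hat, hBt haB⟩
    · exact hw₁ ▸ ⟨point_add_direction has1 ht0, by
        rw [add_right_comm]; exact hAs hat, hBt hasB⟩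
    · exact hw₂ ▸ ⟨point_add_direction hb1 hs0, hAs hbA, hbs⟩
    · exact hw₃ ▸ ⟨point_add_direction (point_add_direction hb1 hs0) ht0, by
        rw [add_right_comm]; exact hAs hbtA, hBt hbs⟩
  choose! c hc using hw
  refine ⟨c, hp, hA, hB, inf_le_left, inf_le_right, hT, hT3, ?_, ?_, fun i =>
    ⟨w i, (hwoff i).1, (hwoff i).2.1, (hwoff i).2.2, (hwne _ _ (hc (w i) (hwoff i).1 (hwoff i).2.1
      (hwoff i).2.2)).symm⟩⟩
  · intro x y hx hxA hxB hy hyA hyB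
    have h1 := hc x hx hxA hxB
    have h2 := hc y hy hyA hyB
    constructor
    · intro hxy
      rw [hxy] at h1
      exact mem_of_one_smul_eq ((A ⊓ B).add_mem h1 h2) (by match_scalars <;> decide)
    · intro hxy
      exact hwne _ _ (mem_of_one_smul_eq ((A ⊓ B).add_mem ((A ⊓ B).add_mem h1 h2) hxy)
        (by match_scalars <;> decide))
  · intro x y z hx hxA hxB hy hyA hyB hz hzA hzB hxy hxz hyz
    have h1 := (A ⊓ B).add_mem ((A ⊓ B).add_mem (hc x hx hxA hxB) (hc y hy hyA hyB))
      (hc z hz hzA hzB)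
    rcases hwsum _ _ _ hxy hxz hyz with h2 | h2
    · exact Or.inl (mem_of_one_smul_eq (A.add_mem h1.1 h2) (by match_scalars <;> decide))
    · exact Or.inr (mem_of_one_smul_eq (B.add_mem h1.2 h2) (by match_scalars <;> decide))

namespace IsFourClasses

variable {A B T : Submodule (ZMod 2) V} {c : V → Fin 4}

theorem notMem_of_mem (H : IsFourClasses h 𝒰 A B T c) {E : Submodule (ZMod 2) V} (hE : E ∈ 𝒰)
    (hEA : E ≠ A) (hEB : E ≠ B) {x : V} (hx : x ∈ E) (hx1 : h x = 1) : x ∉ A ∧ x ∉ B :=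
  ⟨fun hxA => hEA (H.isAffinePartition.eq_of_mem E hE A H.left_mem x hx1 hx hxA),
    fun hxB => hEB (H.isAffinePartition.eq_of_mem E hE B H.right_mem x hx1 hx hxB)⟩

theorem class_eq_iff_of_mem (H : IsFourClasses h 𝒰 A B T c) {E E' : Submodule (ZMod 2) V}
    (hE : E ∈ 𝒰) (hEA : E ≠ A) (hEB : E ≠ B) (hE' : E' ∈ 𝒰) (hEA' : E' ≠ A)
    (hEB' : E' ≠ B) {x y : V} (hx : x ∈ E) (hx1 : h x = 1) (hy : y ∈ E') (hy1 : h y = 1) :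
    c x = c y ↔ x + y ∈ T := by
  have h1 := H.notMem_of_mem hE hEA hEB hx hx1
  have h2 := H.notMem_of_mem hE' hEA' hEB' hy hy1
  exact H.class_eq_iff x y hx1 h1.1 h1.2 hy1 h2.1 h2.2

theorem notMem_add (H : IsFourClasses h 𝒰 A B T c) {x t : V} (hxA : x ∉ A) (hxB : x ∉ B)
    (ht : t ∈ T) : x + t ∉ A ∧ x + t ∉ B :=
  ⟨fun hh => hxA (mem_of_one_smul_eq (A.add_mem hh (H.le_left ht)) (by match_scalars <;> decide)),
    fun hh => hxB (mem_of_one_smul_eq (B.add_mem hh (H.le_right ht))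
      (by match_scalars <;> decide))⟩

theorem class_add (H : IsFourClasses h 𝒰 A B T c) {x t : V} (hx1 : h x = 1) (hxA : x ∉ A)
    (hxB : x ∉ B) (ht : t ∈ T) : c (x + t) = c x := by
  have h1 := H.notMem_add hxA hxB ht
  refine ((H.class_eq_iff x (x + t) hx1 hxA hxB (point_add_direction hx1 (H.map_eq_zero t ht))
    h1.1 h1.2).2 ?_).symm
  rwa [add_add_cancel_self_two]

/-- An element has points in at most two classes: three points in different classes would sum to a
point of `A` or `B`. -/
theorem class_eq_of_mem (H : IsFourClasses h 𝒰 A B T c) {E : Submodule (ZMod 2) V} (hE : E ∈ 𝒰)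
    (hEA : E ≠ A) (hEB : E ≠ B) {x y z : V} (hx : x ∈ E) (hx1 : h x = 1) (hy : y ∈ E)
    (hy1 : h y = 1) (hz : z ∈ E) (hz1 : h z = 1) : c x = c y ∨ c x = c z ∨ c y = c z := by
  by_contra! hcon
  have h1 := H.notMem_of_mem hE hEA hEB hx hx1
  have h2 := H.notMem_of_mem hE hEA hEB hy hy1
  have h3 := H.notMem_of_mem hE hEA hEB hz hz1
  have h4 := H.notMem_of_mem hE hEA hEB (E.add_mem (E.add_mem hx hy) hz)
    (point_add_point_add_point hx1 hy1 hz1)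
  exact (H.sum_mem x y z hx1 h1.1 h1.2 hy1 h2.1 h2.2 hz1 h3.1 h3.2 hcon.1 hcon.2.1
    hcon.2.2).elim h4.1 h4.2

theorem ne_left_right (H : IsFourClasses h 𝒰 A B T c) {E : Submodule (ZMod 2) V} {t : V}
    (ht : t ∈ T) (htE : t ∉ E) : E ≠ A ∧ E ≠ B :=
  ⟨fun hh => htE (hh ▸ H.le_left ht), fun hh => htE (hh ▸ H.le_right ht)⟩

variable [Fintype V]

theorem finrank_le (H : IsFourClasses h 𝒰 A B T c) {E : Submodule (ZMod 2) V} (hE : E ∈ 𝒰)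
    (hEA : E ≠ A) (hEB : E ≠ B) :
    finrank (ZMod 2) E ≤ finrank (ZMod 2) (E ⊓ T : Submodule (ZMod 2) V) + 2 := by
  obtain ⟨x, hx, hx1⟩ := H.isAffinePartition.exists_point E hE
  have h1 := finrank_inf_ker_add_one hx hx1
  have h2 := finrank_le_of_two_classes (T := T) hx hx1 fun y hy hy1 z hz hz1 => by
    simpa only [H.class_eq_iff_of_mem hE hEA hEB hE hEA hEB hx hx1 hy hy1,
      H.class_eq_iff_of_mem hE hEA hEB hE hEA hEB hx hx1 hz hz1,
      H.class_eq_iff_of_mem hE hEA hEB hE hEA hEB hy hy1 hz hz1] using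
      H.class_eq_of_mem hE hEA hEB hx hx1 hy hy1 hz hz1
  omega

theorem exists_class_ne (H : IsFourClasses h 𝒰 A B T c) {E : Submodule (ZMod 2) V} (hE : E ∈ 𝒰)
    (hEA : E ≠ A) (hEB : E ≠ B)
    (hET : finrank (ZMod 2) (E ⊓ T : Submodule (ZMod 2) V) + 2 ≤ finrank (ZMod 2) E) {x : V}
    (hx : x ∈ E) (hx1 : h x = 1) : ∃ y ∈ E, h y = 1 ∧ c x ≠ c y := by
  obtain ⟨y, hy, hy1, hxy⟩ := exists_add_notMem hx hx1 hET
  exact ⟨y, hy, hy1, fun hh =>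
    hxy ((H.class_eq_iff_of_mem hE hEA hEB hE hEA hEB hx hx1 hy hy1).1 hh)⟩

theorem finrank_inf_lt (H : IsFourClasses h 𝒰 A B T c) {E : Submodule (ZMod 2) V} {t : V}
    (ht : t ∈ T) (htE : t ∉ E) : finrank (ZMod 2) (E ⊓ T : Submodule (ZMod 2) V) ≤ 2 := by
  have := finrank_lt_of_mem_notMem (D' := E ⊓ T) (D := T) inf_le_right ht fun hh => htE hh.1
  have := H.finrank_eq
  omega

/-- There is no tight irreducible avsp of type `5^2 4^4`: elements with points in a common class
have the same directions in `T`, so that there would be three elements with points in two classes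
each, and no class in common. -/
theorem false_of_two_five_four (H : IsFourClasses h 𝒰 A B T c)
    (htight : ∀ t ≠ 0, ∃ U ∈ 𝒰, t ∉ U)
    (h4 : ∀ E ∈ 𝒰, E ≠ A → E ≠ B → finrank (ZMod 2) E = 4) : False := by
  have hp := H.isAffinePartition
  have hclass : ∀ {E E' t x y}, E ∈ 𝒰 → E' ∈ 𝒰 → E' ≠ A → E' ≠ B → t ∈ T → t ∉ E → t ∈ E' →
      x ∈ E → h x = 1 → y ∈ E' → h y = 1 → c x ≠ c y := by
    intro E E' t x y hE hE' hEA' hEB' ht htE htE' hx hx1 hy hy1 hxy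
    obtain ⟨hEA, hEB⟩ := H.ne_left_right ht htE
    have h1 := H.finrank_le hE hEA hEB
    have h2 := h4 E hE hEA hEB
    have h3 := H.finrank_eq
    exact htE (hp.mem_of_codim_one H.map_eq_zero hE hE' (by omega) hx hx1 hy
      ((H.class_eq_iff_of_mem hE hEA hEB hE' hEA' hEB' hx hx1 hy hy1).1 hxy) htE' ht)
  have hrank : ∀ {E}, E ∈ 𝒰 → ∀ t ∈ T, t ∉ E →
      finrank (ZMod 2) (E ⊓ T : Submodule (ZMod 2) V) = 2 := by
    intro E hE t ht htE
    obtain ⟨hEA, hEB⟩ := H.ne_left_right ht htE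
    have h1 := H.finrank_le hE hEA hEB
    have h2 := h4 E hE hEA hEB
    have h3 := H.finrank_inf_lt ht htE
    omega
  have hpoints : ∀ {E}, E ∈ 𝒰 → ∀ t ∈ T, t ∉ E → ∃ x ∈ E, h x = 1 ∧ ∃ y ∈ E, h y = 1 ∧
      c x ≠ c y := by
    intro E hE t ht htE
    obtain ⟨hEA, hEB⟩ := H.ne_left_right ht htE
    obtain ⟨x, hx, hx1⟩ := hp.exists_point E hE
    exact ⟨x, hx, hx1, H.exists_class_ne hE hEA hEB
      (by rw [hrank hE t ht htE, h4 E hE hEA hEB]) hx hx1⟩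
  obtain ⟨t₁, ht₁, ht₁0⟩ := exists_mem_ne_zero_of_finrank (D := T) (by rw [H.finrank_eq]; omega)
  obtain ⟨E₁, hE₁, htE₁⟩ := htight t₁ ht₁0
  obtain ⟨hE₁A, hE₁B⟩ := H.ne_left_right ht₁ htE₁
  have hr₁ := hrank hE₁ t₁ ht₁ htE₁
  obtain ⟨t₂, ht₂, ht₂0⟩ := exists_mem_ne_zero_of_finrank (D := E₁ ⊓ T) (by omega)
  obtain ⟨E₂, hE₂, htE₂⟩ := htight t₂ ht₂0
  obtain ⟨hE₂A, hE₂B⟩ := H.ne_left_right ht₂.2 htE₂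
  have hr₂ := hrank hE₂ t₂ ht₂.2 htE₂
  obtain ⟨t₃, ht₃, ht₃0⟩ := exists_mem_ne_zero_of_finrank (D := E₁ ⊓ T ⊓ (E₂ ⊓ T)) (by
    have h1 := Submodule.finrank_sup_add_finrank_inf_eq (E₁ ⊓ T) (E₂ ⊓ T)
    have h2 := Submodule.finrank_mono (sup_le inf_le_right inf_le_right : E₁ ⊓ T ⊔ E₂ ⊓ T ≤ T)
    have h3 := H.finrank_eq
    omega)
  obtain ⟨E₃, hE₃, htE₃⟩ := htight t₃ ht₃0
  obtain ⟨x₁, hx₁, hx₁1, y₁, hy₁, hy₁1, hxy₁⟩ := hpoints hE₁ t₁ ht₁ htE₁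
  obtain ⟨x₂, hx₂, hx₂1, y₂, hy₂, hy₂1, hxy₂⟩ := hpoints hE₂ t₂ ht₂.2 htE₂
  obtain ⟨x₃, hx₃, hx₃1⟩ := hp.exists_point E₃ hE₃
  have h21 : ∀ {x y}, x ∈ E₂ → h x = 1 → y ∈ E₁ → h y = 1 → c x ≠ c y :=
    hclass hE₂ hE₁ hE₁A hE₁B ht₂.2 htE₂ ht₂.1
  have h31 : ∀ {x y}, x ∈ E₃ → h x = 1 → y ∈ E₁ → h y = 1 → c x ≠ c y :=
    hclass hE₃ hE₁ hE₁A hE₁B ht₃.1.2 htE₃ ht₃.1.1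
  have h32 : ∀ {x y}, x ∈ E₃ → h x = 1 → y ∈ E₂ → h y = 1 → c x ≠ c y :=
    hclass hE₃ hE₂ hE₂A hE₂B ht₃.1.2 htE₃ ht₃.2.1
  have hfive : ∀ i j k l m : Fin 4, ¬ (((i ≠ j ∧ k ≠ i ∧ k ≠ j) ∧ l ≠ i ∧ l ≠ j ∧ m ≠ i ∧ m ≠ j) ∧
      k ≠ l ∧ m ≠ k ∧ m ≠ l) := by decide
  exact hfive _ _ _ _ _ ⟨⟨⟨hxy₁, h21 hx₂ hx₂1 hx₁ hx₁1, h21 hx₂ hx₂1 hy₁ hy₁1⟩,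
    h21 hy₂ hy₂1 hx₁ hx₁1, h21 hy₂ hy₂1 hy₁ hy₁1, h31 hx₃ hx₃1 hx₁ hx₁1,
    h31 hx₃ hx₃1 hy₁ hy₁1⟩, hxy₂, h32 hx₃ hx₃1 hx₂ hx₂1, h32 hx₃ hx₃1 hy₂ hy₂1⟩

end IsFourClasses

end TwoFive

/-! ### Type `5^2 4^2 3^4` -/

section TwoFiveTwoFour

variable {V : Type*} [AddCommGroup V] [Module (ZMod 2) V]
  {h : V →ₗ[ZMod 2] ZMod 2} {𝒰 : Finset (Submodule (ZMod 2) V)}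

/-- A tight irreducible partition of type `5^2 4^2 3^4`, with the elements `A` and `B` of dimension
five and the elements `E₁` and `E₂` of dimension four. -/
structure IsTwoFiveTwoFour (h : V →ₗ[ZMod 2] ZMod 2) (𝒰 : Finset (Submodule (ZMod 2) V))
    (A B T E₁ E₂ : Submodule (ZMod 2) V) (c : V → Fin 4) : Prop extends
    IsFourClasses h 𝒰 A B T c where
  irreducible : IsAffineIrreducible h 𝒰
  tight : ∀ t ≠ 0, ∃ U ∈ 𝒰, t ∉ U
  mem₁ : E₁ ∈ 𝒰
  mem₂ : E₂ ∈ 𝒰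
  ne : E₁ ≠ E₂
  finrank_left : finrank (ZMod 2) A = 5
  finrank_right : finrank (ZMod 2) B = 5
  finrank₁ : finrank (ZMod 2) E₁ = 4
  finrank₂ : finrank (ZMod 2) E₂ = 4
  cases_of_mem : ∀ F ∈ 𝒰, F = A ∨ F = B ∨ F = E₁ ∨ F = E₂ ∨ finrank (ZMod 2) F = 3
  card_le : ∀ s ⊆ 𝒰, (∀ F ∈ s, finrank (ZMod 2) F = 3) → s.card ≤ 4

/-- The points of the elements of dimension three. -/
def IsSmallPoint (h : V →ₗ[ZMod 2] ZMod 2) (𝒰 : Finset (Submodule (ZMod 2) V)) (x : V) : Prop :=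
  h x = 1 ∧ ∃ F ∈ 𝒰, finrank (ZMod 2) F = 3 ∧ x ∈ F

/-- The points of the elements of dimension three in the class `k` form a coset of `Q`. -/
def IsCoset (h : V →ₗ[ZMod 2] ZMod 2) (𝒰 : Finset (Submodule (ZMod 2) V))
    (T : Submodule (ZMod 2) V) (c : V → Fin 4) (k : Fin 4) (Q : Submodule (ZMod 2) V) : Prop :=
  ∀ x, IsSmallPoint h 𝒰 x → c x = k → ∀ t ∈ T, (IsSmallPoint h 𝒰 (x + t) ↔ t ∈ Q)

namespace IsTwoFiveTwoFour

variable {A B T E₁ E₂ : Submodule (ZMod 2) V} {c : V → Fin 4}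

theorem symm (H : IsTwoFiveTwoFour h 𝒰 A B T E₁ E₂ c) : IsTwoFiveTwoFour h 𝒰 A B T E₂ E₁ c :=
  { H with
    mem₁ := H.mem₂
    mem₂ := H.mem₁
    ne := H.ne.symm
    finrank₁ := H.finrank₂
    finrank₂ := H.finrank₁
    cases_of_mem := fun F hF => by
      rcases H.cases_of_mem F hF with h1 | h1 | h1 | h1 | h1 <;> simp [h1] }

theorem ne_of_finrank (H : IsTwoFiveTwoFour h 𝒰 A B T E₁ E₂ c) {F : Submodule (ZMod 2) V}
    (hF3 : finrank (ZMod 2) F = 3) : F ≠ A ∧ F ≠ B ∧ F ≠ E₁ ∧ F ≠ E₂ := by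
  refine ⟨?_, ?_, ?_, ?_⟩ <;> rintro rfl
  · exact absurd (hF3.symm.trans H.finrank_left) (by decide)
  · exact absurd (hF3.symm.trans H.finrank_right) (by decide)
  · exact absurd (hF3.symm.trans H.finrank₁) (by decide)
  · exact absurd (hF3.symm.trans H.finrank₂) (by decide)

theorem ne₁ (H : IsTwoFiveTwoFour h 𝒰 A B T E₁ E₂ c) : E₁ ≠ A ∧ E₁ ≠ B := by
  constructor <;> rintro rfl
  · exact absurd (H.finrank_left.symm.trans H.finrank₁) (by decide)
  · exact absurd (H.finrank_right.symm.trans H.finrank₁) (by decide)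

theorem isSmallPoint_iff (H : IsTwoFiveTwoFour h 𝒰 A B T E₁ E₂ c) {x : V} :
    IsSmallPoint h 𝒰 x ↔ h x = 1 ∧ x ∉ A ∧ x ∉ B ∧ x ∉ E₁ ∧ x ∉ E₂ := by
  have hp := H.isAffinePartition
  constructor
  · rintro ⟨hx1, F, hF, hF3, hxF⟩
    obtain ⟨hA, hB, h1, h2⟩ := H.ne_of_finrank hF3
    exact ⟨hx1, fun hh => hA (hp.eq_of_mem F hF A H.left_mem x hx1 hxF hh),
      fun hh => hB (hp.eq_of_mem F hF B H.right_mem x hx1 hxF hh),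
      fun hh => h1 (hp.eq_of_mem F hF E₁ H.mem₁ x hx1 hxF hh),
      fun hh => h2 (hp.eq_of_mem F hF E₂ H.mem₂ x hx1 hxF hh)⟩
  · rintro ⟨hx1, hxA, hxB, hx₁, hx₂⟩
    obtain ⟨F, hF, hxF⟩ := hp.exists_mem x hx1
    refine ⟨hx1, F, hF, ?_, hxF⟩
    rcases H.cases_of_mem F hF with rfl | rfl | rfl | rfl | h3
    · exact absurd hxF hxA
    · exact absurd hxF hxB
    · exact absurd hxF hx₁
    · exact absurd hxF hx₂
    · exact h3

/-- A class without points of `E₁` and `E₂` consists of points of elements of dimension three. -/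
theorem isSmallPoint_add (H : IsTwoFiveTwoFour h 𝒰 A B T E₁ E₂ c) {x : V}
    (hx : IsSmallPoint h 𝒰 x) (hE : ∀ v, v ∈ E₁ ∨ v ∈ E₂ → h v = 1 → c v ≠ c x) {t : V}
    (ht : t ∈ T) : IsSmallPoint h 𝒰 (x + t) := by
  obtain ⟨hx1, hxA, hxB, -, -⟩ := H.isSmallPoint_iff.1 hx
  have hxt := point_add_direction hx1 (H.map_eq_zero t ht)
  have h1 := H.notMem_add hxA hxB ht
  have h2 := H.class_add hx1 hxA hxB ht
  exact H.isSmallPoint_iff.2 ⟨hxt, h1.1, h1.2, fun hh => hE _ (Or.inl hh) hxt h2,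
    fun hh => hE _ (Or.inr hh) hxt h2⟩

theorem class_eq_iff_of_small (H : IsTwoFiveTwoFour h 𝒰 A B T E₁ E₂ c) {x y : V}
    (hx : IsSmallPoint h 𝒰 x) (hy : IsSmallPoint h 𝒰 y) : c x = c y ↔ x + y ∈ T := by
  obtain ⟨hx1, hxA, hxB, -, -⟩ := H.isSmallPoint_iff.1 hx
  obtain ⟨hy1, hyA, hyB, -, -⟩ := H.isSmallPoint_iff.1 hy
  exact H.class_eq_iff x y hx1 hxA hxB hy1 hyA hyB

theorem exists_isSmallPoint_mem (H : IsTwoFiveTwoFour h 𝒰 A B T E₁ E₂ c)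
    {F : Submodule (ZMod 2) V} (hF : F ∈ 𝒰) (hF3 : finrank (ZMod 2) F = 3) :
    ∃ x ∈ F, IsSmallPoint h 𝒰 x := by
  obtain ⟨x, hx, hx1⟩ := H.isAffinePartition.exists_point F hF
  exact ⟨x, hx, hx1, F, hF, hF3, hx⟩

theorem mem_of_isCoset (H : IsTwoFiveTwoFour h 𝒰 A B T E₁ E₂ c) {k : Fin 4}
    {Q : Submodule (ZMod 2) V} (hQ : IsCoset h 𝒰 T c k Q) {F : Submodule (ZMod 2) V} (hF : F ∈ 𝒰)
    (hF3 : finrank (ZMod 2) F = 3) {x : V} (hx : x ∈ F) (hx1 : h x = 1) (hxk : c x = k) {t : V}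
    (ht : t ∈ F) (htT : t ∈ T) : t ∈ Q :=
  (hQ x ⟨hx1, F, hF, hF3, hx⟩ hxk t htT).1
    ⟨point_add_direction hx1 (H.map_eq_zero t htT), F, hF, hF3, F.add_mem hx ht⟩

theorem finrank_eq_three_of_notMem (H : IsTwoFiveTwoFour h 𝒰 A B T E₁ E₂ c)
    {F : Submodule (ZMod 2) V} (hF : F ∈ 𝒰) {t : V} (ht : t ∈ T) (ht₁ : t ∈ E₁) (ht₂ : t ∈ E₂)
    (htF : t ∉ F) : finrank (ZMod 2) F = 3 := by
  obtain ⟨hA, hB⟩ := H.ne_left_right ht htF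
  rcases H.cases_of_mem F hF with h1 | h1 | h1 | h1 | h1
  · exact absurd h1 hA
  · exact absurd h1 hB
  · exact absurd ht₁ (h1 ▸ htF)
  · exact absurd ht₂ (h1 ▸ htF)
  · exact h1

/-- An element of dimension four that contains `T` contains all points of its class. -/
theorem mem_of_class_eq (H : IsTwoFiveTwoFour h 𝒰 A B T E₁ E₂ c) (hT : T ≤ E₁) {x y : V}
    (hx : x ∈ E₁) (hx1 : h x = 1) (hy1 : h y = 1) (hyA : y ∉ A) (hyB : y ∉ B) (hxy : c x = c y) :
    y ∈ E₁ := by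
  obtain ⟨hxA, hxB⟩ := H.notMem_of_mem H.mem₁ H.ne₁.1 H.ne₁.2 hx hx1
  exact add_add_cancel_self_two x y ▸
    E₁.add_mem hx (hT ((H.class_eq_iff x y hx1 hxA hxB hy1 hyA hyB).1 hxy))

theorem class_ne_of_le (H : IsTwoFiveTwoFour h 𝒰 A B T E₁ E₂ c) (hT : T ≤ E₁) {x y : V}
    (hx : x ∈ E₁) (hx1 : h x = 1) (hy : y ∈ E₂) (hy1 : h y = 1) : c x ≠ c y := fun hxy => by
  obtain ⟨hyA, hyB⟩ := H.notMem_of_mem H.mem₂ H.symm.ne₁.1 H.symm.ne₁.2 hy hy1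
  exact H.ne (H.isAffinePartition.eq_of_mem E₁ H.mem₁ E₂ H.mem₂ y hy1
    (H.mem_of_class_eq hT hx hx1 hy1 hyA hyB hxy) hy)

theorem class_eq_or (H : IsTwoFiveTwoFour h 𝒰 A B T E₁ E₂ c) {x y v : V} (hx : x ∈ E₁)
    (hx1 : h x = 1) (hy : y ∈ E₁) (hy1 : h y = 1) (hxy : c x ≠ c y) (hv : v ∈ E₁) (hv1 : h v = 1) :
    c v = c x ∨ c v = c y := by
  rcases H.class_eq_of_mem H.mem₁ H.ne₁.1 H.ne₁.2 hv hv1 hx hx1 hy hy1 with h1 | h1 | h1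
  · exact Or.inl h1
  · exact Or.inr h1
  · exact absurd h1 hxy

theorem exists_isSmallPoint_class (H : IsTwoFiveTwoFour h 𝒰 A B T E₁ E₂ c) {l : Fin 4}
    (hl : ∀ v, v ∈ E₁ ∨ v ∈ E₂ → h v = 1 → c v ≠ l) : ∃ p, IsSmallPoint h 𝒰 p ∧ c p = l := by
  obtain ⟨p, hp1, hpA, hpB, hpl⟩ := H.exists_class l
  exact ⟨p, H.isSmallPoint_iff.2 ⟨hp1, hpA, hpB, fun hh => hl p (Or.inl hh) hp1 hpl,
    fun hh => hl p (Or.inr hh) hp1 hpl⟩, hpl⟩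

variable [Fintype V]

/-- An element of dimension three does not contain all points of a class of its points. -/
theorem exists_mem_notMem (H : IsTwoFiveTwoFour h 𝒰 A B T E₁ E₂ c) {F : Submodule (ZMod 2) V}
    (hF : F ∈ 𝒰) (hF3 : finrank (ZMod 2) F = 3) : ∃ t ∈ T, t ∉ F := by
  obtain ⟨x, hx, hx1⟩ := H.isAffinePartition.exists_point F hF
  by_contra! hcon
  have h1 := finrank_lt_of_mem_notMem (D' := T) (D := F) hcon hx fun hh => by
    rw [H.map_eq_zero x hh] at hx1; exact absurd hx1 (by decide)
  have := H.finrank_eq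
  omega

/-- A flat that consists of points of elements of dimension three and is a union of elements is
impossible, if it contains a class. -/
theorem false_of_flat (H : IsTwoFiveTwoFour h 𝒰 A B T E₁ E₂ c) {S : Set V}
    (hS : ∀ v ∈ S, IsSmallPoint h 𝒰 v)
    (hS3 : ∀ x ∈ S, ∀ y ∈ S, ∀ z ∈ S, c x = c y ∨ c x = c z ∨ c y = c z)
    (hsat : ∀ U ∈ 𝒰, ∀ v ∈ U, v ∈ S → ∀ w ∈ U, h w = 1 → w ∈ S)
    (hST : ∀ x ∈ S, ∀ t ∈ T, x + t ∈ S) {x : V} (hx : x ∈ S) : False := by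
  have hp := H.isAffinePartition
  obtain ⟨hx1, F, hF, hF3, hxF⟩ := hS x hx
  obtain ⟨t, ht, htF⟩ := H.exists_mem_notMem hF hF3
  have hxt := hST x hx t ht
  obtain ⟨-, F', hF', -, hxF'⟩ := hS _ hxt
  obtain ⟨a, ha, ha1⟩ := hp.exists_point A H.left_mem
  have hsum : ∀ x ∈ S, ∀ y ∈ S, ∀ z ∈ S, c x = c y → x + y + z ∈ S := fun x hx y hy z hz hxy => by
    rw [add_comm]
    exact hST z hz _ ((H.class_eq_iff_of_small (hS x hx) (hS y hy)).1 hxy)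
  have := H.irreducible S (fun v hv => (hS v hv).1) (fun x hx y hy z hz => by
      rcases hS3 x hx y hy z hz with h1 | h1 | h1
      · exact hsum x hx y hy z hz h1
      · rw [add_assoc, add_comm y z, ← add_assoc]
        exact hsum x hx z hz y hy h1
      · rw [add_assoc, add_comm x]
        exact hsum y hy z hz x hx h1) hsat F hF F' hF'
    (by rintro rfl; exact htF (add_add_cancel_self_two x t ▸ F.add_mem hxF hxF')) x hxF (x + t)
    hxF' hx hxt a ha1
  exact (H.isSmallPoint_iff.1 (hS a this)).2.1 ha

/-- The points of the elements of dimension three do not avoid two classes that contain the other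
two elements: they would form a flat. -/
theorem false_of_two_empty (H : IsTwoFiveTwoFour h 𝒰 A B T E₁ E₂ c) {F : Submodule (ZMod 2) V}
    (hF : F ∈ 𝒰) (hF3 : finrank (ZMod 2) F = 3) {k l : Fin 4} (hkl : k ≠ l)
    (hE : ∀ v, v ∈ E₁ ∨ v ∈ E₂ → h v = 1 → c v = k ∨ c v = l)
    (hempty : ∀ x, IsSmallPoint h 𝒰 x → c x ≠ k ∧ c x ≠ l) : False := by
  obtain ⟨x, hx, hxs⟩ := H.exists_isSmallPoint_mem hF hF3
  have hfour : ∀ k l i j m : Fin 4, ((k ≠ l ∧ i ≠ k ∧ i ≠ l) ∧ j ≠ k ∧ j ≠ l ∧ m ≠ k ∧ m ≠ l) →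
      i = j ∨ i = m ∨ j = m := by decide
  refine H.false_of_flat (S := {v | IsSmallPoint h 𝒰 v}) (fun v hv => hv)
    (fun x hx y hy z hz => hfour _ _ _ _ _ ⟨⟨hkl, hempty x hx⟩, (hempty y hy).1, (hempty y hy).2,
      hempty z hz⟩) (fun U hU v hvU hv w hw hw1 => ?_) (fun x hx t ht => ?_) (x := x) hxs
  · obtain ⟨hv1, F', hF', hF3', hvF'⟩ := hv
    exact ⟨hw1, F', hF', hF3', H.isAffinePartition.eq_of_mem U hU F' hF' v hv1 hvU hvF' ▸ hw⟩
  · exact H.isSmallPoint_add hx (fun v hv hv1 hcv => by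
      have := hempty x hx
      rcases hE v hv hv1 with h1 | h1
      · exact this.1 (hcv ▸ h1)
      · exact this.2 (hcv ▸ h1)) ht

theorem exists_direction (H : IsTwoFiveTwoFour h 𝒰 A B T E₁ E₂ c) {F : Submodule (ZMod 2) V}
    (hF : F ∈ 𝒰) (hF3 : finrank (ZMod 2) F = 3) : ∃ d ∈ F, d ∈ T ∧ d ≠ 0 := by
  obtain ⟨hA, hB, -, -⟩ := H.ne_of_finrank hF3
  have h1 := H.finrank_le hF hA hB
  obtain ⟨d, hd, hd0⟩ := exists_mem_ne_zero_of_finrank (D := F ⊓ T) (by omega)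
  exact ⟨d, hd.1, hd.2, hd0⟩

/-- An element of dimension three with points in two classes has only one direction in `T`. -/
theorem finrank_le_one (H : IsTwoFiveTwoFour h 𝒰 A B T E₁ E₂ c) {F : Submodule (ZMod 2) V}
    (hF : F ∈ 𝒰) (hF3 : finrank (ZMod 2) F = 3) {x y : V} (hx : x ∈ F) (hx1 : h x = 1)
    (hy : y ∈ F) (hy1 : h y = 1) (hxy : c x ≠ c y) :
    finrank (ZMod 2) (F ⊓ T : Submodule (ZMod 2) V) ≤ 1 := by
  obtain ⟨hA, hB, -, -⟩ := H.ne_of_finrank hF3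
  have h1 := finrank_inf_ker_add_one hx hx1
  have h2 := finrank_lt_of_mem_notMem (D' := F ⊓ T) (D := F ⊓ LinearMap.ker h)
    (fun v hv => ⟨hv.1, H.map_eq_zero v hv.2⟩) (t := x + y)
    ⟨F.add_mem hx hy, point_add_point hx1 hy1⟩
    (fun hh => hxy ((H.class_eq_iff_of_mem hF hA hB hF hA hB hx hx1 hy hy1).2 hh.2))
  omega

/-- Different elements of dimension three with points in a common coset of the plane `Q` have a
common unique direction in `T`, as otherwise they would meet. -/
theorem eq_of_isCoset (H : IsTwoFiveTwoFour h 𝒰 A B T E₁ E₂ c) {k : Fin 4}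
    {Q : Submodule (ZMod 2) V} (hQ : IsCoset h 𝒰 T c k Q) (hQ2 : finrank (ZMod 2) Q = 2)
    {F F' : Submodule (ZMod 2) V} (hF : F ∈ 𝒰) (hF3 : finrank (ZMod 2) F = 3) (hF' : F' ∈ 𝒰)
    (hF3' : finrank (ZMod 2) F' = 3) (hne : F ≠ F') {x x' : V} (hx : x ∈ F) (hx1 : h x = 1)
    (hxk : c x = k) (hx' : x' ∈ F') (hx1' : h x' = 1) (hxk' : c x' = k) {d d' : V} (hd : d ∈ F)
    (hdT : d ∈ T) (hd0 : d ≠ 0) (hd' : d' ∈ F') (hdT' : d' ∈ T) (hd0' : d' ≠ 0) : d = d' := by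
  by_contra hdd
  have hxs : IsSmallPoint h 𝒰 x := ⟨hx1, F, hF, hF3, hx⟩
  have hxs' : IsSmallPoint h 𝒰 x' := ⟨hx1', F', hF', hF3', hx'⟩
  have hxx : x + x' ∈ T := (H.class_eq_iff_of_small hxs hxs').1 (hxk.trans hxk'.symm)
  have hxxQ : x + x' ∈ Q := (hQ x hxs hxk _ hxx).1 (by rwa [add_add_cancel_self_two])
  refine H.isAffinePartition.add_notMem_sup H.map_eq_zero hF hF' hne hx hx1 hx' ?_
  have hl : d ∈ F ⊓ T ⊔ F' ⊓ T := Submodule.mem_sup_left ⟨hd, hdT⟩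
  have hr : d' ∈ F ⊓ T ⊔ F' ⊓ T := Submodule.mem_sup_right ⟨hd', hdT'⟩
  rcases mem_of_finrank_le_two hQ2.le (H.mem_of_isCoset hQ hF hF3 hx hx1 hxk hd hdT)
    (H.mem_of_isCoset hQ hF' hF3' hx' hx1' hxk' hd' hdT') hd0 hd0' hdd hxxQ with h1 | h1 | h1 | h1
  · rw [h1]; exact Submodule.zero_mem _
  · rwa [h1]
  · rwa [h1]
  · rw [h1]; exact Submodule.add_mem _ hl hr

/-- An element with a plane of directions in `T` has all directions of the coset of its points. -/
theorem le_of_isCoset (H : IsTwoFiveTwoFour h 𝒰 A B T E₁ E₂ c) {k : Fin 4}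
    {Q : Submodule (ZMod 2) V} (hQ : IsCoset h 𝒰 T c k Q) (hQ2 : finrank (ZMod 2) Q = 2)
    {F : Submodule (ZMod 2) V} (hF : F ∈ 𝒰) (hF3 : finrank (ZMod 2) F = 3)
    (hF2 : 2 ≤ finrank (ZMod 2) (F ⊓ T : Submodule (ZMod 2) V)) {x : V} (hx : x ∈ F)
    (hx1 : h x = 1) (hxk : c x = k) : Q ≤ F := by
  have h1 : F ⊓ T ≤ Q := fun t ht => H.mem_of_isCoset hQ hF hF3 hx hx1 hxk ht.1 ht.2
  have h2 := Submodule.finrank_mono h1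
  rw [← Submodule.eq_of_le_of_finrank_eq h1 (by omega)]
  exact inf_le_left

/-- The element with half of the points of a class leaves a coset for the elements of dimension
three, if the class has no points of the other element of dimension four. -/
theorem isCoset_inf (H : IsTwoFiveTwoFour h 𝒰 A B T E₁ E₂ c)
    (hrank : finrank (ZMod 2) (E₁ ⊓ T : Submodule (ZMod 2) V) = 2) {y : V} (hy : y ∈ E₁)
    (hy1 : h y = 1) (hE₂ : ∀ z ∈ E₂, h z = 1 → c z ≠ c y) :
    IsCoset h 𝒰 T c (c y) (E₁ ⊓ T) := by
  intro x hx hxy t ht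
  obtain ⟨hx1, hxA, hxB, hx₁, hx₂⟩ := H.isSmallPoint_iff.1 hx
  obtain ⟨hyA, hyB⟩ := H.notMem_of_mem H.mem₁ H.ne₁.1 H.ne₁.2 hy hy1
  have hT3 := H.finrank_eq
  have hxyT : x + y ∈ T := (H.class_eq_iff x y hx1 hxA hxB hy1 hyA hyB).1 hxy
  have hxyE : x + y ∉ E₁ := fun hh =>
    hx₁ (mem_of_one_smul_eq (E₁.add_mem hh hy) (by match_scalars <;> decide))
  have hxt := point_add_direction hx1 (H.map_eq_zero t ht)
  have hxtc := H.class_add hx1 hxA hxB ht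
  rw [H.isSmallPoint_iff]
  constructor
  · rintro ⟨-, -, -, h1, -⟩
    refine ⟨?_, ht⟩
    by_contra htE
    have h2 := (add_mem_of_finrank_le (D' := E₁ ⊓ T) (D := T) inf_le_right (by omega) hxyT
      (fun hh => hxyE hh.1) ht (fun hh => htE hh.1)).1
    exact h1 (mem_of_one_smul_eq (E₁.add_mem h2 hy) (by match_scalars <;> decide))
  · intro htE
    have h1 := H.notMem_add hxA hxB ht
    exact ⟨hxt, h1.1, h1.2, fun hh => hx₁ (mem_of_one_smul_eq (E₁.add_mem hh htE.1)
      (by match_scalars <;> decide)), fun hh => hE₂ _ hh hxt (hxtc.trans hxy)⟩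

theorem exists_class_ne_of_finrank_le_one (H : IsTwoFiveTwoFour h 𝒰 A B T E₁ E₂ c)
    {F : Submodule (ZMod 2) V} (hF : F ∈ 𝒰) (hF3 : finrank (ZMod 2) F = 3)
    (hF1 : ¬ 2 ≤ finrank (ZMod 2) (F ⊓ T : Submodule (ZMod 2) V)) {x : V} (hx : x ∈ F)
    (hx1 : h x = 1) : ∃ y ∈ F, h y = 1 ∧ c x ≠ c y := by
  obtain ⟨hA, hB, -, -⟩ := H.ne_of_finrank hF3
  exact H.exists_class_ne hF hA hB (by omega) hx hx1

/-- The case of two elements of dimension four with points in all four classes. -/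
theorem false_of_four_cosets (H : IsTwoFiveTwoFour h 𝒰 A B T E₁ E₂ c)
    {q : Fin 4 → Submodule (ZMod 2) V} (hq : ∀ i, IsCoset h 𝒰 T c i (q i))
    (hq2 : ∀ i, finrank (ZMod 2) (q i) = 2) (hqT : ∀ i, q i ≤ T)
    (hqE : ∀ t, (∀ i, t ∈ q i) → t ∈ E₁ ∧ t ∈ E₂)
    (hqq : ∀ i j k, i ≠ j → i ≠ k → j ≠ k → ∀ l, q l = q i ∨ q l = q j ∨ q l = q k)
    {t : V} (ht : ∀ i, t ∈ q i) (ht0 : t ≠ 0) : False := by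
  have hp := H.isAffinePartition
  -- an element of dimension three that avoids a common direction has points in two classes
  have hsmall : ∀ t ≠ 0, (∀ i, t ∈ q i) → ∃ F ∈ 𝒰, finrank (ZMod 2) F = 3 ∧ t ∉ F ∧
      finrank (ZMod 2) (F ⊓ T : Submodule (ZMod 2) V) ≤ 1 ∧
      ∃ x ∈ F, h x = 1 ∧ ∃ y ∈ F, h y = 1 ∧ c x ≠ c y := by
    intro t ht0 ht
    obtain ⟨F, hF, htF⟩ := H.tight t ht0
    have hF3 := H.finrank_eq_three_of_notMem hF (hqT 0 (ht 0)) (hqE t ht).1 (hqE t ht).2 htF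
    obtain ⟨x, hx, hx1⟩ := hp.exists_point F hF
    have hF1 : ¬ 2 ≤ finrank (ZMod 2) (F ⊓ T : Submodule (ZMod 2) V) := fun hh =>
      htF (H.le_of_isCoset (hq (c x)) (hq2 _) hF hF3 hh hx hx1 rfl (ht _))
    exact ⟨F, hF, hF3, htF, by omega, x, hx, hx1,
      H.exists_class_ne_of_finrank_le_one hF hF3 hF1 hx hx1⟩
  obtain ⟨F, hF, hF3, htF, hF1, x, hx, hx1, y, hy, hy1, hxy⟩ := hsmall t ht0 ht
  obtain ⟨d, hd, hdT, hd0⟩ := H.exists_direction hF hF3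
  have hdx := H.mem_of_isCoset (hq _) hF hF3 hx hx1 rfl hd hdT
  have hdy := H.mem_of_isCoset (hq _) hF hF3 hy hy1 rfl hd hdT
  have hqxy : q (c x) = q (c y) := by
    by_contra hne
    -- two different planes have at most one direction in common
    have h1 : finrank (ZMod 2) (q (c x) ⊓ q (c y) : Submodule (ZMod 2) V) ≤ 1 := by
      by_contra hcon
      have h2 := Submodule.eq_of_le_of_finrank_le
        (inf_le_left : q (c x) ⊓ q (c y) ≤ q (c x)) (by rw [hq2]; omega)
      have h3 := Submodule.eq_of_le_of_finrank_le
        (inf_le_right : q (c x) ⊓ q (c y) ≤ q (c y)) (by rw [hq2]; omega)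
      exact hne (h2.symm.trans h3)
    exact htF (eq_of_finrank_le_one h1 ⟨hdx, hdy⟩ ⟨ht _, ht _⟩ hd0 ht0 ▸ hd)
  -- the neighbour of `F` in the coset of `x`
  obtain ⟨e, he, heF⟩ : ∃ e ∈ q (c x), e ∉ F := by
    by_contra! hcon
    have h1 : q (c x) ≤ F ⊓ T := fun e he => ⟨hcon e he, hqT _ he⟩
    have := Submodule.finrank_mono h1
    rw [hq2] at this
    omega
  obtain ⟨hxe1, F₁, hF₁, hF₁3, hxe⟩ := (hq (c x) x ⟨hx1, F, hF, hF3, hx⟩ rfl e (hqT _ he)).2 he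
  have hFF₁ : F ≠ F₁ := by
    rintro rfl
    exact heF (add_add_cancel_self_two x e ▸ F.add_mem hx hxe)
  obtain ⟨-, hxA, hxB, -, -⟩ := H.isSmallPoint_iff.1 ⟨hx1, F, hF, hF3, hx⟩
  have hxec : c (x + e) = c x := H.class_add hx1 hxA hxB (hqT _ he)
  have hdF₁ : d ∈ F₁ := by
    obtain ⟨d₁, hd₁, hd₁T, hd₁0⟩ := H.exists_direction hF₁ hF₁3
    rw [H.eq_of_isCoset (hq (c x)) (hq2 _) hF hF3 hF₁ hF₁3 hFF₁ hx hx1 rfl hxe hxe1 hxec hd hdT hd0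
      hd₁ hd₁T hd₁0]
    exact hd₁
  have hF₁1 : ¬ 2 ≤ finrank (ZMod 2) (F₁ ⊓ T : Submodule (ZMod 2) V) := fun hh => by
    have he₁ := H.le_of_isCoset (hq (c x)) (hq2 _) hF₁ hF₁3 hh hxe hxe1 hxec he
    exact hFF₁ (hp.eq_of_mem F hF F₁ hF₁ x hx1 hx
      (mem_of_one_smul_eq (F₁.add_mem hxe he₁) (by match_scalars <;> decide)))
  obtain ⟨z, hz, hz1, hxz⟩ := H.exists_class_ne_of_finrank_le_one hF₁ hF₁3 hF₁1 hxe hxe1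
  rw [hxec] at hxz
  have hyz : c y ≠ c z := by
    intro hyz
    have hys : IsSmallPoint h 𝒰 y := ⟨hy1, F, hF, hF3, hy⟩
    have hzs : IsSmallPoint h 𝒰 z := ⟨hz1, F₁, hF₁, hF₁3, hz⟩
    have hyzT := (H.class_eq_iff_of_small hys hzs).1 hyz
    have hyzq : y + z ∈ q (c x) := by
      rw [hqxy]
      exact (hq (c y) y hys rfl _ hyzT).1 (by rwa [add_add_cancel_self_two])
    have hyzF : y + z ∉ F := fun hh =>
      hFF₁ (hp.eq_of_mem F hF F₁ hF₁ z hz1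
        (mem_of_one_smul_eq (F.add_mem hy hh) (by match_scalars <;> decide)) hz)
    have hFq : F ⊓ T ≤ q (c x) := fun s hs => H.mem_of_isCoset (hq _) hF hF3 hx hx1 rfl hs.1 hs.2
    have h1 : e + (y + z) ∈ F ⊓ T := add_mem_of_finrank_le hFq
      (by rw [hq2]; have := one_le_finrank_of_mem (D := F ⊓ T) ⟨hd, hdT⟩ hd0; omega) he
      (fun hh => heF hh.1) hyzq (fun hh => hyzF hh.1)
    have hFT : ∀ s ∈ F ⊓ T, s ∈ F₁ := by
      intro s hs
      by_cases hs0 : s = 0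
      · rw [hs0]; exact F₁.zero_mem
      · rw [eq_of_finrank_le_one hF1 hs ⟨hd, hdT⟩ hs0 hd0]; exact hdF₁
    obtain ⟨hA, hB, -, -⟩ := H.ne_of_finrank hF3
    obtain ⟨hA₁, -, -, -⟩ := H.ne_of_finrank hF₁3
    refine hFF₁ (H.irreducible.eq_of_directions hp (T := T) hF hF₁ H.left_mem hA.symm hA₁.symm
      (hF₁3.trans hF3.symm) (H.finrank_le hF hA hB) H.map_eq_zero (fun s hs hsT => hFT s ⟨hs, hsT⟩)
      (u := x + y) (F.add_mem hx hy) (point_add_point hx1 hy1) (fun hh => hxy ?_) ?_)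
    · exact (H.class_eq_iff_of_small ⟨hx1, F, hF, hF3, hx⟩ hys).2 hh
    · exact mem_of_one_smul_eq (F₁.add_mem (F₁.add_mem hxe hz) (hFT _ h1))
        (by match_scalars <;> decide)
  have hdz := H.mem_of_isCoset (hq _) hF₁ hF₁3 hz hz1 rfl hdF₁ hdT
  have hdq : ∀ i, d ∈ q i := by
    intro i
    rcases hqq _ _ _ hxy hxz hyz i with h1 | h1 | h1 <;> rw [h1] <;> assumption
  obtain ⟨G, hG, hG3, hdG, hG1, u, hu, hu1, v, hv, hv1, huv⟩ := hsmall d hd0 hdq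
  have hnew : ∀ w ∈ G, h w = 1 → c w ≠ c x ∧ c w ≠ c y ∧ c w ≠ c z := by
    intro w hw hw1
    obtain ⟨g, hg, hgT, hg0⟩ := H.exists_direction hG hG3
    have key : ∀ {F' x'}, F' ∈ 𝒰 → finrank (ZMod 2) F' = 3 → x' ∈ F' → h x' = 1 → d ∈ F' →
        c w ≠ c x' := by
      intro F' x' hF' hF3' hx' hx1' hdF' hwx
      exact hdG (H.eq_of_isCoset (hq (c x')) (hq2 _) hG hG3 hF' hF3'
        (by rintro rfl; exact hdG hdF') hw hw1 hwx hx' hx1' rfl hg hgT hg0 hdF' hdT hd0 ▸ hg)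
    exact ⟨key hF hF3 hx hx1 hd, key hF hF3 hy hy1 hd, key hF₁ hF₁3 hz hz1 hdF₁⟩
  have hfour : ∀ i j k l m : Fin 4, ¬ (((i ≠ j ∧ i ≠ k ∧ j ≠ k) ∧ l ≠ i ∧ l ≠ j ∧ l ≠ k) ∧
      (m ≠ i ∧ m ≠ j ∧ m ≠ k) ∧ l ≠ m) := by decide
  exact hfour _ _ _ _ _ ⟨⟨⟨hxy, hxz, hyz⟩, hnew u hu hu1⟩, hnew v hv hv1, huv⟩

/-- The case of two elements of dimension four that contain all points of one class and half of the
points of two others, with an element of dimension three with points in the class `l` and in the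
first of these two classes. -/
theorem false_of_two_cosets_of_mem (H : IsTwoFiveTwoFour h 𝒰 A B T E₁ E₂ c)
    {Q : Submodule (ZMod 2) V} (hQT : Q ≤ T) (hQ2 : finrank (ZMod 2) Q = 2) (hQ₁ : Q ≤ E₁)
    (hQ₂ : Q ≤ E₂) {i j k l : Fin 4}
    (hall : ∀ m : Fin 4, m = i ∨ m = j ∨ m = k ∨ m = l) (hjl : j ≠ l)
    (hi : ∀ x, IsSmallPoint h 𝒰 x → c x ≠ i)
    (hj : IsCoset h 𝒰 T c j Q) (hk : IsCoset h 𝒰 T c k Q)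
    (hl : ∀ v, v ∈ E₁ ∨ v ∈ E₂ → h v = 1 → c v ≠ l) {F : Submodule (ZMod 2) V} (hF : F ∈ 𝒰)
    (hF3 : finrank (ZMod 2) F = 3) {x y : V} (hx : x ∈ F) (hx1 : h x = 1) (hxj : c x = j)
    (hy : y ∈ F) (hy1 : h y = 1) (hyl : c y = l) : False := by
  classical
  have hp := H.isAffinePartition
  have hT3 := H.finrank_eq
  have hF1 := H.finrank_le_one hF hF3 hx hx1 hy hy1 (by rw [hxj, hyl]; exact hjl)
  have hys : IsSmallPoint h 𝒰 y := ⟨hy1, F, hF, hF3, hy⟩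
  obtain ⟨d, hd, hdT, hd0⟩ := H.exists_direction hF hF3
  have hdQ := H.mem_of_isCoset hj hF hF3 hx hx1 hxj hd hdT
  obtain ⟨G, hG, hdG⟩ := H.tight d hd0
  have hG3 := H.finrank_eq_three_of_notMem hG hdT (hQ₁ hdQ) (hQ₂ hdQ) hdG
  have hFG : F ≠ G := by rintro rfl; exact hdG hd
  obtain ⟨g, hg, hgT, hg0⟩ := H.exists_direction hG hG3
  -- `G` has no points in the class `j`, and points in both of the classes `k` and `l`
  have hGcl : ∀ w ∈ G, h w = 1 → c w = k ∨ c w = l := by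
    intro w hw hw1
    rcases hall (c w) with h1 | h1 | h1 | h1
    · exact absurd h1 (hi w ⟨hw1, G, hG, hG3, hw⟩)
    · exact absurd (H.eq_of_isCoset hj hQ2 hF hF3 hG hG3 hFG hx hx1 hxj hw hw1 h1 hd hdT hd0 hg hgT
        hg0 ▸ hg) hdG
    · exact Or.inl h1
    · exact Or.inr h1
  have hG1 : ¬ 2 ≤ finrank (ZMod 2) (G ⊓ T : Submodule (ZMod 2) V) := by
    intro hh
    obtain ⟨w, hw, hw1⟩ := hp.exists_point G hG
    rcases hGcl w hw hw1 with h1 | h1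
    · exact hdG (H.le_of_isCoset hk hQ2 hG hG3 hh hw hw1 h1 hdQ)
    · exact hdG (hp.mem_of_codim_one H.map_eq_zero hG hF (by omega) hw hw1 hy
        ((H.class_eq_iff_of_small ⟨hw1, G, hG, hG3, hw⟩ hys).1 (h1.trans hyl.symm)) hd hdT)
  obtain ⟨z, hz, hz1, hzk⟩ : ∃ z ∈ G, h z = 1 ∧ c z = k := by
    obtain ⟨w, hw, hw1⟩ := hp.exists_point G hG
    obtain ⟨w', hw', hw1', hww'⟩ := H.exists_class_ne_of_finrank_le_one hG hG3 hG1 hw hw1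
    rcases hGcl w hw hw1 with h1 | h1
    · exact ⟨w, hw, hw1, h1⟩
    · rcases hGcl w' hw' hw1' with h2 | h2
      · exact ⟨w', hw', hw1', h2⟩
      · exact absurd (h1.trans h2.symm) hww'
  have hgQ := H.mem_of_isCoset hk hG hG3 hz hz1 hzk hg hgT
  have hgF : g ∉ F := fun hh =>
    hdG (eq_of_finrank_le_one hF1 ⟨hd, hdT⟩ ⟨hh, hgT⟩ hd0 hg0 ▸ hg)
  -- the neighbours of `F` and of `G` in the two cosets have the same directions in `T`
  have hneigh : ∀ {m : Fin 4} {F G : Submodule (ZMod 2) V} {x d g : V}, IsCoset h 𝒰 T c m Q →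
      F ∈ 𝒰 → finrank (ZMod 2) F = 3 → x ∈ F → h x = 1 → c x = m → d ∈ F → d ∈ T → d ≠ 0 →
      g ∈ Q → g ∉ F → ∃ F' ∈ 𝒰, finrank (ZMod 2) F' = 3 ∧ F ≠ F' ∧ x + g ∈ F' ∧ d ∈ F' ∧
        g ∉ F' := by
    intro m F G x d g hm hF hF3 hx hx1 hxm hd hdT hd0 hgQ hgF
    have hgT := hQT hgQ
    have hxs : IsSmallPoint h 𝒰 x := ⟨hx1, F, hF, hF3, hx⟩
    obtain ⟨hxg1, F', hF', hF3', hxg⟩ := (hm x hxs hxm g hgT).2 hgQ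
    have hne : F ≠ F' := by
      rintro rfl
      exact hgF (add_add_cancel_self_two x g ▸ F.add_mem hx hxg)
    obtain ⟨-, hxA, hxB, -, -⟩ := H.isSmallPoint_iff.1 hxs
    obtain ⟨d', hd', hdT', hd0'⟩ := H.exists_direction hF' hF3'
    refine ⟨F', hF', hF3', hne, hxg, ?_, fun hh => hne (hp.eq_of_mem F hF F' hF' x hx1 hx
      (mem_of_one_smul_eq (F'.add_mem hxg hh) (by match_scalars <;> decide)))⟩
    rw [H.eq_of_isCoset hm hQ2 hF hF3 hF' hF3' hne hx hx1 hxm hxg hxg1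
      ((H.class_add hx1 hxA hxB hgT).trans hxm) hd hdT hd0 hd' hdT' hd0']
    exact hd'
  obtain ⟨F₁, hF₁, hF₁3, hFF₁, hxF₁, hdF₁, hgF₁⟩ :=
    hneigh (G := G) hj hF hF3 hx hx1 hxj hd hdT hd0 hgQ hgF
  obtain ⟨G₁, hG₁, hG₁3, hGG₁, -, hgG₁, hdG₁⟩ :=
    hneigh (G := F) hk hG hG3 hz hz1 hzk hg hgT hg0 hdQ hdG
  -- the point `y + g` belongs to the neighbour of `F`, as there are only four elements
  obtain ⟨hyg1, X, hX, hX3, hyX⟩ := H.isSmallPoint_add hys (fun v hv hv1 => by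
    rw [hyl]; exact hl v hv hv1) hgT
  have hyX' : g ∈ X → y ∈ X := fun hh =>
    mem_of_one_smul_eq (X.add_mem hyX hh) (by match_scalars <;> decide)
  have hXF : X ≠ F := by
    rintro rfl
    exact hgF (add_add_cancel_self_two y g ▸ X.add_mem hy hyX)
  have hgX : g ∉ X := fun hh => hXF (hp.eq_of_mem X hX F hF y hy1 (hyX' hh) hy)
  have hXF₁ : X = F₁ := by
    by_contra hne
    have h5 : ({X, F, F₁, G, G₁} : Finset (Submodule (ZMod 2) V)).card = 5 := by
      have key : ∀ {v : V} {Y Z : Submodule (ZMod 2) V}, v ∉ Y → v ∈ Z → Y ≠ Z := by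
        rintro v Y Z hY hZ rfl
        exact hY hZ
      simp [hne, hXF, hFF₁, hGG₁, key hgX hg, key hgX hgG₁, key hgF hg, key hgF hgG₁, key hgF₁ hg,
        key hgF₁ hgG₁]
    have := H.card_le {X, F, F₁, G, G₁}
      (by
        intro Y hY
        simp only [Finset.mem_insert, Finset.mem_singleton] at hY
        rcases hY with rfl | rfl | rfl | rfl | rfl <;> assumption)
      (by
        intro Y hY
        simp only [Finset.mem_insert, Finset.mem_singleton] at hY
        rcases hY with rfl | rfl | rfl | rfl | rfl <;> assumption)
    omega
  subst hXF₁
  obtain ⟨hA, hB, -, -⟩ := H.ne_of_finrank hF3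
  obtain ⟨hA₁, -, -, -⟩ := H.ne_of_finrank hX3
  refine hFF₁ (H.irreducible.eq_of_directions hp (T := T) hF hX H.left_mem hA.symm hA₁.symm
    (hX3.trans hF3.symm) (H.finrank_le hF hA hB) H.map_eq_zero (fun s hs hsT => ?_)
    (u := x + y) (F.add_mem hx hy) (point_add_point hx1 hy1) (fun hh => hjl ?_) ?_)
  · by_cases hs0 : s = 0
    · rw [hs0]; exact X.zero_mem
    · rw [eq_of_finrank_le_one hF1 ⟨hs, hsT⟩ ⟨hd, hdT⟩ hs0 hd0]; exact hdF₁
  · rw [← hxj, ← hyl]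
    exact (H.class_eq_iff_of_small ⟨hx1, F, hF, hF3, hx⟩ hys).2 hh
  · exact mem_of_one_smul_eq (X.add_mem hxF₁ hyX) (by match_scalars <;> decide)

/-- The case of two elements of dimension four that contain all points of one class and half of the
points of two others. -/
theorem false_of_two_cosets (H : IsTwoFiveTwoFour h 𝒰 A B T E₁ E₂ c)
    {Q : Submodule (ZMod 2) V} (hQT : Q ≤ T) (hQ2 : finrank (ZMod 2) Q = 2) (hQ₁ : Q ≤ E₁)
    (hQ₂ : Q ≤ E₂) {i j k l : Fin 4}
    (hall : ∀ m : Fin 4, m = i ∨ m = j ∨ m = k ∨ m = l) (hjl : j ≠ l) (hkl : k ≠ l)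
    (hi : ∀ x, IsSmallPoint h 𝒰 x → c x ≠ i)
    (hj : IsCoset h 𝒰 T c j Q) (hk : IsCoset h 𝒰 T c k Q)
    (hl : ∀ v, v ∈ E₁ ∨ v ∈ E₂ → h v = 1 → c v ≠ l) {p : V} (hps : IsSmallPoint h 𝒰 p)
    (hpl : c p = l) : False := by
  have hp := H.isAffinePartition
  -- an element with points in `l` and in another class, as `l` is no union of elements
  by_cases hcon : ∃ F ∈ 𝒰, finrank (ZMod 2) F = 3 ∧ ∃ y ∈ F, h y = 1 ∧ c y = l ∧
      ∃ x ∈ F, h x = 1 ∧ c x ≠ l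
  · obtain ⟨F, hF, hF3, y, hy, hy1, hyl, x, hx, hx1, hxl⟩ := hcon
    rcases hall (c x) with h1 | h1 | h1 | h1
    · exact hi x ⟨hx1, F, hF, hF3, hx⟩ h1
    · exact H.false_of_two_cosets_of_mem hQT hQ2 hQ₁ hQ₂ hall hjl hi hj hk hl hF hF3 hx hx1
        h1 hy hy1 hyl
    · exact H.false_of_two_cosets_of_mem hQT hQ2 hQ₁ hQ₂ (i := i) (j := k) (k := j) (l := l)
        (fun m => by rcases hall m with h | h | h | h <;> simp [h]) hkl hi hk hj hl hF
        hF3 hx hx1 h1 hy hy1 hyl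
    · exact hxl h1
  · push Not at hcon
    refine H.false_of_flat (S := {v | IsSmallPoint h 𝒰 v ∧ c v = l}) (fun v hv => hv.1)
      (fun x hx y hy z hz => Or.inl (hx.2.trans hy.2.symm)) (fun U hU v hvU hv w hw hw1 => ?_)
      (fun x hx t ht => ⟨H.isSmallPoint_add hx.1 (fun v hv hv1 => hx.2 ▸ hl v hv hv1) ht, ?_⟩)
      (x := p) ⟨hps, hpl⟩
    · obtain ⟨⟨hv1, F, hF, hF3, hvF⟩, hvl⟩ := hv
      obtain rfl := hp.eq_of_mem U hU F hF v hv1 hvU hvF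
      exact ⟨⟨hw1, U, hU, hF3, hw⟩, hcon U hU hF3 v hvU hv1 hvl w hw hw1⟩
    · obtain ⟨hx1, hxA, hxB, -, -⟩ := H.isSmallPoint_iff.1 hx.1
      exact (H.class_add hx1 hxA hxB ht).trans hx.2

theorem finrank_inf_eq_two (H : IsTwoFiveTwoFour h 𝒰 A B T E₁ E₂ c) (hT : ¬ T ≤ E₁) :
    finrank (ZMod 2) (E₁ ⊓ T : Submodule (ZMod 2) V) = 2 := by
  obtain ⟨t, ht, htE⟩ := SetLike.not_le_iff_exists.1 hT
  have h1 := H.finrank_inf_lt ht htE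
  have h2 := H.finrank_le H.mem₁ H.ne₁.1 H.ne₁.2
  have h3 := H.finrank₁
  omega

theorem class_eq_of_le (H : IsTwoFiveTwoFour h 𝒰 A B T E₁ E₂ c) (hT : T ≤ E₁) {x y : V}
    (hx : x ∈ E₁) (hx1 : h x = 1) (hy : y ∈ E₁) (hy1 : h y = 1) : c x = c y := by
  rw [H.class_eq_iff_of_mem H.mem₁ H.ne₁.1 H.ne₁.2 H.mem₁ H.ne₁.1 H.ne₁.2 hx hx1 hy hy1]
  have h1 : T ≤ E₁ ⊓ LinearMap.ker h := fun t ht => ⟨hT ht, H.map_eq_zero t ht⟩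
  have h2 := finrank_inf_ker_add_one hx hx1
  rw [Submodule.eq_of_le_of_finrank_eq h1 (by rw [H.finrank_eq]; rw [H.finrank₁] at h2; omega)]
  exact ⟨E₁.add_mem hx hy, point_add_point hx1 hy1⟩

theorem exists_pair (H : IsTwoFiveTwoFour h 𝒰 A B T E₁ E₂ c) (hT : ¬ T ≤ E₁) {x : V}
    (hx : x ∈ E₁) (hx1 : h x = 1) : ∃ y ∈ E₁, h y = 1 ∧ c x ≠ c y :=
  H.exists_class_ne H.mem₁ H.ne₁.1 H.ne₁.2 (by rw [H.finrank_inf_eq_two hT, H.finrank₁]) hx hx1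

theorem exists_fourth_class : ∀ i j k : Fin 4, (i ≠ j ∧ i ≠ k ∧ j ≠ k) →
    ∃ l, (l ≠ i ∧ l ≠ j ∧ l ≠ k) ∧
    ∀ m, m = i ∨ m = j ∨ m = k ∨ m = l := by
  decide

/-- The case of an element of dimension four that contains all points of a class. -/
theorem false_of_le (H : IsTwoFiveTwoFour h 𝒰 A B T E₁ E₂ c) {F : Submodule (ZMod 2) V}
    (hF : F ∈ 𝒰) (hF3 : finrank (ZMod 2) F = 3) (hT₁ : T ≤ E₁) : False := by
  have hp := H.isAffinePartition
  obtain ⟨x, hx, hx1⟩ := hp.exists_point E₁ H.mem₁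
  obtain ⟨y, hy, hy1⟩ := hp.exists_point E₂ H.mem₂
  have hfull : ∀ {E₁ E₂ x p}, IsTwoFiveTwoFour h 𝒰 A B T E₁ E₂ c → T ≤ E₁ → x ∈ E₁ → h x = 1 →
      IsSmallPoint h 𝒰 p → c p ≠ c x := by
    intro E₁ E₂ x p H hT hx hx1 hps hpx
    obtain ⟨hp1, hpA, hpB, hp₁, -⟩ := H.isSmallPoint_iff.1 hps
    exact hp₁ (H.mem_of_class_eq hT hx hx1 hp1 hpA hpB hpx.symm)
  by_cases hT₂ : T ≤ E₂
  · refine H.false_of_two_empty hF hF3 (H.class_ne_of_le hT₁ hx hx1 hy hy1) ?_ fun p hps =>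
      ⟨hfull H hT₁ hx hx1 hps, hfull H.symm hT₂ hy hy1 hps⟩
    rintro v (hv | hv) hv1
    · exact Or.inl (H.class_eq_of_le hT₁ hv hv1 hx hx1)
    · exact Or.inr (H.symm.class_eq_of_le hT₂ hv hv1 hy hy1)
  · obtain ⟨z, hz, hz1, hyz⟩ := H.symm.exists_pair hT₂ hy hy1
    have hQ2 := H.symm.finrank_inf_eq_two hT₂
    have hxy := H.class_ne_of_le hT₁ hx hx1 hy hy1
    have hxz := H.class_ne_of_le hT₁ hx hx1 hz hz1
    obtain ⟨l, ⟨hlx, hly, hlz⟩, hall⟩ := exists_fourth_class _ _ _ ⟨hxy, hxz, hyz⟩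
    have hl : ∀ v, v ∈ E₁ ∨ v ∈ E₂ → h v = 1 → c v ≠ l := by
      rintro v (hv | hv) hv1 rfl
      · exact hlx (H.class_eq_of_le hT₁ hv hv1 hx hx1)
      · exact (H.symm.class_eq_or hy hy1 hz hz1 hyz hv hv1).elim hly hlz
    obtain ⟨p, hps, hpl⟩ := H.exists_isSmallPoint_class hl
    exact H.false_of_two_cosets inf_le_right hQ2 (inf_le_right.trans hT₁) inf_le_left hall hly.symm
      hlz.symm (fun p hps => hfull H hT₁ hx hx1 hps)
      (H.symm.isCoset_inf hQ2 hy hy1 fun v hv hv1 => H.class_ne_of_le hT₁ hv hv1 hy hy1)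
      (H.symm.isCoset_inf hQ2 hz hz1 fun v hv hv1 => H.class_ne_of_le hT₁ hv hv1 hz hz1) hl hps hpl

/-- The case of two elements of dimension four with points in two classes each and no class in
common. -/
theorem false_of_disjoint_classes (H : IsTwoFiveTwoFour h 𝒰 A B T E₁ E₂ c) (hT₁ : ¬ T ≤ E₁)
    (hT₂ : ¬ T ≤ E₂) (hdisj : ∀ x ∈ E₁, h x = 1 → ∀ y ∈ E₂, h y = 1 → c x ≠ c y) : False := by
  classical
  have hp := H.isAffinePartition
  obtain ⟨x, hx, hx1⟩ := hp.exists_point E₁ H.mem₁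
  obtain ⟨x', hx', hx1', hxx⟩ := H.exists_pair hT₁ hx hx1
  obtain ⟨y, hy, hy1⟩ := hp.exists_point E₂ H.mem₂
  obtain ⟨y', hy', hy1', hyy⟩ := H.symm.exists_pair hT₂ hy hy1
  have hr₁ := H.finrank_inf_eq_two hT₁
  have hr₂ := H.symm.finrank_inf_eq_two hT₂
  have hfour : ∀ i j k l m : Fin 4, (((i ≠ j ∧ k ≠ l) ∧ i ≠ k ∧ i ≠ l) ∧ j ≠ k ∧ j ≠ l) →
      m = i ∨ m = j ∨ m = k ∨ m = l := by decide
  have hcl := fun m => hfour _ _ _ _ m ⟨⟨⟨hxx, hyy⟩, hdisj x hx hx1 y hy hy1,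
    hdisj x hx hx1 y' hy' hy1'⟩, hdisj x' hx' hx1' y hy hy1, hdisj x' hx' hx1' y' hy' hy1'⟩
  set q : Fin 4 → Submodule (ZMod 2) V := fun i =>
    if i = c x ∨ i = c x' then E₁ ⊓ T else E₂ ⊓ T with hq
  have hqx : q (c x) = E₁ ⊓ T := if_pos (Or.inl rfl)
  have hqx' : q (c x') = E₁ ⊓ T := if_pos (Or.inr rfl)
  have hqy : q (c y) = E₂ ⊓ T := if_neg fun hh =>
    hh.elim (hdisj x hx hx1 y hy hy1).symm (hdisj x' hx' hx1' y hy hy1).symm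
  have hqy' : q (c y') = E₂ ⊓ T := if_neg fun hh =>
    hh.elim (hdisj x hx hx1 y' hy' hy1').symm (hdisj x' hx' hx1' y' hy' hy1').symm
  have hq' : ∀ i, q i = E₁ ⊓ T ∨ q i = E₂ ⊓ T := fun i => ite_eq_or_eq _ _ _
  obtain ⟨t, ht, ht0⟩ := exists_mem_ne_zero_of_finrank (D := E₁ ⊓ T ⊓ (E₂ ⊓ T)) (by
    have h1 := Submodule.finrank_sup_add_finrank_inf_eq (E₁ ⊓ T) (E₂ ⊓ T)
    have h2 := Submodule.finrank_mono (sup_le inf_le_right inf_le_right : E₁ ⊓ T ⊔ E₂ ⊓ T ≤ T)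
    have h3 := H.finrank_eq
    omega)
  refine H.false_of_four_cosets (q := q) (fun i => ?_) (fun i => ?_) (fun i => ?_)
    (fun t ht => ⟨?_, ?_⟩) ?_ (t := t) (fun i => ?_) ht0
  · rcases hcl i with rfl | rfl | rfl | rfl
    · rw [hqx]; exact H.isCoset_inf hr₁ hx hx1 fun z hz hz1 => (hdisj x hx hx1 z hz hz1).symm
    · rw [hqx']; exact H.isCoset_inf hr₁ hx' hx1' fun z hz hz1 => (hdisj x' hx' hx1' z hz hz1).symm
    · rw [hqy]; exact H.symm.isCoset_inf hr₂ hy hy1 fun z hz hz1 => hdisj z hz hz1 y hy hy1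
    · rw [hqy']; exact H.symm.isCoset_inf hr₂ hy' hy1' fun z hz hz1 => hdisj z hz hz1 y' hy' hy1'
  · rcases hq' i with h1 | h1 <;> rw [h1] <;> assumption
  · rcases hq' i with h1 | h1 <;> rw [h1] <;> exact inf_le_right
  · have := ht (c x)
    rw [hqx] at this
    exact this.1
  · have := ht (c y)
    rw [hqy] at this
    exact this.1
  · -- of three classes, one belongs to each of the two pairs
    have hpair : ∀ a b i j k l : Fin 4, ((a ≠ b ∧ i ≠ j) ∧ i ≠ k ∧ j ≠ k) →
        ((l = a ∨ l = b) ↔ (i = a ∨ i = b)) ∨ ((l = a ∨ l = b) ↔ (j = a ∨ j = b)) ∨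
        ((l = a ∨ l = b) ↔ (k = a ∨ k = b)) := by decide +kernel
    intro i j k hij hik hjk l
    simp only [hq]
    rcases hpair (c x) (c x') i j k l ⟨⟨hxx, hij⟩, hik, hjk⟩ with h1 | h1 | h1 <;>
      simp only [h1, true_or, or_true]
  · rcases hq' i with h1 | h1 <;> rw [h1]
    · exact ht.1
    · exact ht.2

/-- If both elements of dimension four have half of the points of a class, with the same directions,
then they contain all points of this class. -/
theorem class_ne_of_common_class (H : IsTwoFiveTwoFour h 𝒰 A B T E₁ E₂ c)
    (hr : finrank (ZMod 2) (E₁ ⊓ T : Submodule (ZMod 2) V) = 2) (hQ : E₁ ⊓ T = E₂ ⊓ T) {x y p : V}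
    (hx : x ∈ E₁) (hx1 : h x = 1) (hy : y ∈ E₂) (hy1 : h y = 1) (hxy : c x = c y)
    (hps : IsSmallPoint h 𝒰 p) : c p ≠ c x := by
  intro hpx
  have hpy := hpx.trans hxy
  obtain ⟨hp1, hpA, hpB, hp₁, hp₂⟩ := H.isSmallPoint_iff.1 hps
  obtain ⟨hxA, hxB⟩ := H.notMem_of_mem H.mem₁ H.ne₁.1 H.ne₁.2 hx hx1
  obtain ⟨hyA, hyB⟩ := H.notMem_of_mem H.mem₂ H.symm.ne₁.1 H.symm.ne₁.2 hy hy1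
  have h1 := (H.class_eq_iff p x hp1 hpA hpB hx1 hxA hxB).1 hpx
  have h2 := (H.class_eq_iff p y hp1 hpA hpB hy1 hyA hyB).1 hpy
  have h3 := add_mem_of_finrank_le (D' := E₁ ⊓ T) (D := T) inf_le_right
    (by rw [H.finrank_eq, hr]) h1
    (fun hh => hp₁ (mem_of_one_smul_eq (E₁.add_mem hh.1 hx) (by match_scalars <;> decide))) h2
    (fun hh => by
      rw [hQ] at hh
      exact hp₂ (mem_of_one_smul_eq (E₂.add_mem hh.1 hy) (by match_scalars <;> decide)))
  exact H.ne (H.isAffinePartition.eq_of_mem E₁ H.mem₁ E₂ H.mem₂ y hy1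
    (mem_of_one_smul_eq (E₁.add_mem h3.1 hx) (by match_scalars <;> decide)) hy)

/-- There is no tight irreducible avsp of type `5^2 4^2 3^4`. -/
theorem false (H : IsTwoFiveTwoFour h 𝒰 A B T E₁ E₂ c) {F : Submodule (ZMod 2) V}
    (hF : F ∈ 𝒰) (hF3 : finrank (ZMod 2) F = 3) : False := by
  have hp := H.isAffinePartition
  by_cases hT₁ : T ≤ E₁
  · exact H.false_of_le hF hF3 hT₁
  by_cases hT₂ : T ≤ E₂
  · exact H.symm.false_of_le hF hF3 hT₂
  by_cases hdisj : ∀ x ∈ E₁, h x = 1 → ∀ y ∈ E₂, h y = 1 → c x ≠ c y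
  · exact H.false_of_disjoint_classes hT₁ hT₂ hdisj
  push Not at hdisj
  obtain ⟨x, hx, hx1, y, hy, hy1, hxy⟩ := hdisj
  obtain ⟨x', hx', hx1', hxx⟩ := H.exists_pair hT₁ hx hx1
  obtain ⟨y', hy', hy1', hyy⟩ := H.symm.exists_pair hT₂ hy hy1
  have hr₁ := H.finrank_inf_eq_two hT₁
  have hr₂ := H.symm.finrank_inf_eq_two hT₂
  have hT3 := H.finrank_eq
  have hxyT := (H.class_eq_iff_of_mem H.mem₁ H.ne₁.1 H.ne₁.2 H.mem₂ H.symm.ne₁.1 H.symm.ne₁.2 hx hx1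
    hy hy1).1 hxy
  have hQ : E₁ ⊓ T = E₂ ⊓ T := by
    refine le_antisymm (fun t ht => ⟨?_, ht.2⟩) (fun t ht => ⟨?_, ht.2⟩)
    · exact hp.mem_of_codim_one H.map_eq_zero H.mem₁ H.mem₂ (by omega) hx hx1 hy hxyT ht.1 ht.2
    · exact hp.mem_of_codim_one H.map_eq_zero H.mem₂ H.mem₁ (by omega) hy hy1 hx
        (by rwa [add_comm]) ht.1 ht.2
  have hempty := fun p (hps : IsSmallPoint h 𝒰 p) =>
    H.class_ne_of_common_class hr₁ hQ hx hx1 hy hy1 hxy hps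
  by_cases hxy' : c x' = c y'
  · refine H.false_of_two_empty hF hF3 hxx ?_ fun p hps =>
      ⟨hempty p hps, H.class_ne_of_common_class hr₁ hQ hx' hx1' hy' hy1' hxy' hps⟩
    rintro v (hv | hv) hv1
    · exact H.class_eq_or hx hx1 hx' hx1' hxx hv hv1
    · rw [hxy, hxy']
      exact H.symm.class_eq_or hy hy1 hy' hy1' hyy hv hv1
  · have hxy₁ : c x ≠ c y' := by rwa [hxy]
    obtain ⟨l, ⟨hlx, hlx', hly'⟩, hall⟩ := exists_fourth_class _ _ _ ⟨hxx, hxy₁, hxy'⟩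
    have hE₁ : ∀ v ∈ E₁, h v = 1 → c v = c x ∨ c v = c x' := fun v hv hv1 =>
      H.class_eq_or hx hx1 hx' hx1' hxx hv hv1
    have hE₂ : ∀ v ∈ E₂, h v = 1 → c v = c x ∨ c v = c y' := fun v hv hv1 =>
      hxy ▸ H.symm.class_eq_or hy hy1 hy' hy1' hyy hv hv1
    have hl : ∀ v, v ∈ E₁ ∨ v ∈ E₂ → h v = 1 → c v ≠ l := by
      rintro v (hv | hv) hv1 rfl
      · exact (hE₁ v hv hv1).elim hlx hlx'
      · exact (hE₂ v hv hv1).elim hlx hly'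
    obtain ⟨p, hps, hpl⟩ := H.exists_isSmallPoint_class hl
    refine H.false_of_two_cosets inf_le_right hr₁ inf_le_left (hQ ▸ inf_le_left) hall hlx'.symm
      hly'.symm hempty (H.isCoset_inf hr₁ hx' hx1' fun z hz hz1 hzx => ?_)
      (hQ ▸ H.symm.isCoset_inf hr₂ hy' hy1' fun z hz hz1 hzy => ?_) hl hps hpl
    · exact (hE₂ z hz hz1).elim (fun hh => hxx (hh.symm.trans hzx))
        fun hh => hxy' (hzx.symm.trans hh)
    · exact (hE₁ z hz hz1).elim (fun hh => hxy₁ (hh.symm.trans hzy))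
        fun hh => hxy' (hh.symm.trans hzy)

end IsTwoFiveTwoFour

end TwoFiveTwoFour

/-! ### The possible types -/

section Types

variable {V : Type*} [AddCommGroup V] [Module (ZMod 2) V]

theorem sum_filter_finrank_le (𝒰 : Finset (Submodule (ZMod 2) V)) (d : ℕ) (f : ℕ → ℕ) :
    ∑ X ∈ 𝒰.filter (fun X : Submodule (ZMod 2) V => finrank (ZMod 2) X ≤ d),
      f (finrank (ZMod 2) X) = ∑ e ∈ Finset.range (d + 1), avspType 𝒰 e * f e := by
  rw [← Finset.sum_fiberwise_of_maps_to (t := Finset.range (d + 1))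
    (g := fun X : Submodule (ZMod 2) V => finrank (ZMod 2) X)]
  · refine Finset.sum_congr rfl fun e he => ?_
    rw [Finset.sum_congr rfl fun X hX => by rw [(Finset.mem_filter.1 hX).2], Finset.sum_const,
      smul_eq_mul, avspType, Finset.filter_filter]
    congr 2
    ext X
    simp only [Finset.mem_filter]
    have := Finset.mem_range.1 he
    exact and_congr_right fun _ => ⟨fun hh => hh.2, fun hh => ⟨by omega, hh⟩⟩
  · intro X hX
    have := (Finset.mem_filter.1 hX).2
    exact Finset.mem_range.2 (by omega)

theorem avspType_eq_zero_iff {𝒰 : Finset (Submodule (ZMod 2) V)} {d : ℕ} :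
    avspType 𝒰 d = 0 ↔ ∀ U ∈ 𝒰, finrank (ZMod 2) U ≠ d := by
  rw [avspType, Finset.card_eq_zero, Finset.filter_eq_empty_iff]

theorem exists_of_avspType_ne_zero {𝒰 : Finset (Submodule (ZMod 2) V)} {d : ℕ}
    (hd : avspType 𝒰 d ≠ 0) : ∃ U ∈ 𝒰, finrank (ZMod 2) U = d := by
  by_contra! hcon
  exact hd (avspType_eq_zero_iff.2 hcon)

/-- Subspaces of codimension at most one in `D`. -/
theorem finrank_le_finrank_inf_add_card [Finite V] (D : Submodule (ZMod 2) V)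
    (s : Finset (Submodule (ZMod 2) V))
    (hs : ∀ X ∈ s, finrank (ZMod 2) D ≤ finrank (ZMod 2) (D ⊓ X : Submodule (ZMod 2) V) + 1) :
    finrank (ZMod 2) D ≤ finrank (ZMod 2) (D ⊓ s.inf id : Submodule (ZMod 2) V) + s.card := by
  classical
  induction s using Finset.induction_on with
  | empty => rw [Finset.inf_empty, inf_top_eq]; simp
  | insert X s hX ih =>
    have h1 := ih fun Y hY => hs Y (Finset.mem_insert_of_mem hY)
    have h2 := hs X (Finset.mem_insert_self X s)
    have h3 := Submodule.finrank_sup_add_finrank_inf_eq (D ⊓ s.inf id) (D ⊓ X)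
    have h4 := Submodule.finrank_mono
      (sup_le inf_le_left inf_le_left : D ⊓ s.inf id ⊔ D ⊓ X ≤ D)
    have h5 := Submodule.finrank_mono (show D ⊓ s.inf id ⊓ (D ⊓ X) ≤ D ⊓ (insert X s).inf id by
      rw [Finset.inf_insert, id_eq]
      exact le_inf (inf_le_left.trans inf_le_left)
        (le_inf (inf_le_right.trans inf_le_right) (inf_le_left.trans inf_le_right)))
    rw [Finset.card_insert_of_notMem hX]
    omega

variable [Fintype V] {h : V →ₗ[ZMod 2] ZMod 2} {𝒰 : Finset (Submodule (ZMod 2) V)}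

theorem IsAffinePartition.finrank_lt (hp : IsAffinePartition h 𝒰) {U : Submodule (ZMod 2) V}
    (hU : U ∈ 𝒰) : finrank (ZMod 2) U < finrank (ZMod 2) V := by
  obtain ⟨v, -, hv⟩ := hp.exists_notMem U hU
  rw [← finrank_top (ZMod 2) V]
  exact finrank_lt_of_mem_notMem le_top Submodule.mem_top hv

theorem IsAffinePartition.one_le_finrank (hp : IsAffinePartition h 𝒰) {U : Submodule (ZMod 2) V}
    (hU : U ∈ 𝒰) : 1 ≤ finrank (ZMod 2) U := by
  obtain ⟨v, hv, hv1⟩ := hp.exists_point U hU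
  exact one_le_finrank_of_mem hv (ne_zero_of_map_eq_one hv1)

theorem IsAffinePartition.sum_two_pow_eq (hp : IsAffinePartition h 𝒰) (hh : ∃ v, h v = 1) :
    ∑ U ∈ 𝒰, 2 ^ (finrank (ZMod 2) U - 1) = 2 ^ (finrank (ZMod 2) V - 1) := by
  classical
  obtain ⟨v, hv⟩ := hh
  rw [hp.sum_two_pow (Finset.Subset.refl 𝒰), ← finrank_top (ZMod 2) V,
    ← card_filter_mem_eq_one (Submodule.mem_top (x := v)) hv]
  congr 1
  ext v
  simp only [Finset.mem_filter, Finset.mem_univ, Submodule.mem_top, true_and, and_iff_left_iff_imp]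
  exact hp.exists_mem v

/-- If all elements have dimension at least five, then there are at most four of them, and they
have a common direction. -/
theorem IsAffinePartition.exists_finrank_lt_five (hp : IsAffinePartition h 𝒰)
    (hh : ∃ v, h v = 1) (htight : ∀ t ≠ 0, ∃ U ∈ 𝒰, t ∉ U) (hV : finrank (ZMod 2) V = 7) :
    ∃ U ∈ 𝒰, finrank (ZMod 2) U < 5 := by
  classical
  by_contra! h5
  have hsum := hp.sum_two_pow_eq hh
  obtain ⟨v, hv⟩ := hh
  obtain ⟨A, hA, -⟩ := hp.exists_mem v hv
  obtain ⟨a, ha, ha1⟩ := hp.exists_point A hA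
  have hcard : 𝒰.card * 2 ^ 4 ≤ 2 ^ 6 := by
    rw [hV] at hsum
    rw [← hsum, ← smul_eq_mul]
    exact Finset.card_nsmul_le_sum _ _ _ fun U hU =>
      Nat.pow_le_pow_right two_pos (by have := h5 U hU; omega)
  have h1 := finrank_inf_ker_add_one ha ha1
  have h2 := h5 A hA
  have h3 := finrank_le_finrank_inf_add_card (A ⊓ LinearMap.ker h) (𝒰.erase A) fun X hX => by
    obtain ⟨hXA, hX⟩ := Finset.mem_erase.1 hX
    have h4 := Submodule.finrank_sup_add_finrank_inf_eq A X
    have h6 := Submodule.finrank_le (A ⊔ X)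
    have h7 := h5 X hX
    have h8 : A ⊓ X ≤ A ⊓ LinearMap.ker h ⊓ X := fun t ht => ⟨⟨ht.1, LinearMap.mem_ker.2
      (zmod_two_ne_one.1 fun h1 => hXA (hp.eq_of_mem X hX A hA t h1 ht.2 ht.1))⟩, ht.2⟩
    have h9 := Submodule.finrank_mono h8
    omega
  rw [Finset.card_erase_of_mem hA] at h3
  obtain ⟨t, ht, ht0⟩ := exists_mem_ne_zero_of_finrank
    (D := A ⊓ LinearMap.ker h ⊓ (𝒰.erase A).inf id) (by omega)
  obtain ⟨U, hU, htU⟩ := htight t ht0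
  rcases eq_or_ne U A with rfl | hUA
  · exact htU ht.1.1
  · exact htU ((Finset.inf_le (f := id) (Finset.mem_erase.2 ⟨hUA, hU⟩)) ht.2)

/-- Elements of dimension one are parallel. -/
theorem IsAffineIrreducible.avspType_one (hirr : IsAffineIrreducible h 𝒰)
    (hp : IsAffinePartition h 𝒰) : avspType 𝒰 1 ≤ 2 := by
  by_contra! h3
  obtain ⟨U, U', X, hU, hU', hX, hne, hUX, hUX'⟩ := Finset.two_lt_card_iff.1 h3
  simp only [Finset.mem_filter] at hU hU' hX
  have hdir : ∀ {U : Submodule (ZMod 2) V}, U ∈ 𝒰 → finrank (ZMod 2) U = 1 → ∀ t ∈ U, h t = 0 →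
      t = 0 := by
    intro U hU hU1 t ht ht0
    obtain ⟨u, hu, hu1⟩ := hp.exists_point U hU
    by_contra htne
    have := eq_of_finrank_le_one hU1.le ht hu htne (ne_zero_of_map_eq_one hu1)
    rw [this, hu1] at ht0
    exact absurd ht0 (by decide)
  refine hirr.not_parallel hp hU.1 hU'.1 hX.1 hne hUX.symm hUX'.symm fun t ht =>
    ⟨fun htU => ?_, fun htU => ?_⟩
  · rw [hdir hU.1 hU.2 t htU ht]; exact U'.zero_mem
  · rw [hdir hU'.1 hU'.2 t htU ht]; exact U.zero_mem

/-- The types of tight irreducible partitions of the affine space of dimension six. -/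
theorem IsAffineIrreducible.isListedType (hirr : IsAffineIrreducible h 𝒰)
    (hp : IsAffinePartition h 𝒰) (hh : ∃ v, h v = 1) (htight : ∀ t ≠ 0, ∃ U ∈ 𝒰, t ∉ U)
    (hV : finrank (ZMod 2) V = 7) : IsListedType (avspType 𝒰) := by
  classical
  have hlt : ∀ U ∈ 𝒰, finrank (ZMod 2) U < 7 := fun U hU => hV ▸ hp.finrank_lt hU
  have hm0 : avspType 𝒰 0 = 0 := avspType_eq_zero_iff.2 fun U hU => by
    have := hp.one_le_finrank hU; omega
  have hsum : ∑ e ∈ Finset.range 7, avspType 𝒰 e * 2 ^ (e - 1) = 64 := by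
    have := hp.sum_two_pow_eq hh
    rw [hV] at this
    rw [← sum_filter_finrank_le 𝒰 6 fun e => 2 ^ (e - 1), Finset.filter_true_of_mem fun U hU => by
      have := hlt U hU; omega]
    exact this
  have hlow : ∀ d e, 1 ≤ e → e ≤ d → d ≤ 5 → avspType 𝒰 e ≠ 0 →
      2 ^ d < ∑ e ∈ Finset.range (d + 1), avspType 𝒰 e * 2 ^ (e - 1) := by
    intro d e he hed hd5 hme
    obtain ⟨U, hU, hUe⟩ := exists_of_avspType_ne_zero hme
    rw [← sum_filter_finrank_le 𝒰 d fun e => 2 ^ (e - 1)]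
    exact hirr.two_pow_lt_sum hp (he.trans hed) (by omega) hh hU (by omega)
  have hm1 := hirr.avspType_one hp
  have hmin : ∃ e, 1 ≤ e ∧ e < 5 ∧ avspType 𝒰 e ≠ 0 := by
    obtain ⟨U, hU, hU5⟩ := hp.exists_finrank_lt_five hh htight hV
    exact ⟨_, hp.one_le_finrank hU, hU5, fun hh => avspType_eq_zero_iff.1 hh U hU rfl⟩
  have h11 := hlow 1 1 le_rfl le_rfl (by omega)
  have h22 := hlow 2 2 (by omega) le_rfl (by omega)
  have h32 := hlow 3 2 (by omega) (by omega) (by omega)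
  have h33 := hlow 3 3 (by omega) le_rfl (by omega)
  obtain ⟨e, he1, he5, hme⟩ := hmin
  have h4 := hlow 4 e he1 (by omega) (by omega) hme
  have h5 := hlow 5 e he1 (by omega) (by omega) hme
  simp only [Finset.sum_range_succ, Finset.sum_range_zero] at hsum h11 h22 h32 h33 h4 h5
  norm_num [hm0] at hsum h11 h22 h32 h33 h4 h5
  have hm1' : avspType 𝒰 1 = 0 := by
    by_contra hne
    have := h11 hne
    omega
  rw [hm1'] at hsum h22 h32 h33 h4 h5
  have hm6 : avspType 𝒰 6 = 0 := by omega
  have htype : avspType 𝒰 =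
      typeFiveToTwo (avspType 𝒰 5) (avspType 𝒰 4) (avspType 𝒰 3) (avspType 𝒰 2) := by
    funext d
    match d with
    | 0 => exact hm0
    | 1 => exact hm1'
    | 2 => rfl
    | 3 => rfl
    | 4 => rfl
    | 5 => rfl
    | 6 => exact hm6
    | d + 7 =>
      refine avspType_eq_zero_iff.2 fun U hU => ?_
      have := hlt U hU
      omega
  -- the elements of the dimensions that occur
  have hdim : ∀ U ∈ 𝒰, finrank (ZMod 2) U = 2 ∨ finrank (ZMod 2) U = 3 ∨ finrank (ZMod 2) U = 4 ∨
      finrank (ZMod 2) U = 5 := by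
    intro U hU
    have h1 := hp.one_le_finrank hU
    have h2 := hlt U hU
    have h3 := avspType_eq_zero_iff.1 hm1' U hU
    have h4 := avspType_eq_zero_iff.1 hm6 U hU
    omega
  have hno : ∀ d, avspType 𝒰 d = 0 → ∀ U ∈ 𝒰, finrank (ZMod 2) U ≠ d := fun d hd =>
    avspType_eq_zero_iff.1 hd
  have hone : ¬ (avspType 𝒰 5 = 1 ∧ avspType 𝒰 4 = 6) := by
    rintro ⟨hm5, hm4⟩
    obtain ⟨A, hA⟩ := Finset.card_eq_one.1 hm5
    have hAm := Finset.mem_filter.1 (hA ▸ Finset.mem_singleton_self A)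
    refine hirr.false_of_one_five hp htight hV hAm.1 hAm.2 fun E hE hEA => ?_
    have h1 := hno 2 (by omega) E hE
    have h2 := hno 3 (by omega) E hE
    have h3 : finrank (ZMod 2) E ≠ 5 := fun hh =>
      hEA (Finset.mem_singleton.1 (hA ▸ Finset.mem_filter.2 ⟨hE, hh⟩))
    rcases hdim E hE with h | h | h | h <;> omega
  have htwo : avspType 𝒰 5 = 2 → ∃ A B c, IsFourClasses h 𝒰 A B (A ⊓ B) c ∧
      finrank (ZMod 2) A = 5 ∧ finrank (ZMod 2) B = 5 ∧
      ∀ E ∈ 𝒰, E ≠ A → E ≠ B → finrank (ZMod 2) E ≠ 5 := by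
    intro hm5
    obtain ⟨A, B, hAB, hAB'⟩ := Finset.card_eq_two.1 hm5
    have hA := Finset.mem_filter.1 (hAB' ▸ Finset.mem_insert_self A {B})
    have hB := Finset.mem_filter.1 (hAB' ▸ Finset.mem_insert_of_mem (Finset.mem_singleton_self B))
    obtain ⟨X, hX, hXe⟩ := exists_of_avspType_ne_zero hme
    obtain ⟨c, hc⟩ := exists_isFourClasses hirr hp hV hA.1 hB.1 hX hAB
      (by rintro rfl; omega) (by rintro rfl; omega) hA.2 hB.2
    refine ⟨A, B, c, hc, hA.2, hB.2, fun E hE hEA hEB hE5 => ?_⟩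
    have := hAB' ▸ Finset.mem_filter.2 ⟨hE, hE5⟩
    simp only [Finset.mem_insert, Finset.mem_singleton] at this
    exact this.elim hEA hEB
  have htwo₁ : ¬ (avspType 𝒰 5 = 2 ∧ avspType 𝒰 4 = 4) := by
    rintro ⟨hm5, hm4⟩
    obtain ⟨A, B, c, hc, -, -, hne⟩ := htwo hm5
    refine hc.false_of_two_five_four htight fun E hE hEA hEB => ?_
    have h1 := hno 2 (by omega) E hE
    have h2 := hno 3 (by omega) E hE
    have h3 := hne E hE hEA hEB
    rcases hdim E hE with h | h | h | h <;> omega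
  have htwo₂ : ¬ (avspType 𝒰 5 = 2 ∧ avspType 𝒰 4 = 2 ∧ avspType 𝒰 3 = 4) := by
    rintro ⟨hm5, hm4, hm3⟩
    obtain ⟨A, B, c, hc, hA5, hB5, hne⟩ := htwo hm5
    obtain ⟨E₁, E₂, hE, hE'⟩ := Finset.card_eq_two.1 hm4
    have hE₁ := Finset.mem_filter.1 (hE' ▸ Finset.mem_insert_self E₁ {E₂})
    have hE₂ := Finset.mem_filter.1
      (hE' ▸ Finset.mem_insert_of_mem (Finset.mem_singleton_self E₂))
    obtain ⟨F, hF, hF3⟩ := exists_of_avspType_ne_zero (𝒰 := 𝒰) (d := 3) (by omega)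
    have H : IsTwoFiveTwoFour h 𝒰 A B (A ⊓ B) E₁ E₂ c :=
      { hc with
        irreducible := hirr
        tight := htight
        mem₁ := hE₁.1
        mem₂ := hE₂.1
        ne := hE
        finrank_left := hA5
        finrank_right := hB5
        finrank₁ := hE₁.2
        finrank₂ := hE₂.2
        cases_of_mem := fun X hX => by
          by_contra! hcon
          have h1 := hno 2 (by omega) X hX
          have h2 := hne X hX hcon.1 hcon.2.1
          have h3 : finrank (ZMod 2) X ≠ 4 := fun hh => by
            have := hE' ▸ Finset.mem_filter.2 ⟨hX, hh⟩
            simp only [Finset.mem_insert, Finset.mem_singleton] at this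
            exact this.elim hcon.2.2.1 hcon.2.2.2.1
          rcases hdim X hX with h | h | h | h
          · exact h1 h
          · exact hcon.2.2.2.2 h
          · exact h3 h
          · exact h2 h
        card_le := fun s hs hs3 => hm3 ▸ Finset.card_le_card fun X hX =>
          Finset.mem_filter.2 ⟨hs hX, hs3 X hX⟩ }
    exact H.false hF hF3
  rw [htype]
  generalize avspType 𝒰 5 = m₅ at *
  generalize avspType 𝒰 4 = i at *
  generalize avspType 𝒰 3 = j at *
  generalize avspType 𝒰 2 = m₂ at *
  have h5le : m₅ ≤ 2 := by omega
  interval_cases m₅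
  · obtain rfl : m₂ = 32 - 2 * j - 4 * i := by omega
    exact .no_five i j (by omega) (by omega) (by omega) (by omega)
  · obtain rfl : m₂ = 24 - 2 * j - 4 * i := by omega
    exact .one_five i j (by omega) (by omega) (by omega)
  · obtain rfl : m₂ = 16 - 2 * j - 4 * i := by omega
    exact .two_five i j (by omega) (by omega) (by omega) (by
      rintro ⟨⟩
      exact htwo₂ ⟨rfl, rfl, rfl⟩)

end Types

/-! ### Checking partitions given by lists of points -/

section Codes

/-- Evaluates the natural number `n` before it is passed to `f`; this keeps evaluation in the kernel
from copying unevaluated terms. -/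
def withValue {α : Type} (n : ℕ) (f : ℕ → α) : α :=
  match n with
  | 0 => f 0
  | k + 1 => f (Nat.succ k)

theorem withValue_eq {α : Type} (n : ℕ) (f : ℕ → α) : withValue n f = f n := by
  cases n <;> rfl

/-- Whether the bit mask `m` contains `n`. -/
def bitAt (m n : ℕ) : Bool := Nat.beq (Nat.land (Nat.shiftRight m n) 1) 1

theorem bitAt_eq_testBit (m n : ℕ) : bitAt m n = m.testBit n := by
  change Nat.beq ((m >>> n) &&& 1) 1 = _
  rw [Nat.testBit, Nat.land_comm, Nat.one_and_eq_mod_two]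
  rcases Nat.mod_two_eq_zero_or_one (m >>> n) with h | h <;> rw [h] <;> rfl

/-- The bit mask of a list of numbers. -/
def maskOf : List ℕ → ℕ
  | [] => 0
  | p :: l => Nat.lor (Nat.shiftLeft 1 p) (maskOf l)

theorem bitAt_maskOf {l : List ℕ} {p : ℕ} : bitAt (maskOf l) p = true ↔ p ∈ l := by
  rw [bitAt_eq_testBit]
  induction l with
  | nil => simp [maskOf]
  | cons a l ih =>
    change ((1 <<< a ||| maskOf l).testBit p) = true ↔ _
    rw [Nat.testBit_or, Nat.one_shiftLeft, Nat.testBit_two_pow, Bool.or_eq_true, ih]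
    simp [eq_comm]

/-- The points `0, …, 63` of the list form a flat of the affine space of 6-bit vectors. -/
def isFlatCode : List ℕ → Bool
  | [] => false
  | p :: l => withValue (maskOf (p :: l)) fun m =>
    l.all fun x => l.all fun y => bitAt m (Nat.xor p (Nat.xor x y))

/-- Some direction of the flat `a` translates a point of `b` into the mask `m`. -/
def stepMeets : List ℕ → List ℕ → ℕ → Bool
  | [], _, _ => false
  | p :: l, b, m => (p :: l).any fun x => withValue (Nat.xor p x) fun d =>
    b.any fun y => bitAt m (Nat.xor d y)

/-- Exchanges the bits of the mask `m` at the positions in `c` with those `s` positions higher. -/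
def swapBits (c s m : ℕ) : ℕ :=
  Nat.lor (Nat.land (Nat.shiftRight m s) c) (Nat.shiftLeft (Nat.land m c) s)

/-- For each bit `i` of a position, the number `2 ^ i` and the mask of the positions below `64` in
which the bit `i` is not set. -/
def swapTable : List (ℕ × ℕ × ℕ) :=
  [(0, 1, 0x5555555555555555), (1, 2, 0x3333333333333333), (2, 4, 0x0F0F0F0F0F0F0F0F),
    (3, 8, 0x00FF00FF00FF00FF), (4, 16, 0x0000FFFF0000FFFF), (5, 32, 0x00000000FFFFFFFF)]

/-- With `swapTable`, the translate of a mask of points by the vector `v`. -/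
def translateMask (v : ℕ) : List (ℕ × ℕ × ℕ) → ℕ → ℕ
  | [], m => m
  | (i, s, c) :: l, m =>
    bif bitAt v i then withValue (swapBits c s m) (translateMask v l) else translateMask v l m

/-- Enlarges the flat with the mask `M`, which contains `b`, to the flat it spans with the points
of a list. -/
def joinPoints (b : ℕ) : List ℕ → ℕ → ℕ
  | [], M => M
  | p :: l, M => bif bitAt M p then joinPoints b l M else
    withValue (Nat.lor M (translateMask (Nat.xor b p) swapTable M)) (joinPoints b l)

/-- Joins to a flat, one after the other, all flats of the list that it meets. -/
def joinMeeting (b : ℕ) : List (List ℕ) → ℕ → ℕ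
  | [], M => M
  | e :: els, M => withValue (Nat.land M (maskOf e)) fun q =>
    bif Nat.beq q 0 then joinMeeting b els M else withValue (joinPoints b e M) (joinMeeting b els)

/-- Starting from the flats `a` and `b`, three rounds of joining the flats that are met produce the
whole space. -/
def closureIsAll (els : List (List ℕ)) : List ℕ → List ℕ → Bool
  | [], _ => false
  | p :: l, b =>
    withValue (joinPoints p b (maskOf (p :: l))) fun M =>
    withValue (joinMeeting p els M) fun M =>
    withValue (joinMeeting p els M) fun M =>
    Nat.beq (joinMeeting p els M) (2 ^ 64 - 1)

/-- For every pair of flats in the list, the flats spanned by the pair either meet an earlier third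
flat or lead to the whole space. The mask `pre` is the union of the flats in `earlier`. -/
def pairsGenerate (els : List (List ℕ)) : List (List ℕ) → ℕ → List (List ℕ) → Bool
  | _, _, [] => true
  | earlier, pre, b :: rest =>
    (earlier.all fun a => withValue (Nat.xor pre (maskOf a)) fun q =>
      stepMeets a b q || stepMeets b a q || closureIsAll els a b) &&
    withValue (Nat.lor pre (maskOf b)) fun pre' => pairsGenerate els (b :: earlier) pre' rest

/-- The directions of the first flat that are directions of all flats. -/
def commonDirections : List (List ℕ) → List ℕ
  | [] => []
  | [] :: _ => []
  | (p :: l) :: els => els.foldl (fun D e => withValue (maskOf e) fun m =>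
      D.filter fun t => bitAt m (Nat.xor t (e.headD 0))) ((p :: l).map fun x => Nat.xor p x)

/-- The flats in the list partition the points `0, …, 63`, have no common direction and no
nontrivial union that is a flat. -/
def isTightIrreducibleCode (els : List (List ℕ)) : Bool :=
  els.all isFlatCode && Nat.beq els.flatten.length 64 &&
    Nat.beq (maskOf els.flatten) (2 ^ 64 - 1) &&
    (commonDirections els).all (fun t => Nat.beq t 0) &&
    pairsGenerate els [] 0 els

/-- The flats in the list have the type `5^{m₅} 4^{m₄} 3^{m₃} 2^{m₂}`. A flat of linear dimension
`d` has `2 ^ (d - 1)` points. -/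
def hasTypeCode (m₅ m₄ m₃ m₂ : ℕ) (els : List (List ℕ)) : Bool :=
  Nat.beq (els.countP fun L => Nat.beq L.length 8) m₄ &&
  Nat.beq (els.countP fun L => Nat.beq L.length 4) m₃ &&
  Nat.beq (els.countP fun L => Nat.beq L.length 16) m₅ &&
  Nat.beq (els.countP fun L => Nat.beq L.length 2) m₂ &&
  els.all fun L => Nat.beq L.length 2 || Nat.beq L.length 4 || Nat.beq L.length 8 ||
    Nat.beq L.length 16

/-! ### Soundness of the check -/

theorem swapTable_spec : ∀ e ∈ swapTable, e.2.2 < 2 ^ 64 ∧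
    ∀ y < 64, e.2.2.testBit y = true → y + e.2.1 = y ^^^ e.2.1 := by
  decide +kernel

theorem bitAt_swapBits {c s m x : ℕ} (hc : c < 2 ^ 64)
    (hcs : ∀ y < 64, c.testBit y = true → y + s = y ^^^ s) (h : bitAt (swapBits c s m) x = true) :
    bitAt m (x ^^^ s) = true := by
  have hlt : ∀ y, c.testBit y = true → y < 64 := fun y hy => by
    by_contra hy'
    have := Nat.testBit_lt_two_pow (lt_of_lt_of_le hc (Nat.pow_le_pow_right (by norm_num)
      (not_lt.1 hy')))
    simp [this] at hy
  rw [bitAt_eq_testBit] at h ⊢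
  change (((m >>> s) &&& c) ||| ((m &&& c) <<< s)).testBit x = true at h
  simp only [Nat.testBit_or, Nat.testBit_and, Nat.testBit_shiftRight, Nat.testBit_shiftLeft,
    Bool.or_eq_true, Bool.and_eq_true, decide_eq_true_eq] at h
  rcases h with ⟨h1, h2⟩ | ⟨h1, h2, h3⟩
  · rw [← hcs x (hlt x h2) h2, add_comm]; exact h1
  · have h4 := hcs _ (hlt _ h3) h3
    rw [Nat.sub_add_cancel h1] at h4
    rw [h4, Nat.xor_assoc, Nat.xor_self, Nat.xor_zero]; exact h2

/-- The vector by which `translateMask` translates. -/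
def tableSum (v : ℕ) : List (ℕ × ℕ × ℕ) → ℕ
  | [] => 0
  | (i, s, _) :: l => (bif bitAt v i then s else 0) ^^^ tableSum v l

theorem bitAt_translateMask {v x : ℕ} (l : List (ℕ × ℕ × ℕ)) (hl : ∀ e ∈ l, e ∈ swapTable) (m : ℕ)
    (h : bitAt (translateMask v l m) x = true) : bitAt m (x ^^^ tableSum v l) = true := by
  induction l generalizing m with
  | nil => simpa [tableSum, translateMask] using h
  | cons e l ih =>
    obtain ⟨i, s, c⟩ := e
    have he := swapTable_spec _ (hl _ List.mem_cons_self)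
    have ih' := ih fun e he => hl e (List.mem_cons_of_mem _ he)
    rw [translateMask, withValue_eq] at h
    rw [tableSum]
    cases hv : bitAt v i with
    | true =>
      rw [hv, cond_true] at h
      have h2 := bitAt_swapBits he.1 he.2 (ih' _ h)
      rwa [cond_true, Nat.xor_comm s, ← Nat.xor_assoc]
    | false =>
      rw [hv, cond_false] at h
      simpa using ih' _ h

theorem tableSum_swapTable : ∀ v < 64, tableSum v swapTable = v := by
  decide +kernel

variable {s : ℕ → Prop}

/-- The assertions about masks are made for a set `s` of numbers below `64` that is closed under the
sum of three elements. -/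
structure IsFlatPred (s : ℕ → Prop) : Prop where
  lt : ∀ x, s x → x < 64
  xor : ∀ x y z, s x → s y → s z → s (x ^^^ (y ^^^ z))

theorem IsFlatPred.joinPoints (hs : IsFlatPred s) {b : ℕ} (hb : s b) (l : List ℕ)
    (hl : ∀ p ∈ l, s p) (M : ℕ) (hM : ∀ x, bitAt M x = true → s x) :
    ∀ x, bitAt (joinPoints b l M) x = true → s x := by
  induction l generalizing M with
  | nil => exact hM
  | cons p l ih =>
    have ih' := ih fun q hq => hl q (List.mem_cons_of_mem _ hq)
    have hp := hl p List.mem_cons_self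
    rw [_root_.joinPoints, withValue_eq]
    cases hMp : bitAt M p with
    | true => rw [cond_true]; exact ih' M hM
    | false =>
      rw [cond_false]
      refine ih' _ fun x hx => ?_
      rw [bitAt_eq_testBit] at hx
      change ((M ||| translateMask (b ^^^ p) swapTable M).testBit x) = true at hx
      rw [Nat.testBit_or, Bool.or_eq_true, ← bitAt_eq_testBit, ← bitAt_eq_testBit] at hx
      rcases hx with hx | hx
      · exact hM x hx
      · have h1 := bitAt_translateMask swapTable (fun _ h => h) M hx
        rw [tableSum_swapTable _ (Nat.xor_lt_two_pow (n := 6) (hs.lt b hb) (hs.lt p hp))] at h1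
        have h2 := hs.xor _ _ _ (hM _ h1) hb hp
        rwa [Nat.xor_assoc, Nat.xor_self, Nat.xor_zero] at h2

theorem IsFlatPred.joinMeeting (hs : IsFlatPred s) {b : ℕ} (hb : s b) (els : List (List ℕ))
    (hsat : ∀ L ∈ els, ∀ p ∈ L, s p → ∀ q ∈ L, s q) (M : ℕ) (hM : ∀ x, bitAt M x = true → s x) :
    ∀ x, bitAt (joinMeeting b els M) x = true → s x := by
  induction els generalizing M with
  | nil => exact hM
  | cons e els ih =>
    have ih' := ih fun L hL => hsat L (List.mem_cons_of_mem _ hL)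
    rw [_root_.joinMeeting, withValue_eq, withValue_eq]
    cases hq : Nat.beq (Nat.land M (maskOf e)) 0 with
    | true => rw [cond_true]; exact ih' M hM
    | false =>
      rw [cond_false]
      have hne : M &&& maskOf e ≠ 0 := fun h0 => by
        have : Nat.land M (maskOf e) = 0 := h0
        rw [this] at hq
        exact absurd hq (by decide)
      obtain ⟨x, hx⟩ := Nat.exists_testBit_of_ne_zero hne
      rw [Nat.testBit_and, Bool.and_eq_true, ← bitAt_eq_testBit, ← bitAt_eq_testBit] at hx
      exact ih' _ (hs.joinPoints hb e
        (hsat e List.mem_cons_self x (bitAt_maskOf.1 hx.2) (hM x hx.1)) M hM)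

theorem testBit_of_beq_full {M p : ℕ} (h : Nat.beq M (2 ^ 64 - 1) = true) (hp : p < 64) :
    bitAt M p = true := by
  rw [Nat.eq_of_beq_eq_true h, bitAt_eq_testBit, Nat.testBit_two_pow_sub_one]
  simpa using hp

theorem IsFlatPred.closureIsAll (hs : IsFlatPred s) {els : List (List ℕ)}
    (hsat : ∀ L ∈ els, ∀ p ∈ L, s p → ∀ q ∈ L, s q) {a b : List ℕ} (ha : ∀ p ∈ a, s p)
    (hb : ∀ p ∈ b, s p) (h : closureIsAll els a b = true) : ∀ p < 64, s p := by
  cases a with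
  | nil => simp [_root_.closureIsAll] at h
  | cons p l =>
    rw [_root_.closureIsAll, withValue_eq, withValue_eq, withValue_eq] at h
    have hp := ha p List.mem_cons_self
    intro x hx
    exact hs.joinMeeting hp els hsat _ (hs.joinMeeting hp els hsat _ (hs.joinMeeting hp els hsat _
      (hs.joinPoints hp b hb _ fun y hy => ha y (bitAt_maskOf.1 hy)))) x (testBit_of_beq_full h hx)

theorem IsFlatPred.exists_of_stepMeets (hs : IsFlatPred s) {a b : List ℕ} (ha : ∀ p ∈ a, s p)
    (hb : ∀ p ∈ b, s p) {m : ℕ} (h : stepMeets a b m = true) :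
    ∃ x, bitAt m x = true ∧ s x := by
  cases a with
  | nil => simp [stepMeets] at h
  | cons p l =>
    simp only [stepMeets, withValue_eq, List.any_eq_true] at h
    obtain ⟨x, hx, y, hy, hxy⟩ := h
    refine ⟨_, hxy, ?_⟩
    have := hs.xor _ _ _ (ha p List.mem_cons_self) (ha x hx) (hb y hy)
    rwa [← Nat.xor_assoc] at this

/-- If a set closed under the sum of three elements is a union of flats of a checked list, among
them two different ones, then it contains everything: the check leads from any pair of flats to one
with smaller positions in the list or to the whole space. -/
theorem IsFlatPred.of_pairsGenerate (hs : IsFlatPred s) {els : List (List ℕ)}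
    (hsat : ∀ L ∈ els, ∀ p ∈ L, s p → ∀ q ∈ L, s q) (rest : List (List ℕ)) :
    ∀ (earlier : List (List ℕ)) (pre : ℕ), (∀ L ∈ earlier, L ∈ els) → (∀ L ∈ rest, L ∈ els) →
      (∀ x, bitAt pre x = true ↔ ∃ L ∈ earlier, x ∈ L) →
      (∀ a ∈ earlier, ∀ b ∈ earlier, a ≠ b → (∀ p ∈ a, s p) → (∀ p ∈ b, s p) → ∀ p < 64, s p) →
      pairsGenerate els earlier pre rest = true →
      ∀ a ∈ earlier ++ rest, ∀ b ∈ earlier ++ rest, a ≠ b → (∀ p ∈ a, s p) → (∀ p ∈ b, s p) →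
        ∀ p < 64, s p := by
  induction rest with
  | nil =>
    intro earlier pre _ _ _ hearlier _
    simpa using hearlier
  | cons c rest ih =>
    intro earlier pre hE hR hpre hearlier h
    rw [pairsGenerate, withValue_eq, Bool.and_eq_true, List.all_eq_true] at h
    obtain ⟨h1, h2⟩ := h
    have hc : ∀ a ∈ earlier, (∀ p ∈ a, s p) → (∀ p ∈ c, s p) → ∀ p < 64, s p := by
      intro a haE ha hcs
      have h3 := h1 a haE
      rw [withValue_eq, Bool.or_eq_true, Bool.or_eq_true] at h3
      have key : ∀ x, bitAt (Nat.xor pre (maskOf a)) x = true → s x → ∀ p < 64, s p := by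
        intro x hx hsx
        rw [bitAt_eq_testBit] at hx
        change ((pre ^^^ maskOf a).testBit x) = true at hx
        rw [Nat.testBit_xor, ← bitAt_eq_testBit, ← bitAt_eq_testBit] at hx
        have hxa : x ∉ a := fun hxa => by
          rw [bitAt_maskOf.2 hxa, (hpre x).2 ⟨a, haE, hxa⟩] at hx
          exact absurd hx (by decide)
        have hxa' : bitAt (maskOf a) x = false := by
          rw [← Bool.not_eq_true, bitAt_maskOf]; exact hxa
        rw [hxa', Bool.xor_false] at hx
        obtain ⟨L, hL, hxL⟩ := (hpre x).1 hx
        exact hearlier a haE L hL (fun hh => hxa (hh ▸ hxL)) ha (hsat L (hE L hL) x hxL hsx)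
      rcases h3 with (h3 | h3) | h3
      · obtain ⟨x, hx, hsx⟩ := hs.exists_of_stepMeets ha hcs h3
        exact key x hx hsx
      · obtain ⟨x, hx, hsx⟩ := hs.exists_of_stepMeets hcs ha h3
        exact key x hx hsx
      · exact hs.closureIsAll hsat ha hcs h3
    have := ih (c :: earlier) _ ?_ ?_ ?_ ?_ h2
    · intro a ha b hb
      exact this a (by simp only [List.mem_append, List.mem_cons] at ha ⊢; tauto) b
        (by simp only [List.mem_append, List.mem_cons] at hb ⊢; tauto)
    · intro L hL
      rcases List.mem_cons.1 hL with rfl | hL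
      · exact hR _ List.mem_cons_self
      · exact hE L hL
    · exact fun L hL => hR L (List.mem_cons_of_mem _ hL)
    · intro x
      rw [bitAt_eq_testBit]
      change ((pre ||| maskOf c).testBit x) = true ↔ _
      rw [Nat.testBit_or, Bool.or_eq_true, ← bitAt_eq_testBit, ← bitAt_eq_testBit, hpre,
        bitAt_maskOf]
      simp only [List.mem_cons, exists_eq_or_imp]
      exact or_comm
    · intro a ha b hb hab has hbs
      rcases List.mem_cons.1 ha with rfl | ha' <;> rcases List.mem_cons.1 hb with rfl | hb'
      · exact absurd rfl hab
      · exact hc b hb' hbs has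
      · exact hc a ha' has hbs
      · exact hearlier a ha' b hb' hab has hbs

theorem mem_commonDirections {p t : ℕ} {l : List ℕ} {els : List (List ℕ)}
    (h : ∀ e ∈ (p :: l) :: els, t ^^^ e.headD 0 ∈ e) :
    t ∈ commonDirections ((p :: l) :: els) := by
  have key : ∀ (els : List (List ℕ)) (D : List ℕ), (∀ e ∈ els, t ^^^ e.headD 0 ∈ e) → t ∈ D →
      t ∈ els.foldl (fun D e => withValue (maskOf e) fun m =>
        D.filter fun t => bitAt m (Nat.xor t (e.headD 0))) D := by
    intro els
    induction els with
    | nil => exact fun D _ hD => hD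
    | cons e els ih =>
      intro D he hD
      refine ih _ (fun e' he' => he e' (List.mem_cons_of_mem _ he')) ?_
      simp only [withValue_eq]
      exact List.mem_filter.2 ⟨hD, bitAt_maskOf.2 (he e List.mem_cons_self)⟩
  refine key els _ (fun e he => h e (List.mem_cons_of_mem _ he)) ?_
  refine List.mem_map.2 ⟨_, h _ List.mem_cons_self, ?_⟩
  change p ^^^ (t ^^^ p) = t
  rw [Nat.xor_comm t, ← Nat.xor_assoc, Nat.xor_self, Nat.zero_xor]

theorem xor_mem_of_isFlatCode {L : List ℕ} (h : isFlatCode L = true) {x y z : ℕ} (hx : x ∈ L)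
    (hy : y ∈ L) (hz : z ∈ L) : x ^^^ (y ^^^ z) ∈ L := by
  cases L with
  | nil => simp at hx
  | cons p l =>
    simp only [isFlatCode, withValue_eq, List.all_eq_true, bitAt_maskOf] at h
    have key : ∀ x ∈ p :: l, ∀ y ∈ p :: l, p ^^^ (x ^^^ y) ∈ p :: l := by
      intro x hx y hy
      rcases List.mem_cons.1 hx with rfl | hx'
      · rw [← Nat.xor_assoc, Nat.xor_self, Nat.zero_xor]; exact hy
      · rcases List.mem_cons.1 hy with rfl | hy'
        · rw [Nat.xor_comm x, ← Nat.xor_assoc, Nat.xor_self, Nat.zero_xor]; exact hx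
        · exact h x hx' y hy'
    have h1 := key _ (key x hx y hy) z hz
    have h2 : p ^^^ (p ^^^ (x ^^^ y) ^^^ z) = x ^^^ (y ^^^ z) := by
      rw [Nat.xor_assoc p, ← Nat.xor_assoc p p, Nat.xor_self, Nat.zero_xor, Nat.xor_assoc]
    rwa [h2] at h1

end Codes

/-! ### Partitions from lists of points -/

section Realization

/-- The point of the affine space `v 6 = 1` whose first six coordinates are the bits of `p`. -/
def bitPoint (p : ℕ) : Fin 7 → ZMod 2 := fun i =>
  bif decide ((i : ℕ) = 6) then 1 else bif p.testBit i then 1 else 0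

theorem bitPoint_six (p : ℕ) : (LinearMap.proj 6 : (Fin 7 → ZMod 2) →ₗ[ZMod 2] ZMod 2) (bitPoint p)
    = 1 := rfl

theorem bitPoint_xor (x y z : ℕ) :
    bitPoint (x ^^^ (y ^^^ z)) = bitPoint x + bitPoint y + bitPoint z := by
  funext i
  simp only [bitPoint, Pi.add_apply, Nat.testBit_xor]
  generalize x.testBit i = a, y.testBit i = b, z.testBit i = c, decide ((i : ℕ) = 6) = d
  revert a b c d
  decide

theorem bitPoint_injective {x y : ℕ} (hx : x < 64) (hy : y < 64) (h : bitPoint x = bitPoint y) :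
    x = y := by
  refine Nat.eq_of_testBit_eq fun i => ?_
  by_cases hi : i < 6
  · have := congrFun h ⟨i, by omega⟩
    have h6 : decide (i = 6) = false := by simp; omega
    simp only [bitPoint, h6, cond_false] at this
    generalize x.testBit i = a, y.testBit i = b at this
    revert a b
    decide
  · have : 64 ≤ 2 ^ i := by
      calc 64 = 2 ^ 6 := by norm_num
        _ ≤ 2 ^ i := Nat.pow_le_pow_right (by norm_num) (by omega)
    rw [Nat.testBit_lt_two_pow (hx.trans_le this), Nat.testBit_lt_two_pow (hy.trans_le this)]

theorem exists_bitPoint {v : Fin 7 → ZMod 2} (hv : v 6 = 1) : ∃ p < 64, bitPoint p = v := by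
  refine ⟨Nat.ofBits fun i : Fin 6 => decide (v i.castSucc = 1), Nat.ofBits_lt_two_pow _, ?_⟩
  funext i
  by_cases hi : (i : ℕ) < 6
  · have h6 : decide ((i : ℕ) = 6) = false := by simp; omega
    simp only [bitPoint, h6, cond_false]
    rw [Nat.testBit_ofBits_lt _ _ hi]
    have : (⟨(i : ℕ), hi⟩ : Fin 6).castSucc = i := rfl
    rw [this]
    rcases zmod_two_eq_zero_or_one (v i) with h | h <;> rw [h] <;> rfl
  · have : i = 6 := by omega
    subst this
    rw [hv]; rfl

/-- The subspace spanned by the points in a list. -/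
noncomputable def codeFlat (L : List ℕ) : Submodule (ZMod 2) (Fin 7 → ZMod 2) :=
  Submodule.span (ZMod 2) (bitPoint '' {p | p ∈ L})

theorem bitPoint_mem_codeFlat {L : List ℕ} (hL : isFlatCode L = true) (hlt : ∀ p ∈ L, p < 64)
    {p : ℕ} (hp : p < 64) : bitPoint p ∈ codeFlat L ↔ p ∈ L := by
  rw [codeFlat, mem_span_iff_of_ternary (h := LinearMap.proj 6) ?_ ?_ (bitPoint_six p)]
  · constructor
    · rintro ⟨q, hq, hqp⟩
      rwa [← bitPoint_injective (hlt q hq) hp hqp]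
    · exact fun h => ⟨p, h, rfl⟩
  · rintro _ ⟨q, -, rfl⟩; rfl
  · rintro _ ⟨x, hx, rfl⟩ _ ⟨y, hy, rfl⟩ _ ⟨z, hz, rfl⟩
    exact ⟨_, xor_mem_of_isFlatCode hL hx hy hz, bitPoint_xor x y z⟩

theorem two_pow_finrank_codeFlat {L : List ℕ} (hL : isFlatCode L = true) (hlt : ∀ p ∈ L, p < 64)
    (hnd : L.Nodup) : 2 ^ (finrank (ZMod 2) (codeFlat L) - 1) = L.length ∧
      1 ≤ finrank (ZMod 2) (codeFlat L) := by
  classical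
  obtain ⟨p, hp⟩ : ∃ p, p ∈ L := by
    cases L with
    | nil => simp [isFlatCode] at hL
    | cons p l => exact ⟨p, List.mem_cons_self⟩
  have hpm := (bitPoint_mem_codeFlat hL hlt (hlt p hp)).2 hp
  refine ⟨?_, one_le_finrank_of_mem hpm (ne_zero_of_map_eq_one (bitPoint_six p))⟩
  rw [← card_filter_mem_eq_one hpm (bitPoint_six p), ← List.toFinset_card_of_nodup hnd]
  symm
  refine Finset.card_bij (fun p _ => bitPoint p) ?_ ?_ ?_
  · intro q hq
    rw [List.mem_toFinset] at hq
    exact Finset.mem_filter.2 ⟨Finset.mem_univ _,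
      (bitPoint_mem_codeFlat hL hlt (hlt q hq)).2 hq, bitPoint_six q⟩
  · intro x hx y hy hxy
    rw [List.mem_toFinset] at hx hy
    exact bitPoint_injective (hlt x hx) (hlt y hy) hxy
  · intro v hv
    simp only [Finset.mem_filter, Finset.mem_univ, true_and] at hv
    obtain ⟨q, hq, rfl⟩ := exists_bitPoint hv.2
    exact ⟨q, List.mem_toFinset.2 ((bitPoint_mem_codeFlat hL hlt hq).1 hv.1), rfl⟩

open Classical in
/-- The set of subspaces spanned by the lists of points. -/
noncomputable def codePartition (els : List (List ℕ)) :
    Finset (Submodule (ZMod 2) (Fin 7 → ZMod 2)) :=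
  (els.map codeFlat).toFinset

theorem two_pow_sub_one_eq_iff {d e : ℕ} (hd : 1 ≤ d) (he : 1 ≤ e) :
    2 ^ (d - 1) = 2 ^ (e - 1) ↔ d = e := by
  rw [Nat.pow_right_inj (le_refl 2)]; omega

/-- A list of lists of points that passes the check gives a tight irreducible avsp. -/
theorem isTightIrreducibleAVSP_codePartition {els : List (List ℕ)} {m₅ m₄ m₃ m₂ : ℕ}
    (h : isTightIrreducibleCode els = true) (htype : hasTypeCode m₅ m₄ m₃ m₂ els = true) :
    IsTightIrreducibleAVSP (codePartition els) ∧
      avspType (codePartition els) = typeFiveToTwo m₅ m₄ m₃ m₂ := by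
  classical
  simp only [isTightIrreducibleCode, Bool.and_eq_true] at h
  obtain ⟨⟨⟨⟨hflat, hlen⟩, hfull⟩, hcomm⟩, hpairs⟩ := h
  rw [List.all_eq_true] at hflat
  have hlen := Nat.eq_of_beq_eq_true hlen
  have hmem : ∀ p, p ∈ els.flatten ↔ p < 64 := by
    intro p
    rw [← bitAt_maskOf, Nat.eq_of_beq_eq_true hfull, bitAt_eq_testBit, Nat.testBit_two_pow_sub_one,
      decide_eq_true_eq]
  have hnd : els.flatten.Nodup := by
    have h1 : els.flatten.toFinset = Finset.range 64 := by
      ext p; rw [List.mem_toFinset, hmem, Finset.mem_range]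
    have h2 := congrArg Finset.card h1
    rw [Finset.card_range, ← hlen] at h2
    rw [← List.dedup_eq_self]
    exact (List.dedup_sublist _).eq_of_length (by rw [← List.card_toFinset]; exact h2)
  obtain ⟨hndL, hdisj⟩ := List.nodup_flatten.1 hnd
  have hlt : ∀ L ∈ els, ∀ p ∈ L, p < 64 := fun L hL p hp =>
    (hmem p).1 (List.mem_flatten.2 ⟨L, hL, hp⟩)
  have hne : ∀ L ∈ els, ∃ p, p ∈ L := by
    intro L hL
    have := hflat L hL
    cases L with
    | nil => simp [isFlatCode] at this
    | cons p l => exact ⟨p, List.mem_cons_self⟩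
  have heq : ∀ L ∈ els, ∀ L' ∈ els, ∀ p, p ∈ L → p ∈ L' → L = L' := by
    intro L hL L' hL' p hp hp'
    by_contra hLL
    have : Std.Symm (@List.Disjoint ℕ) := ⟨fun _ _ hab => hab.symm⟩
    exact hdisj.forall hL hL' hLL hp hp'
  have hmemF : ∀ L ∈ els, ∀ p < 64, (bitPoint p ∈ codeFlat L ↔ p ∈ L) := fun L hL p hp =>
    bitPoint_mem_codeFlat (hflat L hL) (hlt L hL) hp
  have hinj : ∀ L ∈ els, ∀ L' ∈ els, codeFlat L = codeFlat L' → L = L' := by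
    intro L hL L' hL' hLL
    obtain ⟨p, hp⟩ := hne L hL
    have hp64 := hlt L hL p hp
    refine heq L hL L' hL' p hp ((hmemF L' hL' p hp64).1 ?_)
    rw [← hLL]; exact (hmemF L hL p hp64).2 hp
  have hmemP : ∀ U, U ∈ codePartition els ↔ ∃ L ∈ els, codeFlat L = U := by
    intro U; simp [codePartition]
  have hcard : ∀ (q : Submodule (ZMod 2) (Fin 7 → ZMod 2) → Prop) [DecidablePred q],
      ((codePartition els).filter q).card = els.countP fun L => decide (q (codeFlat L)) := by
    intro q _
    have hels : els.Nodup := by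
      refine List.Pairwise.imp_of_mem ?_ hdisj
      rintro a b ha - hab rfl
      obtain ⟨p, hp⟩ := hne a ha
      exact hab hp hp
    have hmapnd : (els.map codeFlat).Nodup := List.Nodup.map_on (fun a ha b hb => hinj a ha b hb)
      hels
    have hfilter : (codePartition els).filter q =
        ((els.map codeFlat).filter fun U => decide (q U)).toFinset := by
      ext U; simp [codePartition]
    rw [hfilter, List.toFinset_card_of_nodup (hmapnd.filter _),
      ← List.countP_eq_length_filter, List.countP_map]
    rfl
  simp only [hasTypeCode, Bool.and_eq_true] at htype
  obtain ⟨⟨⟨⟨h4, h3⟩, h5⟩, h2⟩, hlen'⟩ := htype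
  have h4 := Nat.eq_of_beq_eq_true h4
  have h3 := Nat.eq_of_beq_eq_true h3
  have h5 := Nat.eq_of_beq_eq_true h5
  have h2 := Nat.eq_of_beq_eq_true h2
  have hlens : ∀ L ∈ els, L.length = 2 ∨ L.length = 4 ∨ L.length = 8 ∨ L.length = 16 := by
    intro L hL
    have := List.all_eq_true.1 hlen' L hL
    simpa only [Bool.or_eq_true, Nat.beq_eq, or_assoc] using this
  have hrank := fun L hL => two_pow_finrank_codeFlat (hflat L hL) (hlt L hL) (hndL L hL)
  have hp : IsAffinePartition (LinearMap.proj 6) (codePartition els) := by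
    refine ⟨fun U hU => ?_, fun v hv => ?_, fun U hU U' hU' v hv hvU hvU' => ?_, fun U hU => ?_⟩
    · obtain ⟨L, hL, rfl⟩ := (hmemP U).1 hU
      obtain ⟨p, hp⟩ := hne L hL
      exact ⟨bitPoint p, (hmemF L hL p (hlt L hL p hp)).2 hp, bitPoint_six p⟩
    · obtain ⟨p, hp64, rfl⟩ := exists_bitPoint hv
      obtain ⟨L, hL, hp⟩ := List.mem_flatten.1 ((hmem p).2 hp64)
      exact ⟨codeFlat L, (hmemP _).2 ⟨L, hL, rfl⟩, (hmemF L hL p hp64).2 hp⟩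
    · obtain ⟨L, hL, rfl⟩ := (hmemP U).1 hU
      obtain ⟨L', hL', rfl⟩ := (hmemP U').1 hU'
      obtain ⟨p, hp64, rfl⟩ := exists_bitPoint hv
      rw [heq L hL L' hL' p ((hmemF L hL p hp64).1 hvU) ((hmemF L' hL' p hp64).1 hvU')]
    · obtain ⟨L, hL, rfl⟩ := (hmemP U).1 hU
      have : ∃ p < 64, p ∉ L := by
        by_contra! hcon
        have hsub : Finset.range 64 ⊆ L.toFinset := fun p hp => by
          simpa using hcon p (Finset.mem_range.1 hp)
        have h1 := Finset.card_le_card hsub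
        rw [Finset.card_range] at h1
        have h2 := List.toFinset_card_le L
        rcases hlens L hL with h | h | h | h <;> omega
      obtain ⟨p, hp64, hp⟩ := this
      exact ⟨bitPoint p, bitPoint_six p, fun hh => hp ((hmemF L hL p hp64).1 hh)⟩
  refine ⟨hp.isTightIrreducibleAVSP ?_ ⟨bitPoint 0, bitPoint_six 0⟩ ?_, ?_⟩
  · intro S hS hS3 hsat U hU U' hU' hne' u hu u' hu' huS hu'S v hv
    obtain ⟨L, hL, rfl⟩ := (hmemP U).1 hU
    obtain ⟨L', hL', rfl⟩ := (hmemP U').1 hU'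
    have hs : IsFlatPred fun p => p < 64 ∧ bitPoint p ∈ S := by
      refine ⟨fun x hx => hx.1, fun x y z hx hy hz => ⟨?_, ?_⟩⟩
      · exact Nat.xor_lt_two_pow (n := 6) hx.1 (Nat.xor_lt_two_pow (n := 6) hy.1 hz.1)
      · rw [bitPoint_xor]; exact hS3 _ hx.2 _ hy.2 _ hz.2
    have hsat' : ∀ X ∈ els, ∀ w ∈ codeFlat X, w ∈ S → ∀ q ∈ X, q < 64 ∧ bitPoint q ∈ S :=
      fun X hX w hwX hw q hq => ⟨hlt X hX q hq, hsat _ ((hmemP _).2 ⟨X, hX, rfl⟩) _ hwX hw _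
        ((hmemF X hX q (hlt X hX q hq)).2 hq) (bitPoint_six q)⟩
    obtain ⟨p, hp64, rfl⟩ := exists_bitPoint hv
    exact (hs.of_pairsGenerate (els := els) (fun X hX q hq hsq => hsat' X hX _
      ((hmemF X hX q hsq.1).2 hq) hsq.2) els [] 0 (by simp) (fun _ h => h)
      (by simp [bitAt_eq_testBit]) (by simp) hpairs L (by simpa using hL) L' (by simpa using hL')
      (fun hLL => hne' (by rw [hLL])) (hsat' L hL u hu huS) (hsat' L' hL' u' hu' hu'S) p hp64).2
  · intro t ht
    by_contra! hcon
    have hcon' : ∀ L ∈ els, t ∈ codeFlat L := fun L hL => hcon _ ((hmemP _).2 ⟨L, hL, rfl⟩)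
    -- A common direction `t` translates the point `0` into its own element.
    obtain ⟨L₀, hL₀, h0⟩ := List.mem_flatten.1 ((hmem 0).2 (by norm_num))
    have ht6 : (LinearMap.proj 6 : (Fin 7 → ZMod 2) →ₗ[ZMod 2] ZMod 2) t = 0 := by
      rcases zmod_two_eq_zero_or_one ((LinearMap.proj 6 : (Fin 7 → ZMod 2) →ₗ[ZMod 2] ZMod 2) t)
        with h | h
      · exact h
      · exfalso
        obtain ⟨p, hp64, rfl⟩ := exists_bitPoint h
        have hall : ∀ L ∈ els, L = L₀ := fun L hL =>
          have hL1 := (hmemF L hL p hp64).1 (hcon' L hL)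
          have hL2 := (hmemF L₀ hL₀ p hp64).1 (hcon' L₀ hL₀)
          heq L hL L₀ hL₀ p hL1 hL2
        obtain ⟨v, hv, hvL⟩ := hp.exists_notMem _ ((hmemP _).2 ⟨L₀, hL₀, rfl⟩)
        obtain ⟨U, hU, hvU⟩ := hp.exists_mem v hv
        obtain ⟨L, hL, rfl⟩ := (hmemP U).1 hU
        rw [hall L hL] at hvU
        exact hvL hvU
    obtain ⟨p, hp64, hpt⟩ :=
      exists_bitPoint (v := bitPoint 0 + t) (point_add_direction (bitPoint_six 0) ht6)
    have hp0 : ∀ x, bitPoint (p ^^^ x) = bitPoint x + t := by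
      intro x
      have := bitPoint_xor x p 0
      rw [Nat.xor_zero, Nat.xor_comm] at this
      rw [this, hpt, add_assoc, add_comm (bitPoint 0), add_assoc, add_comm t,
        ZModModule.add_self, zero_add]
    have htr : ∀ L ∈ els, ∀ x ∈ L, p ^^^ x ∈ L := by
      intro L hL x hx
      have hx64 := hlt L hL x hx
      rw [← hmemF L hL _ (Nat.xor_lt_two_pow (n := 6) hp64 hx64), hp0]
      exact Submodule.add_mem _ ((hmemF L hL x hx64).2 hx) (hcon' L hL)
    have hpmem : p ∈ commonDirections els := by
      cases els with
      | nil => simp at hL₀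
      | cons e els =>
        cases e with
        | nil => simpa using hne [] List.mem_cons_self
        | cons q l =>
          refine mem_commonDirections fun e he => htr e he _ ?_
          obtain ⟨y, hy⟩ := hne e he
          cases e with
          | nil => simp at hy
          | cons y e => exact List.mem_cons_self
    have hp00 := Nat.eq_of_beq_eq_true (List.all_eq_true.1 hcomm p hpmem)
    rw [hp00] at hpt
    exact ht (left_eq_add.1 hpt)
  · have hdim : ∀ d, 1 ≤ d → avspType (codePartition els) d =
        els.countP fun L => Nat.beq L.length (2 ^ (d - 1)) := by
      intro d hd
      rw [avspType, hcard]
      refine List.countP_congr fun L hL => ?_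
      rw [decide_eq_true_eq, Nat.beq_eq, ← (hrank L hL).1,
        two_pow_sub_one_eq_iff (hrank L hL).2 hd]
    have hother : ∀ d, d ≠ 2 → d ≠ 3 → d ≠ 4 → d ≠ 5 → avspType (codePartition els) d = 0 := by
      intro d hd2 hd3 hd4 hd5
      rw [avspType, hcard, List.countP_eq_zero]
      intro L hL hh
      rw [decide_eq_true_eq] at hh
      have hr := hrank L hL
      rw [hh] at hr
      have key : ∀ e, 1 ≤ e → L.length = 2 ^ (e - 1) → d = e := fun e he hLe =>
        (two_pow_sub_one_eq_iff hr.2 he).1 (hr.1.trans hLe)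
      rcases hlens L hL with h | h | h | h
      · exact hd2 (key 2 (by norm_num) h)
      · exact hd3 (key 3 (by norm_num) h)
      · exact hd4 (key 4 (by norm_num) h)
      · exact hd5 (key 5 (by norm_num) h)
    funext d
    match d with
    | 0 => exact hother 0 (by norm_num) (by norm_num) (by norm_num) (by norm_num)
    | 1 => exact hother 1 (by norm_num) (by norm_num) (by norm_num) (by norm_num)
    | 2 => rw [hdim 2 (by norm_num)]; exact h2
    | 3 => rw [hdim 3 (by norm_num)]; exact h3
    | 4 => rw [hdim 4 (by norm_num)]; exact h4
    | 5 => rw [hdim 5 (by norm_num)]; exact h5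
    | d + 6 => exact hother (d + 6) (by omega) (by omega) (by omega) (by omega)

end Realization

/-! ### A partition of every listed type -/

section Data

/-- Partitions of the points `0, …, 63` into flats with two elements of dimension `5`: one of each
listed type, in the lexicographic order of the numbers of elements of dimension `4` and `3`. -/
def partitionsTwoFive : List (List (List ℕ)) := [
  [[0, 1, 6, 7, 8, 9, 14, 15, 48, 49, 54, 55, 56, 57, 62, 63], [2, 3, 10, 11, 18, 19, 26, 27, 34,
   35, 42, 43, 50, 51, 58, 59], [23, 60], [12, 37], [17, 28], [33, 53], [29, 46], [21, 47], [24,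
   61], [45, 52], [41, 44], [13, 39], [16, 40], [22, 38], [5, 20], [32, 36], [25, 30], [4, 31]],
  [[0, 6, 11, 13, 17, 23, 26, 28, 35, 37, 40, 46, 50, 52, 57, 63], [2, 4, 8, 14, 18, 20, 24, 30, 32,
   38, 42, 44, 48, 54, 58, 60], [1, 31, 41, 55], [34, 53], [10, 49], [21, 29], [27, 56], [12, 59],
   [7, 47], [9, 61], [5, 16], [45, 51], [33, 43], [25, 39], [3, 36], [19, 22], [15, 62]],
  [[3, 6, 11, 14, 16, 21, 24, 29, 34, 39, 42, 47, 49, 52, 57, 60], [9, 10, 12, 15, 17, 18, 20, 23,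
   32, 35, 37, 38, 56, 59, 61, 62], [26, 30, 41, 45], [2, 27, 46, 55], [33, 48], [0, 31], [22, 40],
   [43, 63], [7, 36], [50, 51], [4, 44], [8, 19], [25, 28], [5, 13], [1, 54], [53, 58]],
  [[2, 6, 9, 13, 17, 21, 26, 30, 34, 38, 41, 45, 49, 53, 58, 62], [1, 5, 10, 14, 16, 20, 27, 31, 33,
   37, 42, 46, 48, 52, 59, 63], [15, 22, 32, 57], [18, 19, 60, 61], [4, 24, 47, 51], [8, 50], [3,
   35], [36, 54], [12, 23], [7, 56], [25, 40], [39, 55], [0, 43], [28, 29], [11, 44]],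
  [[1, 4, 11, 14, 16, 21, 26, 31, 35, 38, 41, 44, 50, 55, 56, 61], [0, 2, 8, 10, 17, 19, 25, 27, 37,
   39, 45, 47, 52, 54, 60, 62], [34, 40, 53, 63], [18, 24, 49, 59], [6, 12, 48, 58], [5, 29, 43,
   51], [13, 22], [3, 15], [9, 28], [7, 30], [33, 57], [20, 42], [32, 46], [23, 36]],
  [[16, 17, 20, 21, 26, 27, 30, 31, 32, 33, 36, 37, 42, 43, 46, 47], [0, 1, 2, 3, 12, 13, 14, 15,
   52, 53, 54, 55, 56, 57, 58, 59], [9, 23, 35, 61], [19, 29, 39, 41], [4, 8, 50, 62], [22, 24, 38,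
   40], [7, 10, 49, 60], [25, 34], [51, 63], [6, 11], [28, 48], [5, 18], [44, 45]],
  [[1, 6, 11, 12, 19, 20, 25, 30, 32, 39, 42, 45, 50, 53, 56, 63], [0, 2, 8, 10, 16, 18, 24, 26, 36,
   38, 44, 46, 52, 54, 60, 62], [5, 15, 55, 61], [28, 29, 48, 49], [9, 31, 37, 51], [7, 14, 34, 43],
   [13, 23, 35, 57], [21, 27, 33, 47], [40, 59], [3, 41], [22, 58], [4, 17]],
  [[2, 6, 10, 14, 18, 22, 26, 30, 33, 37, 41, 45, 49, 53, 57, 61], [1, 7, 9, 15, 17, 23, 25, 31, 32,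
   38, 40, 46, 48, 54, 56, 62], [36, 43, 51, 60], [20, 28, 50, 58], [19, 24, 39, 44], [11, 29, 34,
   52], [8, 13, 16, 21], [4, 12, 55, 63], [3, 27, 35, 59], [0, 5, 42, 47]],
  [[0, 1, 4, 5, 26, 27, 30, 31, 42, 43, 46, 47, 48, 49, 52, 53], [9, 10, 13, 14, 16, 19, 20, 23, 32,
   35, 36, 39, 57, 58, 61, 62], [17, 21, 25, 29, 51, 55, 59, 63], [22, 34], [33, 38], [6, 15], [2,
   7], [3, 8], [28, 54], [12, 41], [44, 56], [18, 40], [50, 60], [37, 45], [11, 24]],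
  [[3, 4, 11, 12, 16, 23, 24, 31, 32, 39, 40, 47, 51, 52, 59, 60], [6, 7, 14, 15, 18, 19, 26, 27,
   36, 37, 44, 45, 48, 49, 56, 57], [1, 5, 9, 13, 50, 54, 58, 62], [0, 20, 33, 53], [8, 46], [29,
   38], [34, 41], [42, 43], [2, 21], [17, 28], [22, 61], [55, 63], [10, 35], [25, 30]],
  [[0, 3, 9, 10, 17, 18, 24, 27, 33, 34, 40, 43, 48, 51, 57, 58], [2, 4, 8, 14, 16, 22, 26, 28, 35,
   37, 41, 47, 49, 55, 59, 61], [11, 15, 19, 23, 42, 46, 50, 54], [21, 25, 52, 56], [5, 29, 38, 62],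
   [20, 32], [30, 63], [39, 44], [7, 45], [31, 60], [12, 13], [1, 6], [36, 53]],
  [[0, 1, 12, 13, 18, 19, 30, 31, 36, 37, 40, 41, 54, 55, 58, 59], [10, 11, 14, 15, 16, 17, 20, 21,
   42, 43, 46, 47, 48, 49, 52, 53], [6, 7, 24, 25, 44, 45, 50, 51], [2, 29, 34, 61], [8, 22, 32,
   62], [3, 5, 57, 63], [26, 56], [28, 33], [4, 35], [23, 39], [9, 27], [38, 60]],
  [[0, 5, 11, 14, 18, 23, 25, 28, 33, 36, 42, 47, 51, 54, 56, 61], [1, 7, 10, 12, 19, 21, 24, 30,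
   35, 37, 40, 46, 49, 55, 58, 60], [9, 13, 16, 20, 34, 38, 59, 63], [2, 15, 52, 57], [3, 8, 22,
   29], [6, 31, 44, 53], [39, 43, 50, 62], [4, 45], [17, 48], [32, 41], [26, 27]],
  [[8, 9, 14, 15, 16, 17, 22, 23, 32, 33, 38, 39, 56, 57, 62, 63], [4, 5, 10, 11, 20, 21, 26, 27,
   34, 35, 44, 45, 50, 51, 60, 61], [2, 3, 28, 29, 40, 41, 54, 55], [42, 46, 48, 52], [12, 25, 36,
   49], [7, 19, 47, 59], [6, 24, 43, 53], [1, 13, 18, 30], [0, 31, 37, 58]],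
  [[1, 3, 13, 15, 17, 19, 29, 31, 33, 35, 45, 47, 49, 51, 61, 63], [5, 7, 9, 11, 16, 18, 28, 30, 37,
   39, 41, 43, 48, 50, 60, 62], [2, 14, 20, 24, 32, 44, 54, 58], [6, 8, 21, 27, 38, 40, 53, 59],
   [34, 36], [0, 12], [26, 56], [22, 55], [4, 10], [25, 57], [23, 46], [42, 52]],
  [[0, 5, 8, 13, 19, 22, 27, 30, 32, 37, 40, 45, 51, 54, 59, 62], [1, 2, 4, 7, 9, 10, 12, 15, 33,
   34, 36, 39, 41, 42, 44, 47], [18, 21, 26, 29, 48, 55, 56, 63], [6, 14, 17, 25, 38, 46, 49, 57],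
   [16, 20, 24, 28], [43, 60], [31, 50], [35, 53], [3, 23], [52, 61], [11, 58]],
  [[2, 3, 14, 15, 16, 17, 28, 29, 36, 37, 40, 41, 54, 55, 58, 59], [4, 5, 10, 11, 22, 23, 24, 25,
   34, 35, 44, 45, 48, 49, 62, 63], [0, 8, 19, 27, 38, 46, 53, 61], [6, 7, 30, 31, 42, 43, 50, 51],
   [9, 13, 56, 60], [1, 12, 52, 57], [20, 39], [18, 26], [33, 47], [21, 32]]]

/-- Partitions of the points `0, …, 63` into flats with one element of dimension `5`: one of each
listed type, in the lexicographic order of the numbers of elements of dimension `4` and `3`. -/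
def partitionsOneFive : List (List (List ℕ)) := [
  [[8, 44], [30, 31], [14, 29], [1, 11], [50, 60], [35, 40], [7, 63], [16, 61], [10, 57], [27, 55],
   [4, 17], [41, 56], [20, 51], [26, 39], [52, 54], [22, 48], [5, 25], [0, 42], [34, 59], [15, 18],
   [3, 12], [33, 38], [45, 46], [21, 37], [2, 6, 9, 13, 19, 23, 24, 28, 32, 36, 43, 47, 49, 53, 58,
   62]],
  [[19, 31, 35, 47], [34, 46], [4, 45], [1, 57], [32, 38], [0, 44], [6, 37], [3, 33], [14, 36], [10,
   39], [13, 25], [9, 11], [12, 28], [58, 63], [22, 51], [26, 42], [7, 15], [2, 53], [54, 60], [40,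
   48], [16, 41], [5, 43], [8, 21], [17, 18, 20, 23, 24, 27, 29, 30, 49, 50, 52, 55, 56, 59, 61,
   62]],
  [[0, 2, 8, 10, 20, 22, 28, 30, 32, 34, 40, 42, 52, 54, 60, 62], [6, 21, 43, 56], [15, 18, 46, 51],
   [48, 61], [1, 24], [47, 63], [23, 31], [12, 39], [33, 55], [19, 29], [4, 36], [16, 45], [3, 9],
   [11, 58], [7, 14], [35, 37], [50, 57], [5, 26], [41, 44], [13, 53], [25, 27], [38, 49], [17,
   59]],
  [[18, 19, 20, 21, 26, 27, 28, 29, 32, 33, 38, 39, 40, 41, 46, 47], [4, 14, 54, 60], [17, 31, 52,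
   58], [8, 9, 10, 11], [0, 7], [36, 63], [53, 57], [24, 30], [5, 43], [23, 61], [1, 49], [34, 48],
   [35, 44], [59, 62], [6, 55], [16, 51], [15, 45], [13, 25], [2, 12], [3, 56], [22, 42], [37, 50]],
  [[0, 5, 11, 14, 17, 20, 26, 31, 33, 36, 42, 47, 48, 53, 59, 62], [7, 15, 37, 45], [8, 30, 46, 56],
   [13, 28, 44, 61], [34, 40, 51, 57], [49, 55], [1, 38], [32, 43], [23, 63], [2, 16], [18, 29],
   [35, 39], [3, 10], [12, 21], [4, 50], [24, 25], [6, 54], [27, 52], [19, 22], [41, 60], [9, 58]],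
  [[0, 5, 9, 12, 17, 20, 24, 29, 32, 37, 41, 44, 49, 52, 56, 61], [8, 15, 40, 47], [7, 31, 35, 59],
   [11, 21, 45, 51], [3, 19, 34, 50], [18, 27, 48, 57], [43, 58], [1, 62], [26, 42], [6, 10], [22,
   25], [2, 60], [16, 36], [39, 46], [23, 63], [38, 53], [14, 54], [4, 30], [13, 55], [28, 33]],
  [[9, 11, 13, 15, 17, 19, 21, 23, 41, 43, 45, 47, 49, 51, 53, 55], [16, 18, 33, 35], [25, 27, 28,
   30], [4, 24, 39, 59], [6, 8, 20, 26], [14, 31, 40, 57], [2, 29, 37, 58], [56, 62], [48, 63], [0,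
   60], [1, 10], [22, 36], [38, 61], [50, 54], [12, 46], [3, 34], [7, 42], [32, 44], [5, 52]],
  [[1, 2, 9, 10, 16, 19, 24, 27, 37, 38, 45, 46, 52, 55, 60, 63], [18, 26, 35, 43], [8, 11, 41, 42],
   [5, 31, 39, 61], [14, 29, 34, 49], [12, 22, 40, 50], [6, 23, 36, 53], [25, 30, 57, 62], [15, 21],
   [32, 54], [28, 44], [13, 58], [4, 48], [51, 56], [3, 17], [33, 47], [7, 59], [0, 20]],
  [[0, 1, 2, 3, 8, 9, 10, 11, 36, 37, 38, 39, 44, 45, 46, 47], [22, 25, 54, 57], [41, 43, 61, 63],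
   [16, 17, 20, 21], [14, 31, 35, 50], [23, 30, 33, 40], [12, 27, 34, 53], [5, 15, 49, 59], [24, 28,
   48, 52], [42, 60], [26, 55], [19, 58], [29, 56], [4, 13], [18, 32], [6, 7], [51, 62]],
  [[0, 1, 6, 7, 8, 9, 14, 15, 18, 19, 20, 21, 26, 27, 28, 29], [32, 43, 54, 61], [13, 16, 42, 55],
   [33, 38, 51, 52], [5, 23, 44, 62], [4, 31, 35, 56], [10, 24, 41, 59], [46, 47, 48, 49], [22, 30,
   37, 45], [34, 36, 58, 60], [25, 50], [3, 63], [12, 53], [2, 11], [17, 39], [40, 57]],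
  [[1, 2, 4, 7, 8, 11, 13, 14, 48, 51, 53, 54, 57, 58, 60, 63], [9, 31, 36, 50], [3, 29, 38, 56],
   [43, 46, 49, 52], [17, 19, 24, 26], [0, 15, 37, 42], [5, 10, 22, 25], [6, 12, 39, 45], [41, 44,
   59, 62], [16, 18, 32, 34], [23, 30, 33, 40], [55, 61], [20, 47], [27, 35], [21, 28]],
  [[0, 2, 4, 6, 25, 27, 29, 31, 32, 34, 36, 38, 57, 59, 61, 63], [42, 43, 50, 51], [35, 47, 52, 56],
   [24, 28, 58, 62], [20, 26, 39, 41], [19, 30, 49, 60], [18, 22, 40, 44], [14, 16, 46, 48], [12,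
   15, 53, 54], [8, 10, 21, 23], [7, 17, 33, 55], [3, 5, 11, 13], [1, 9, 37, 45]],
  [[0, 3, 12, 15, 20, 23, 24, 27, 37, 38, 41, 42, 49, 50, 61, 62], [16, 21, 26, 31, 51, 54, 57, 60],
   [36, 59], [7, 25], [6, 8], [4, 43], [45, 47], [11, 40], [39, 63], [48, 55], [18, 29], [22, 35],
   [19, 58], [5, 14], [1, 13], [10, 46], [2, 32], [28, 52], [34, 56], [30, 44], [17, 33], [9, 53]],
  [[20, 21, 22, 23, 24, 25, 26, 27, 48, 49, 50, 51, 60, 61, 62, 63], [16, 17, 28, 29, 32, 33, 44,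
   45], [36, 38, 57, 59], [8, 12], [31, 53], [37, 43], [7, 18], [41, 47], [9, 30], [10, 40], [14,
   19], [3, 55], [1, 13], [4, 11], [6, 56], [15, 34], [2, 39], [0, 35], [46, 52], [42, 58],
   [5, 54]],
  [[9, 11, 12, 14, 16, 18, 21, 23, 41, 43, 44, 46, 48, 50, 53, 55], [3, 8, 20, 31, 35, 40, 52, 63],
   [5, 24, 33, 60], [26, 28, 34, 36], [22, 61], [19, 45], [0, 2], [37, 56], [39, 49], [29, 59], [27,
   58], [25, 62], [13, 30], [38, 51], [4, 57], [7, 54], [17, 42], [15, 32], [1, 10], [6, 47]],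
  [[4, 6, 8, 10, 17, 19, 29, 31, 37, 39, 41, 43, 48, 50, 60, 62], [18, 23, 27, 30, 35, 38, 42, 47],
   [22, 28, 53, 63], [2, 3, 20, 21], [12, 13, 24, 25], [26, 52], [36, 59], [33, 45], [0, 34], [15,
   44], [32, 56], [40, 51], [11, 54], [7, 14], [16, 46], [1, 58], [5, 57], [9, 49], [55, 61]],
  [[0, 2, 8, 10, 20, 22, 28, 30, 36, 38, 44, 46, 48, 50, 56, 58], [4, 15, 17, 26, 34, 41, 55, 60],
   [16, 31, 37, 42], [21, 27, 33, 47], [18, 23, 24, 29], [5, 9, 53, 57], [14, 49], [25, 62], [3,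
   54], [12, 61], [13, 40], [1, 43], [7, 35], [11, 63], [6, 39], [45, 51], [32, 52], [19, 59]],
  [[3, 7, 9, 13, 19, 23, 25, 29, 34, 38, 40, 44, 50, 54, 56, 60], [4, 11, 16, 31, 36, 43, 48, 63],
   [20, 22, 45, 47], [26, 30, 49, 53], [0, 10, 52, 62], [2, 12, 55, 57], [5, 8, 21, 24], [6, 35],
   [1, 39], [46, 58], [15, 17], [28, 59], [33, 61], [37, 42], [41, 51], [18, 32], [14, 27]],
  [[4, 7, 9, 10, 17, 18, 28, 31, 33, 34, 44, 47, 52, 55, 57, 58], [1, 11, 19, 25, 35, 41, 49, 59],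
   [13, 27, 36, 50], [38, 45, 53, 62], [14, 22, 37, 61], [2, 12, 32, 46], [5, 6, 20, 23], [3, 15,
   48, 60], [30, 42], [43, 54], [0, 8], [40, 63], [16, 51], [21, 56], [24, 26], [29, 39]],
  [[0, 4, 10, 14, 19, 23, 25, 29, 35, 39, 41, 45, 48, 52, 58, 62], [1, 11, 18, 24, 33, 43, 50, 56],
   [27, 31, 57, 61], [12, 22, 38, 60], [15, 30, 46, 63], [9, 16, 44, 53], [2, 28, 47, 49], [17, 20,
   32, 37], [13, 26, 36, 51], [54, 59], [8, 55], [6, 42], [7, 40], [21, 34], [3, 5]],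
  [[0, 7, 10, 13, 17, 22, 27, 28, 32, 39, 42, 45, 49, 54, 59, 60], [1, 6, 18, 21, 35, 36, 48, 55],
   [38, 44, 51, 57], [11, 20, 37, 58], [5, 31, 46, 52], [3, 26, 33, 56], [9, 19, 47, 53], [8, 15,
   16, 23], [4, 25, 34, 63], [12, 14, 41, 43], [50, 61], [30, 62], [2, 29], [24, 40]],
  [[10, 11, 12, 13, 24, 25, 30, 31, 42, 43, 44, 45, 56, 57, 62, 63], [2, 9, 22, 29, 34, 41, 54, 61],
   [50, 51, 58, 59], [20, 26, 38, 40], [19, 21, 35, 37], [16, 17, 48, 49], [8, 27, 39, 52], [7, 28,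
   46, 53], [5, 14, 55, 60], [3, 6, 18, 23], [1, 4, 33, 36], [0, 15, 32, 47]],
  [[0, 3, 4, 7, 25, 26, 29, 30, 41, 42, 45, 46, 48, 51, 52, 55], [5, 6, 20, 23, 44, 47, 61, 62], [9,
   10, 16, 19, 33, 34, 56, 59], [36, 49], [17, 39], [21, 28], [11, 15], [40, 58], [35, 60], [22,
   24], [18, 54], [53, 63], [27, 57], [13, 32], [8, 50], [1, 2], [12, 31], [14, 37], [38, 43]],
  [[2, 4, 9, 15, 18, 20, 25, 31, 33, 39, 42, 44, 49, 55, 58, 60], [10, 13, 16, 23, 35, 36, 57, 62],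
   [5, 8, 21, 24, 34, 47, 50, 63], [37, 38, 45, 46], [22, 59], [17, 27], [19, 40], [7, 12], [6, 51],
   [3, 43], [14, 41], [0, 1], [29, 52], [53, 54], [28, 48], [11, 32], [30, 61], [26, 56]],
  [[0, 1, 12, 13, 22, 23, 26, 27, 36, 37, 40, 41, 50, 51, 62, 63], [8, 15, 25, 30, 43, 44, 58, 61],
   [7, 9, 19, 29, 35, 45, 55, 57], [3, 16, 38, 53], [11, 17, 33, 59], [14, 48], [32, 52], [34, 39],
   [47, 54], [28, 46], [2, 56], [31, 42], [4, 60], [18, 21], [24, 49], [5, 20], [6, 10]],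
  [[4, 7, 13, 14, 21, 22, 28, 31, 36, 39, 45, 46, 53, 54, 60, 63], [16, 17, 26, 27, 34, 35, 40, 41],
   [2, 6, 19, 23, 43, 47, 58, 62], [1, 29, 37, 57], [5, 20, 38, 55], [0, 10, 32, 42], [12, 33], [11,
   61], [30, 56], [8, 44], [52, 59], [48, 49], [18, 50], [25, 51], [3, 9], [15, 24]],
  [[0, 3, 4, 7, 16, 19, 20, 23, 32, 35, 36, 39, 48, 51, 52, 55], [2, 5, 26, 29, 34, 37, 58, 61], [1,
   15, 17, 31, 38, 40, 54, 56], [11, 28, 44, 59], [8, 30, 42, 60], [33, 41, 49, 57], [9, 24, 47,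
   62], [45, 53], [21, 46], [10, 13], [6, 27], [12, 18], [25, 43], [22, 63], [14, 50]],
  [[1, 6, 10, 13, 16, 23, 27, 28, 35, 36, 40, 47, 50, 53, 57, 62], [9, 14, 26, 29, 43, 44, 56, 63],
   [4, 7, 8, 11, 37, 38, 41, 42], [15, 24, 39, 48], [0, 12, 55, 59], [19, 31, 33, 45], [18, 30, 34,
   46], [2, 5, 58, 61], [20, 21], [32, 60], [17, 54], [3, 51], [49, 52], [22, 25]],
  [[0, 1, 8, 9, 18, 19, 26, 27, 34, 35, 42, 43, 48, 49, 56, 57], [16, 22, 24, 30, 33, 39, 41, 47],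
   [4, 7, 12, 15, 20, 23, 28, 31], [36, 45, 52, 61], [51, 54, 58, 63], [37, 46, 53, 62], [5, 25, 32,
   60], [6, 10, 55, 59], [3, 13, 38, 40], [11, 21], [29, 50], [17, 44], [2, 14]],
  [[8, 11, 12, 15, 25, 26, 29, 30, 33, 34, 37, 38, 48, 51, 52, 55], [4, 6, 16, 18, 41, 43, 61, 63],
   [3, 13, 21, 27, 35, 45, 53, 59], [32, 46, 50, 60], [17, 24, 49, 56], [14, 31, 47, 62], [9, 20,
   39, 58], [5, 7, 40, 42], [2, 23, 44, 57], [1, 19, 36, 54], [0, 10, 22, 28]],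
  [[3, 4, 10, 13, 18, 21, 27, 28, 35, 36, 42, 45, 50, 53, 59, 60], [7, 9, 19, 29, 32, 46, 52, 58],
   [16, 17, 24, 25, 48, 49, 56, 57], [0, 5, 11, 14, 34, 39, 41, 44], [2, 30], [15, 20], [31, 51],
   [12, 54], [37, 63], [23, 26], [1, 6], [55, 62], [43, 47], [22, 38], [40, 61], [8, 33]],
  [[2, 3, 4, 5, 8, 9, 14, 15, 16, 17, 22, 23, 26, 27, 28, 29], [34, 35, 42, 43, 54, 55, 62, 63], [1,
   6, 18, 21, 40, 47, 59, 60], [0, 13, 20, 25, 33, 44, 53, 56], [30, 31, 50, 51], [49, 57], [19,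
   32], [10, 58], [7, 11], [46, 48], [36, 41], [39, 61], [24, 45], [12, 38], [37, 52]],
  [[0, 3, 4, 7, 9, 10, 13, 14, 49, 50, 53, 54, 56, 59, 60, 63], [19, 23, 25, 29, 32, 36, 42, 46],
   [1, 15, 20, 26, 34, 44, 55, 57], [17, 22, 24, 31, 51, 52, 58, 61], [2, 5, 33, 38], [11, 16, 43,
   48], [18, 39], [37, 45], [6, 30], [21, 41], [12, 28], [40, 62], [8, 47], [27, 35]],
  [[1, 2, 9, 10, 20, 23, 28, 31, 33, 34, 41, 42, 52, 55, 60, 63], [3, 12, 21, 26, 39, 40, 49, 62],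
   [0, 6, 27, 29, 43, 45, 48, 54], [13, 15, 16, 18, 36, 38, 57, 59], [8, 25, 44, 61], [11, 22, 46,
   51], [4, 7, 32, 35], [17, 19], [14, 37], [47, 56], [24, 50], [30, 58], [5, 53]],
  [[8, 11, 13, 14, 17, 18, 20, 23, 32, 35, 37, 38, 57, 58, 60, 63], [10, 15, 27, 30, 33, 36, 48,
   53], [19, 22, 25, 28, 50, 55, 56, 61], [4, 12, 16, 24, 34, 42, 54, 62], [3, 6, 41, 44], [9, 31,
   39, 49], [7, 26, 46, 51], [2, 29, 43, 52], [21, 59], [45, 47], [0, 40], [1, 5]],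
  [[40, 41, 42, 43, 44, 45, 46, 47, 56, 57, 58, 59, 60, 61, 62, 63], [24, 26, 28, 30, 32, 34, 36,
   38], [2, 4, 10, 12, 17, 23, 25, 31], [3, 5, 18, 20, 33, 39, 48, 54], [11, 27, 37, 53], [9, 14,
   51, 52], [8, 13, 19, 22], [7, 15, 21, 29], [1, 16, 35, 50], [0, 6, 49, 55]],
  [[0, 6, 10, 12, 19, 21, 25, 31, 35, 37, 41, 47, 48, 54, 58, 60], [3, 11, 16, 24, 32, 40, 51, 59],
   [7, 14, 20, 29, 36, 45, 55, 62], [34, 39, 43, 46, 49, 52, 56, 61], [2, 9, 17, 26, 33, 42, 50,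
   57], [4, 44], [13, 30], [1, 53], [5, 28], [27, 38], [8, 22], [15, 23], [18, 63]],
  [[5, 6, 13, 14, 16, 19, 24, 27, 37, 38, 45, 46, 48, 51, 56, 59], [0, 11, 17, 26, 39, 44, 54, 61],
   [3, 8, 22, 29, 34, 41, 55, 60], [2, 4, 9, 15, 18, 20, 25, 31], [35, 36, 40, 47, 50, 53, 57, 62],
   [10, 30, 43, 63], [33, 52], [7, 49], [21, 28], [12, 32], [1, 23], [42, 58]],
  [[5, 6, 12, 15, 17, 18, 24, 27, 36, 39, 45, 46, 48, 51, 57, 58], [1, 10, 21, 30, 32, 43, 52, 63],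
   [4, 11, 16, 31, 35, 44, 55, 56], [9, 14, 26, 29, 40, 47, 59, 60], [3, 8, 23, 28, 33, 42, 53, 62],
   [13, 25, 38, 50], [7, 20, 34, 49], [2, 37], [0, 61], [19, 41], [22, 54]],
  [[0, 6, 9, 15, 19, 21, 26, 28, 33, 39, 40, 46, 50, 52, 59, 61], [8, 12, 27, 31, 43, 47, 56, 60],
   [2, 7, 18, 23, 35, 38, 51, 54], [3, 10, 20, 29, 32, 41, 55, 62], [1, 4, 11, 14, 48, 53, 58, 63],
   [17, 30, 34, 45], [16, 22, 42, 44], [13, 25, 37, 49], [5, 24, 36, 57]]]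

/-- Partitions of the points `0, …, 63` into flats with no element of dimension `5`: one of each
listed type, in the lexicographic order of the numbers of elements of dimension `4` and `3`. -/
def partitionsNoFive : List (List (List ℕ)) := [
  [[12, 16], [23, 46], [35, 57], [15, 47], [59, 61], [32, 42], [18, 26], [9, 17], [0, 38], [6, 54],
   [14, 53], [1, 41], [2, 49], [43, 58], [31, 62], [45, 50], [7, 11], [29, 34], [40, 60], [21, 63],
   [27, 56], [20, 51], [5, 33], [39, 44], [37, 48], [36, 55], [3, 19], [22, 25], [28, 30], [10, 24],
   [8, 52], [4, 13]],
  [[10, 36], [14, 18], [1, 46], [62, 63], [3, 25], [30, 59], [21, 45], [20, 35], [51, 53], [2, 50],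
   [38, 55], [0, 34], [54, 58], [13, 43], [41, 44], [15, 37], [28, 52], [5, 12], [8, 17], [26, 33],
   [32, 48], [16, 27], [19, 56], [40, 60], [9, 22], [7, 61], [11, 57], [23, 42], [24, 49], [39, 47],
   [4, 6, 29, 31]],
  [[4, 24, 40, 52], [2, 50], [39, 51], [6, 58], [44, 49], [20, 54], [41, 60], [7, 25], [13, 63],
   [53, 56], [21, 48], [10, 22], [47, 57], [1, 32], [26, 31], [3, 9], [15, 59], [12, 55], [36, 45],
   [17, 38], [19, 27], [8, 23], [11, 34], [0, 16], [42, 43], [18, 35], [29, 61], [5, 28], [33, 37],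
   [14, 30, 46, 62]],
  [[7, 16, 35, 52], [13, 26], [10, 57], [40, 59], [18, 39], [47, 58], [2, 36], [38, 60], [22, 30],
   [5, 32], [6, 55], [23, 54], [8, 49], [20, 43], [25, 33], [0, 15], [19, 29], [1, 12], [21, 37],
   [3, 24], [27, 50], [11, 14], [28, 51], [17, 42], [44, 45], [46, 56], [31, 63], [4, 9, 48, 61],
   [34, 41, 53, 62]],
  [[8, 14, 32, 38], [0, 15], [19, 25], [42, 52], [26, 34], [27, 51], [37, 58], [50, 59], [41, 49],
   [13, 61], [47, 62], [22, 54], [6, 55], [1, 9], [2, 48], [4, 30], [5, 56], [12, 16], [18, 20],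
   [21, 24], [7, 35], [45, 63], [31, 40], [17, 36], [39, 44], [10, 23, 33, 60], [11, 28, 46, 57],
   [3, 29, 43, 53]],
  [[1, 3, 16, 18], [0, 23, 46, 57], [20, 26, 38, 40], [7, 21, 35, 49], [11, 17, 41, 51], [14, 53],
   [27, 30], [2, 56], [9, 31], [39, 50], [6, 32], [22, 52], [28, 33], [5, 59], [4, 60], [15, 58],
   [12, 29], [13, 37], [10, 24], [54, 55], [36, 43], [34, 61], [25, 48], [44, 47], [19, 62], [8,
   63], [42, 45]],
  [[26, 29, 50, 53], [40, 45, 58, 63], [0, 1, 14, 15], [23, 24, 35, 44], [6, 20, 36, 54], [34, 43,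
   52, 61], [38, 62], [21, 42], [11, 27], [2, 47], [18, 60], [3, 5], [33, 37], [4, 9], [12, 19],
   [30, 57], [7, 46], [28, 32], [10, 49], [25, 59], [8, 56], [31, 51], [13, 39], [17, 41], [22, 55],
   [16, 48]],
  [[24, 26, 57, 59], [6, 12, 48, 58], [13, 14, 28, 31], [23, 30, 55, 62], [0, 19, 33, 50], [15, 21,
   34, 56], [1, 27, 46, 52], [10, 32], [22, 29], [40, 45], [20, 63], [11, 18], [16, 54], [47, 53],
   [2, 25], [35, 41], [4, 61], [17, 36], [3, 5], [42, 43], [7, 38], [9, 49], [39, 51], [8, 60], [37,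
   44]],
  [[3, 7, 16, 20], [19, 26, 48, 57], [25, 30, 43, 44], [4, 18, 45, 59], [6, 15, 17, 24], [49, 51,
   61, 63], [9, 12, 32, 37], [22, 28, 52, 62], [29, 38], [40, 60], [1, 50], [8, 58], [27, 36], [5,
   10], [11, 54], [23, 55], [21, 31], [41, 53], [34, 35], [13, 46], [39, 56], [0, 47], [2, 14], [33,
   42]],
  [[4, 16, 47, 59], [0, 9, 35, 42], [15, 30, 38, 55], [2, 12, 48, 62], [11, 18, 43, 50], [1, 6, 24,
   31], [8, 14, 17, 23], [39, 41, 54, 56], [3, 28, 34, 61], [19, 36], [5, 37], [25, 51], [13, 60],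
   [10, 44], [27, 33], [52, 53], [22, 49], [40, 57], [21, 29], [45, 58], [20, 26], [7, 46], [32,
   63]],
  [[3, 15, 39, 43], [5, 11, 19, 29], [7, 12, 49, 58], [17, 28, 54, 59], [37, 47, 50, 56], [33, 44,
   52, 57], [4, 6, 40, 42], [2, 27, 46, 55], [8, 14, 18, 20], [0, 1, 34, 35], [32, 60], [16, 53],
   [21, 38], [31, 48], [10, 13], [36, 51], [61, 62], [9, 26], [22, 45], [24, 25], [41, 63], [23,
   30]],
  [[12, 16, 40, 52], [18, 20, 51, 53], [17, 31, 49, 63], [1, 10, 19, 24], [2, 7, 35, 38], [6, 29,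
   43, 48], [3, 11, 39, 47], [21, 27, 50, 60], [0, 14, 23, 25], [4, 22, 37, 55], [41, 46, 57, 62],
   [13, 33], [8, 42], [26, 36], [28, 61], [9, 44], [5, 15], [56, 59], [34, 58], [32, 45], [30, 54]],
  [[0, 27, 38, 61], [6, 18, 37, 49], [20, 29, 39, 46], [4, 24, 42, 54], [5, 8, 55, 58], [14, 28, 44,
   62], [33, 35, 41, 43], [32, 40, 51, 59], [3, 25, 47, 53], [10, 19, 45, 52], [17, 26, 50, 57], [7,
   12, 21, 30], [9, 36], [15, 60], [22, 23], [31, 48], [2, 56], [11, 13], [16, 34], [1, 63]],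
  [[42, 46, 49, 53], [0, 10, 33, 43], [17, 28, 54, 59], [5, 23, 38, 52], [22, 24, 55, 57], [1, 8,
   36, 45], [20, 26, 34, 44], [6, 27, 35, 62], [12, 16, 47, 51], [21, 29, 50, 58], [32, 37, 56, 61],
   [7, 13, 19, 25], [3, 15, 18, 30], [11, 63], [4, 9], [2, 14], [41, 60], [39, 48], [31, 40]],
  [[23, 29, 38, 44], [0, 1, 50, 51], [17, 22, 48, 55], [9, 18, 47, 52], [7, 21, 42, 56], [2, 3, 60,
   61], [4, 12, 33, 41], [25, 27, 28, 30], [8, 11, 13, 14], [19, 20, 24, 31], [37, 45, 49, 57], [5,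
   6, 53, 54], [43, 46, 59, 62], [16, 26, 34, 40], [15, 58], [10, 32], [39, 63], [35, 36]],
  [[33, 46, 49, 62], [35, 38, 58, 63], [32, 37, 40, 45], [25, 29, 51, 55], [19, 27, 36, 44], [18,
   23, 42, 47], [16, 24, 53, 61], [14, 21, 34, 57], [13, 20, 41, 48], [10, 26, 43, 59], [6, 11, 17,
   28], [5, 30, 39, 60], [3, 7, 50, 54], [2, 4, 9, 15], [1, 8, 22, 31], [0, 12, 52, 56]],
  [[10, 52], [13, 45], [46, 63], [6, 39], [51, 60], [53, 55], [24, 44], [17, 38], [9, 31], [18, 54],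
   [12, 33], [20, 43], [36, 58], [28, 41], [30, 57], [7, 26], [2, 49], [0, 11], [25, 50], [5, 21],
   [3, 47], [19, 48], [34, 56], [1, 29], [4, 27], [23, 62], [32, 40], [15, 42], [8, 14, 16, 22, 35,
   37, 59, 61]],
  [[16, 23, 34, 37], [56, 63], [44, 60], [21, 39], [26, 48], [11, 45], [1, 62], [3, 5], [31, 36],
   [14, 28], [46, 61], [4, 29], [2, 51], [49, 53], [35, 52], [0, 27], [41, 55], [7, 57], [9, 22],
   [8, 10], [47, 50], [17, 20], [6, 40], [13, 38], [15, 58], [30, 54], [12, 59], [18, 19, 24, 25,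
   32, 33, 42, 43]],
  [[48, 52], [22, 62], [19, 20], [36, 51], [3, 5], [49, 58], [6, 29], [11, 57], [26, 47], [35, 43],
   [2, 28], [14, 40], [25, 38], [15, 23], [16, 46], [53, 60], [1, 27], [0, 12], [54, 59], [31, 41],
   [34, 55], [4, 7], [45, 50], [8, 33], [17, 24, 37, 44], [9, 30, 42, 61], [10, 13, 18, 21, 32, 39,
   56, 63]],
  [[18, 20, 26, 28, 50, 52, 58, 60], [7, 22, 36, 53], [0, 13, 34, 47], [23, 30, 55, 62], [39, 57],
   [16, 43], [10, 63], [2, 21], [11, 42], [29, 35], [1, 4], [37, 41], [5, 8], [24, 31], [48, 49],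
   [19, 27], [54, 61], [6, 44], [45, 59], [14, 46], [17, 51], [33, 56], [25, 32], [38, 40], [3, 9],
   [12, 15]],
  [[0, 7, 18, 21, 43, 44, 57, 62], [6, 10, 52, 56], [16, 19, 32, 35], [13, 24, 47, 58], [4, 28, 36,
   60], [26, 59], [12, 15], [41, 53], [29, 50], [23, 46], [22, 38], [25, 42], [33, 48], [9, 14], [8,
   55], [34, 49], [31, 51], [5, 61], [17, 37], [2, 20], [30, 40], [11, 27], [45, 63], [1, 39], [3,
   54]],
  [[8, 11, 12, 15, 25, 26, 29, 30], [4, 27, 35, 60], [7, 23, 47, 63], [3, 18, 40, 57], [1, 21, 32,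
   52], [38, 41, 49, 62], [0, 28], [6, 50], [10, 14], [37, 45], [2, 58], [39, 43], [22, 48], [24,
   59], [17, 34], [13, 33], [16, 55], [36, 54], [20, 31], [19, 61], [44, 51], [46, 53], [5, 42], [9,
   56]],
  [[4, 12, 22, 30, 32, 40, 50, 58], [19, 21, 42, 44], [33, 34, 60, 63], [0, 14, 35, 45], [10, 26,
   46, 62], [6, 7, 48, 49], [15, 18, 38, 59], [36, 53], [31, 47], [3, 17], [1, 61], [23, 51], [20,
   28], [13, 39], [24, 27], [5, 11], [25, 43], [41, 52], [16, 29], [9, 56], [8, 55], [37, 54], [2,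
   57]],
  [[1, 10, 17, 26, 36, 47, 52, 63], [3, 22, 45, 56], [33, 40, 55, 62], [0, 8, 49, 57], [19, 28, 38,
   41], [5, 18, 37, 50], [2, 11, 39, 46], [4, 20, 43, 59], [27, 29], [13, 15], [7, 30], [24, 42],
   [21, 25], [31, 48], [54, 60], [23, 35], [9, 14], [32, 51], [16, 53], [12, 58], [6, 61], [34,
   44]],
  [[12, 15, 20, 23, 37, 38, 61, 62], [2, 21, 46, 57], [7, 31, 41, 49], [0, 22, 45, 59], [10, 13, 35,
   36], [26, 30, 50, 54], [3, 5, 27, 29], [4, 8, 32, 44], [39, 40, 55, 56], [28, 60], [51, 53], [19,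
   58], [17, 24], [14, 16], [11, 25], [1, 52], [9, 43], [42, 63], [33, 48], [34, 47], [6, 18]],
  [[7, 13, 19, 25, 35, 41, 55, 61], [10, 23, 39, 58], [3, 5, 16, 22], [0, 2, 44, 46], [8, 29, 37,
   48], [18, 31, 52, 57], [9, 28, 43, 62], [38, 42, 51, 63], [20, 21, 32, 33], [1, 14, 34, 45], [15,
   47], [11, 36], [4, 24], [26, 27], [56, 59], [17, 60], [6, 50], [30, 53], [49, 54], [12, 40]],
  [[0, 1, 4, 5, 56, 57, 60, 61], [15, 28, 38, 53], [8, 17, 34, 59], [18, 27, 37, 44], [2, 24, 36,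
   62], [14, 21, 33, 58], [3, 26, 40, 49], [19, 23, 42, 46], [7, 9, 39, 41], [20, 22, 48, 50], [13,
   25, 35, 55], [43, 52], [16, 63], [31, 32], [10, 11], [45, 47], [6, 51], [29, 54], [12, 30]],
  [[33, 37, 40, 44, 50, 54, 59, 63], [6, 10, 17, 29], [7, 9, 55, 57], [32, 47, 51, 60], [2, 11, 22,
   31], [16, 27, 49, 58], [1, 13, 39, 43], [3, 19, 45, 61], [5, 15, 20, 30], [8, 26, 42, 56], [12,
   14, 21, 23], [34, 38, 48, 52], [0, 46], [18, 28], [53, 62], [4, 35], [24, 36], [25, 41]],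
  [[0, 5, 27, 30, 33, 36, 58, 63], [13, 31, 42, 56], [18, 19, 28, 29], [3, 6, 10, 15], [34, 38, 48,
   52], [11, 21, 35, 61], [2, 25, 44, 55], [16, 26, 49, 59], [32, 43, 53, 62], [7, 8, 51, 60], [4,
   17, 39, 50], [9, 24, 40, 57], [14, 22, 46, 54], [23, 45], [20, 47], [37, 41], [1, 12]],
  [[5, 8, 20, 25, 37, 40, 52, 57], [38, 39, 42, 43], [36, 46, 48, 58], [23, 31, 53, 61], [19, 28,
   35, 44], [16, 29, 50, 63], [15, 17, 32, 62], [11, 18, 33, 56], [10, 12, 41, 47], [9, 13, 51, 55],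
   [6, 21, 34, 49], [4, 14, 54, 60], [3, 7, 26, 30], [1, 2, 24, 27], [0, 22, 45, 59]],
  [[42, 58], [17, 20], [32, 51], [3, 4], [24, 46], [13, 40], [11, 36], [21, 26], [57, 61], [34, 53],
   [18, 59], [16, 49], [1, 9], [5, 63], [23, 44], [45, 56], [31, 39], [15, 22], [2, 41], [7, 47],
   [10, 38], [0, 30], [55, 60], [28, 50], [6, 8, 19, 29, 37, 43, 48, 62], [12, 14, 25, 27, 33, 35,
   52, 54]],
  [[16, 23, 24, 31, 51, 52, 59, 60], [17, 21, 25, 29, 34, 38, 42, 46], [40, 45, 58, 63], [9, 53],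
   [26, 50], [10, 27], [28, 36], [47, 55], [13, 43], [19, 32], [39, 56], [2, 61], [15, 44], [30,
   37], [18, 57], [12, 33], [11, 14], [3, 62], [4, 22], [1, 20], [35, 48], [6, 49], [7, 8], [0, 54],
   [5, 41]],
  [[6, 7, 8, 9, 22, 23, 24, 25], [3, 13, 21, 27, 37, 43, 51, 61], [17, 20, 57, 60], [11, 15, 49,
   53], [1, 40], [14, 63], [16, 52], [10, 44], [12, 29], [28, 50], [18, 33], [41, 47], [0, 31], [56,
   59], [5, 42], [30, 54], [19, 35], [4, 62], [2, 48], [32, 36], [26, 38], [46, 55], [39, 58], [34,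
   45]],
  [[2, 15, 20, 25, 33, 44, 55, 58], [4, 10, 22, 24, 32, 46, 50, 60], [5, 17, 34, 54], [9, 16, 41,
   48], [6, 14, 19, 27], [43, 51], [11, 56], [13, 29], [36, 63], [18, 59], [45, 47], [0, 26], [37,
   52], [31, 53], [21, 28], [8, 40], [12, 62], [39, 49], [23, 35], [3, 30], [1, 7], [38, 42], [57,
   61]],
  [[0, 4, 19, 23, 43, 47, 56, 60], [2, 3, 8, 9, 20, 21, 30, 31], [12, 25, 38, 51], [36, 46, 55, 61],
   [1, 7, 27, 29], [6, 17, 39, 48], [34, 45], [11, 54], [59, 62], [5, 42], [26, 35], [13, 14], [37,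
   49], [33, 52], [50, 57], [18, 58], [28, 40], [10, 63], [16, 53], [22, 32], [15, 44], [24, 41]],
  [[1, 7, 10, 12, 49, 55, 58, 60], [18, 21, 27, 28, 35, 36, 42, 45], [14, 15, 16, 17], [2, 4, 11,
   13], [3, 6, 32, 37], [34, 40, 53, 63], [30, 31, 56, 57], [43, 50], [23, 62], [19, 59], [51, 54],
   [29, 44], [47, 52], [22, 24], [0, 61], [9, 25], [5, 46], [8, 41], [20, 39], [26, 48], [33, 38]],
  [[4, 6, 8, 10, 17, 19, 29, 31], [9, 13, 18, 22, 43, 47, 48, 52], [11, 21, 35, 61], [16, 20, 24,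
   28], [2, 12, 38, 40], [3, 26, 33, 56], [45, 46, 57, 58], [34, 42, 54, 62], [37, 44], [30, 36],
   [5, 32], [49, 60], [7, 27], [41, 59], [55, 63], [14, 23], [39, 51], [0, 15], [25, 53], [1, 50]],
  [[7, 11, 23, 27, 38, 42, 54, 58], [1, 13, 22, 26, 37, 41, 50, 62], [17, 28, 52, 57], [3, 12, 32,
   47], [6, 24, 43, 53], [4, 8, 48, 60], [0, 14, 49, 63], [15, 29, 33, 51], [5, 9, 19, 31], [25,
   46], [45, 56], [16, 35], [30, 34], [44, 61], [18, 59], [2, 20], [39, 40], [10, 55], [21, 36]],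
  [[12, 15, 20, 23, 44, 47, 52, 55], [1, 8, 16, 25, 39, 46, 54, 63], [2, 10, 37, 45], [48, 51, 61,
   62], [0, 26, 33, 59], [9, 19, 38, 60], [11, 18, 40, 49], [28, 30, 41, 43], [7, 13, 32, 42], [3,
   4, 50, 53], [34, 56], [14, 57], [6, 27], [5, 22], [21, 35], [36, 58], [24, 31], [17, 29]],
  [[2, 4, 16, 22, 43, 45, 57, 63], [1, 5, 26, 30, 42, 46, 49, 53], [11, 14, 17, 20], [6, 13, 19,
   24], [33, 47, 48, 62], [0, 23, 32, 55], [3, 25, 40, 50], [15, 27, 41, 61], [8, 9, 34, 35], [10,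
   28, 37, 51], [21, 31, 38, 44], [12, 58], [7, 18], [36, 56], [52, 54], [39, 60], [29, 59]],
  [[3, 7, 24, 28, 34, 38, 57, 61], [2, 10, 22, 30, 39, 47, 51, 59], [36, 40, 50, 62], [0, 4, 42,
   46], [8, 29, 37, 48], [13, 15, 56, 58], [12, 27, 43, 60], [5, 19, 35, 53], [18, 21, 49, 54], [23,
   26, 33, 44], [6, 11, 32, 45], [9, 20, 41, 52], [1, 55], [16, 17], [25, 63], [14, 31]],
  [[8, 9, 26, 27, 36, 37, 54, 55], [3, 10, 22, 31, 38, 47, 51, 58], [56, 59, 61, 62], [32, 42, 53,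
   63], [21, 29, 35, 43], [16, 23, 25, 30], [14, 19, 45, 48], [13, 28, 40, 57], [7, 12, 34, 41], [6,
   11, 49, 60], [5, 15, 18, 24], [4, 17, 33, 52], [1, 20, 39, 50], [0, 2, 44, 46]],
  [[8, 10, 13, 15, 57, 59, 60, 62], [16, 20, 25, 29, 32, 36, 41, 45], [5, 12, 22, 31, 39, 46, 52,
   61], [2, 30], [35, 44], [50, 63], [27, 43], [18, 26], [28, 56], [6, 33], [37, 58], [38, 42], [1,
   40], [0, 23], [4, 53], [47, 49], [3, 21], [24, 34], [9, 54], [14, 48], [7, 51], [11, 19], [17,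
   55]],
  [[1, 5, 26, 30, 35, 39, 56, 60], [33, 36, 40, 45, 50, 55, 59, 62], [4, 6, 12, 14, 21, 23, 29, 31],
   [17, 27, 53, 63], [34, 58], [32, 51], [18, 25], [9, 15], [28, 52], [44, 46], [0, 16], [49, 61],
   [19, 41], [10, 43], [11, 57], [3, 37], [22, 38], [8, 48], [2, 20], [7, 24], [13, 47], [42, 54]],
  [[7, 13, 22, 28, 35, 41, 50, 56], [1, 8, 23, 30, 33, 40, 55, 62], [2, 4, 19, 21, 43, 45, 58, 60],
   [24, 31, 51, 52], [0, 12, 38, 42], [10, 26], [27, 29], [36, 39], [14, 48], [37, 44], [16, 32],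
   [25, 54], [20, 47], [17, 63], [53, 61], [15, 18], [3, 34], [11, 46], [6, 57], [5, 9], [49, 59]],
  [[8, 11, 21, 22, 32, 35, 61, 62], [3, 15, 20, 24, 36, 40, 51, 63], [16, 17, 28, 29, 54, 55, 58,
   59], [19, 27, 34, 42], [25, 31, 41, 47], [10, 23, 45, 48], [37, 57], [26, 49], [30, 38], [12,
   53], [5, 6], [1, 52], [9, 43], [18, 44], [7, 39], [33, 56], [0, 4], [2, 14], [13, 46], [50, 60]],
  [[2, 7, 10, 15, 49, 52, 57, 60], [0, 12, 21, 25, 38, 42, 51, 63], [6, 9, 20, 27, 32, 47, 50, 61],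
   [4, 11, 53, 58], [29, 31, 41, 43], [3, 5, 26, 28], [18, 19, 44, 45], [8, 40], [48, 62], [34, 36],
   [14, 37], [16, 35], [54, 55], [13, 39], [1, 46], [22, 56], [17, 24], [30, 33], [23, 59]],
  [[0, 13, 21, 24, 34, 47, 55, 58], [1, 2, 20, 23, 37, 38, 48, 51], [4, 7, 8, 11, 49, 50, 61, 62],
   [5, 16, 33, 52], [9, 12, 19, 22], [28, 29, 40, 41], [44, 45, 56, 57], [18, 27, 39, 46], [36, 53],
   [14, 15], [43, 60], [10, 32], [3, 42], [26, 54], [59, 63], [6, 31], [25, 35], [17, 30]],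
  [[2, 6, 19, 23, 43, 47, 58, 62], [8, 13, 25, 28, 41, 44, 56, 61], [1, 5, 10, 14, 17, 21, 26, 30],
   [39, 45, 51, 57], [22, 31, 54, 63], [16, 24, 32, 40], [15, 29, 46, 60], [36, 42, 53, 59], [35,
   37, 50, 52], [4, 27], [9, 34], [7, 20], [0, 55], [18, 38], [3, 11], [48, 49], [12, 33]],
  [[5, 15, 22, 28, 36, 46, 55, 61], [10, 13, 25, 30, 34, 37, 49, 54], [3, 7, 8, 12, 16, 20, 27, 31],
   [0, 17, 43, 58], [42, 45, 56, 63], [35, 41, 52, 62], [11, 23, 44, 48], [39, 40, 51, 60], [1, 24,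
   32, 57], [18, 21, 26, 29], [6, 53], [4, 9], [19, 38], [33, 59], [14, 47], [2, 50]],
  [[3, 6, 9, 12, 18, 23, 24, 29], [1, 2, 8, 11, 37, 38, 44, 47], [32, 35, 45, 46, 52, 55, 57, 58],
   [40, 42, 61, 63], [16, 19, 48, 51], [13, 30, 33, 50], [4, 15, 20, 31], [5, 22, 34, 49], [7, 26,
   43, 54], [0, 28, 39, 59], [10, 14, 17, 21], [53, 60], [27, 62], [25, 36], [41, 56]],
  [[3, 7, 9, 13, 32, 36, 42, 46], [14, 15, 18, 19, 44, 45, 48, 49], [25, 26, 28, 31, 56, 59, 61,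
   62], [40, 41, 54, 55], [22, 27, 50, 63], [20, 29, 34, 43], [17, 24, 53, 60], [12, 16, 38, 58],
   [6, 23, 37, 52], [4, 10, 33, 47], [2, 8, 51, 57], [1, 5, 35, 39], [0, 11, 21, 30]],
  [[8, 10, 20, 22, 40, 42, 52, 54], [4, 9, 16, 29, 35, 46, 55, 58], [2, 15, 18, 31, 34, 47, 50, 63],
   [1, 13, 23, 27, 39, 43, 49, 61], [12, 56], [37, 57], [7, 45], [3, 36], [11, 25], [24, 51], [0,
   21], [33, 41], [26, 30], [59, 60], [17, 32], [19, 53], [5, 44], [6, 38], [14, 62], [28, 48]],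
  [[3, 4, 27, 28, 43, 44, 51, 52], [9, 13, 25, 29, 41, 45, 57, 61], [5, 15, 21, 31, 37, 47, 53, 63],
   [2, 6, 10, 14, 34, 38, 42, 46], [17, 23, 24, 30], [39, 50], [0, 22], [59, 62], [36, 40], [11,
   20], [12, 49], [55, 58], [1, 18], [54, 56], [33, 35], [8, 19], [26, 60], [16, 32], [7, 48]],
  [[6, 8, 21, 27, 34, 44, 49, 63], [9, 11, 12, 14, 48, 50, 53, 55], [10, 13, 24, 31, 41, 46, 59,
   60], [32, 35, 36, 39, 57, 58, 61, 62], [7, 16, 47, 56], [18, 30, 33, 45], [15, 51], [1, 52], [0,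
   23], [38, 43], [19, 20], [5, 29], [26, 40], [4, 37], [28, 42], [25, 54], [3, 17], [2, 22]],
  [[1, 13, 23, 27, 34, 46, 52, 56], [5, 9, 16, 28, 39, 43, 50, 62], [0, 7, 19, 20, 40, 47, 59, 60],
   [3, 4, 11, 12, 17, 22, 25, 30], [8, 18, 41, 51], [37, 44, 48, 57], [24, 26, 29, 31], [6, 49],
   [10, 33], [14, 63], [38, 45], [15, 58], [2, 54], [32, 36], [42, 55], [53, 61], [21, 35]],
  [[5, 11, 20, 26, 37, 43, 52, 58], [9, 12, 27, 30, 34, 39, 48, 53], [16, 19, 28, 31, 32, 35, 44,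
   47], [2, 6, 10, 14, 17, 21, 25, 29], [57, 59, 61, 63], [7, 8, 38, 41], [4, 24, 45, 49], [0, 13,
   51, 62], [40, 60], [18, 46], [15, 55], [3, 22], [50, 56], [33, 42], [23, 54], [1, 36]],
  [[2, 5, 9, 14, 48, 55, 59, 60], [3, 15, 17, 29, 39, 43, 53, 57], [18, 22, 27, 31, 32, 36, 41, 45],
   [6, 13, 23, 28, 37, 46, 52, 63], [0, 12, 50, 62], [4, 16, 34, 54], [8, 10, 33, 35], [7, 21, 42,
   56], [20, 24, 49, 61], [19, 44], [40, 47], [25, 51], [30, 58], [11, 38], [1, 26]],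
  [[16, 17, 20, 21, 26, 27, 30, 31], [0, 2, 9, 11, 36, 38, 45, 47], [1, 4, 19, 22, 43, 46, 57, 60],
   [37, 39, 40, 42, 48, 50, 61, 63], [8, 28, 44, 56], [18, 23, 59, 62], [10, 25, 32, 51], [15, 29,
   35, 49], [13, 24, 34, 55], [6, 14, 33, 41], [3, 58], [5, 12], [7, 52], [53, 54]],
  [[16, 20, 26, 30, 51, 55, 57, 61], [4, 15, 19, 24, 34, 41, 53, 62], [35, 39, 43, 47, 48, 52, 56,
   60], [1, 2, 9, 10, 37, 38, 45, 46], [32, 42, 49, 59], [17, 21, 27, 31], [12, 18, 40, 54], [11,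
   14, 33, 36], [7, 13, 23, 29], [5, 8, 50, 63], [3, 6, 25, 28], [0, 22, 44, 58]],
  [[32, 35, 36, 39, 41, 42, 45, 46], [2, 6, 25, 29, 43, 47, 48, 52], [3, 10, 23, 30, 33, 40, 53,
   60], [0, 4, 24, 28, 34, 38, 58, 62], [1, 8, 22, 31, 37, 44, 50, 59], [5, 18], [19, 20], [7, 12],
   [55, 63], [11, 26], [9, 57], [17, 49], [14, 15], [21, 54], [27, 51], [13, 16], [56, 61]],
  [[1, 13, 21, 25, 34, 46, 54, 58], [9, 11, 28, 30, 41, 43, 60, 62], [7, 14, 19, 26, 36, 45, 48,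
   57], [16, 22, 27, 29, 33, 39, 42, 44], [3, 4, 24, 31, 40, 47, 51, 52], [0, 5, 18, 23], [17, 61],
   [37, 49], [35, 63], [8, 50], [10, 20], [2, 59], [15, 56], [53, 55], [6, 12], [32, 38]],
  [[3, 7, 18, 22, 34, 38, 51, 55], [19, 21, 27, 29, 48, 54, 56, 62], [2, 4, 9, 15, 33, 39, 42, 44],
   [0, 13, 17, 28, 37, 40, 52, 57], [6, 11, 20, 25, 32, 45, 50, 63], [5, 26, 36, 59], [14, 23, 35,
   58], [31, 61], [8, 46], [30, 41], [10, 24], [49, 60], [16, 53], [12, 43], [1, 47]],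
  [[1, 3, 25, 27, 40, 42, 48, 50], [7, 15, 18, 26, 38, 46, 51, 59], [2, 12, 16, 30, 37, 43, 55, 57],
   [4, 6, 17, 19, 33, 35, 52, 54], [11, 14, 24, 29, 41, 44, 58, 63], [20, 23, 28, 31], [39, 47, 53,
   61], [0, 13, 49, 60], [10, 34], [9, 22], [36, 45], [8, 21], [5, 32], [56, 62]],
  [[0, 12, 16, 28, 37, 41, 53, 57], [13, 15, 17, 19, 45, 47, 49, 51], [7, 8, 18, 29, 39, 40, 50,
   61], [5, 6, 25, 26, 32, 35, 60, 63], [4, 14, 21, 31, 33, 43, 48, 58], [36, 44, 54, 62], [3, 22,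
   46, 59], [1, 20, 34, 55], [23, 27, 52, 56], [9, 38], [10, 11], [24, 30], [2, 42]],
  [[0, 4, 24, 28, 33, 37, 57, 61], [17, 20, 26, 31, 35, 38, 40, 45], [5, 14, 21, 30, 39, 44, 55,
   60], [6, 11, 22, 27, 34, 47, 50, 63], [12, 13, 18, 19, 42, 43, 52, 53], [49, 51, 56, 58], [32,
   46, 48, 62], [7, 10, 54, 59], [3, 9, 23, 29], [2, 15, 36, 41], [1, 8, 16, 25]],
  [[1, 5, 8, 12, 18, 22, 27, 31], [20, 21, 24, 25, 34, 35, 46, 47], [17, 19, 28, 30, 53, 55, 56,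
   58], [0, 13, 23, 26, 33, 44, 54, 59], [2, 6, 11, 15, 48, 52, 57, 61], [38, 39, 42, 43, 50, 51,
   62, 63], [4, 41], [29, 45], [40, 60], [7, 14], [9, 16], [10, 36], [32, 37], [3, 49]],
  [[13, 14, 21, 22, 40, 43, 48, 51], [0, 1, 28, 29, 34, 35, 62, 63], [2, 15, 20, 25, 39, 42, 49,
   60], [7, 9, 16, 30, 33, 47, 54, 56], [3, 4, 24, 31, 41, 46, 50, 53], [18, 19, 26, 27, 36, 37, 44,
   45], [6, 23, 38, 55], [32, 57], [10, 17], [8, 11], [5, 59], [58, 61], [12, 52]],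
  [[7, 13, 22, 28, 38, 44, 55, 61], [2, 9, 18, 25, 33, 42, 49, 58], [3, 14, 19, 30, 36, 41, 52, 57],
   [0, 8, 16, 24, 35, 43, 51, 59], [1, 5, 11, 15, 50, 54, 56, 60], [4, 10, 20, 26, 32, 46, 48, 62],
   [17, 27, 39, 45], [6, 12, 34, 40], [29, 53], [37, 47], [23, 31], [21, 63]],
  [[1, 5, 8, 12, 34, 38, 43, 47], [11, 13, 17, 23, 33, 39, 59, 61], [10, 15, 25, 28, 32, 37, 51,
   54], [19, 21, 27, 29, 50, 52, 58, 60], [2, 3, 30, 31, 44, 45, 48, 49], [0, 6, 16, 22, 40, 46, 56,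
   62], [24, 26, 53, 55], [14, 20, 35, 57], [7, 9, 36, 42], [4, 18, 41, 63]],
  [[14, 15, 18, 19, 36, 37, 56, 57], [16, 23, 24, 31, 51, 52, 59, 60], [10, 13, 26, 29, 32, 39, 48,
   55], [6, 12, 17, 27, 34, 40, 53, 63], [4, 7, 21, 22, 44, 47, 61, 62], [2, 5, 25, 30, 42, 45, 49,
   54], [1, 3, 9, 11, 33, 35, 41, 43], [0, 8, 20, 28, 38, 46, 50, 58]]]

theorem isTightIrreducibleCode_of_mem_two :
    partitionsTwoFive.all isTightIrreducibleCode = true := by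
  decide +kernel

theorem isTightIrreducibleCode_of_mem_one :
    partitionsOneFive.all isTightIrreducibleCode = true := by
  decide +kernel

theorem isTightIrreducibleCode_of_mem_no :
    partitionsNoFive.all isTightIrreducibleCode = true := by
  decide +kernel

theorem exists_hasTypeCode_two : ∀ i < 3, ∀ j < 9,
    (j + 2 * i ≤ 8 ∧ j + 2 * i ≠ 7) ∧ (i, j) ≠ (2, 4) →
    partitionsTwoFive.any (hasTypeCode 2 i j (16 - 2 * j - 4 * i)) = true := by
  decide +kernel

theorem exists_hasTypeCode_one : ∀ i < 5, ∀ j < 13, j + 2 * i ≤ 12 ∧ j + 2 * i ≠ 11 →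
    partitionsOneFive.any (hasTypeCode 1 i j (24 - 2 * j - 4 * i)) = true := by
  decide +kernel

theorem exists_hasTypeCode_no : ∀ i < 9, ∀ j < 17, (j + 2 * i ≤ 16 ∧ j + 2 * i ≠ 15) ∧ i ≠ 7 →
    partitionsNoFive.any (hasTypeCode 0 i j (32 - 2 * j - 4 * i)) = true := by
  decide +kernel

theorem exists_isTightIrreducibleAVSP_of_list {data : List (List (List ℕ))} {m₅ m₄ m₃ m₂ : ℕ}
    (h : data.all isTightIrreducibleCode = true)
    (htype : data.any (hasTypeCode m₅ m₄ m₃ m₂) = true) :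
    ∃ 𝒰 : Finset (Submodule (ZMod 2) (Fin 7 → ZMod 2)),
      IsTightIrreducibleAVSP 𝒰 ∧ avspType 𝒰 = typeFiveToTwo m₅ m₄ m₃ m₂ := by
  obtain ⟨els, hels, ht⟩ := List.any_eq_true.1 htype
  exact ⟨_, isTightIrreducibleAVSP_codePartition (List.all_eq_true.1 h els hels) ht⟩

/-- Every listed type is the type of a tight irreducible avsp of `PG(6,2)`. -/
theorem exists_of_isListedType {m : ℕ → ℕ} (hm : IsListedType m) :
    ∃ 𝒰 : Finset (Submodule (ZMod 2) (Fin 7 → ZMod 2)),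
      IsTightIrreducibleAVSP 𝒰 ∧ avspType 𝒰 = m := by
  cases hm with
  | two_five i j hi hj h7 hne =>
    exact exists_isTightIrreducibleAVSP_of_list isTightIrreducibleCode_of_mem_two
      (exists_hasTypeCode_two i (by omega) j (by omega) ⟨⟨hj, h7⟩, hne⟩)
  | one_five i j hi hj h11 =>
    exact exists_isTightIrreducibleAVSP_of_list isTightIrreducibleCode_of_mem_one
      (exists_hasTypeCode_one i (by omega) j (by omega) ⟨hj, h11⟩)
  | no_five i j hi hj h15 h7 =>
    exact exists_isTightIrreducibleAVSP_of_list isTightIrreducibleCode_of_mem_no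
      (exists_hasTypeCode_no i (by omega) j (by omega) ⟨⟨hj, h15⟩, h7⟩)

end Data

theorem IsTightIrreducibleAVSP.isListedType {𝒰 : Finset (Submodule (ZMod 2) (Fin 7 → ZMod 2))}
    (h𝒰 : IsTightIrreducibleAVSP 𝒰) : IsListedType (avspType 𝒰) := by
  obtain ⟨h, hp, hirr, hh, htight⟩ := h𝒰.exists_functional
  exact hirr.isListedType hp hh htight (by simp)

/-- The size is the sum of the multiplicities. -/
theorem card_eq_sum_avspType {V : Type*} [AddCommGroup V] [Module (ZMod 2) V]
    {𝒰 : Finset (Submodule (ZMod 2) V)} {m₅ m₄ m₃ m₂ : ℕ}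
    (hm : avspType 𝒰 = typeFiveToTwo m₅ m₄ m₃ m₂) : 𝒰.card = m₅ + m₄ + m₃ + m₂ := by
  have h1 : ∀ U ∈ 𝒰, finrank (ZMod 2) U ≤ 5 := by
    intro U hU
    by_contra! h6
    have h2 : avspType 𝒰 (finrank (ZMod 2) U) = 0 := by
      rw [hm]
      match finrank (ZMod 2) U, h6 with
      | d + 6, _ => rfl
    exact avspType_eq_zero_iff.1 h2 U hU rfl
  have h2 := sum_filter_finrank_le 𝒰 5 fun _ => 1
  rw [Finset.filter_true_of_mem h1, Finset.sum_const, smul_eq_mul, mul_one, hm] at h2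
  simp only [Finset.sum_range_succ, Finset.sum_range_zero, typeFiveToTwo] at h2
  omega

theorem IsTightIrreducibleAVSP.eight_le_card {𝒰 : Finset (Submodule (ZMod 2) (Fin 7 → ZMod 2))}
    (h𝒰 : IsTightIrreducibleAVSP 𝒰) :
    8 ≤ 𝒰.card ∧ (𝒰.card = 8 → avspType 𝒰 = typeFiveToTwo 0 8 0 0) := by
  have h1 := h𝒰.isListedType
  generalize hm : avspType 𝒰 = m at h1
  cases h1 with
  | two_five i j hi hj h7 hne =>
    rw [card_eq_sum_avspType hm]
    have : ¬ (i = 2 ∧ j = 4) := by rintro ⟨rfl, rfl⟩; exact hne rfl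
    exact ⟨by omega, fun h8 => by omega⟩
  | one_five i j hi hj h11 =>
    rw [card_eq_sum_avspType hm]
    exact ⟨by omega, fun h8 => by omega⟩
  | no_five i j hi hj h15 h7 =>
    rw [card_eq_sum_avspType hm]
    refine ⟨by omega, fun h8 => ?_⟩
    obtain rfl : i = 8 := by omega
    obtain rfl : j = 0 := by omega
    rfl

theorem mainTheorem5 :
    -- every tight irreducible avsp of PG(6,2) has a listed type
    (∀ 𝒰 : Finset (Submodule (ZMod 2) (Fin 7 → ZMod 2)),
      IsTightIrreducibleAVSP 𝒰 → IsListedType (avspType 𝒰)) ∧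
    -- every listed type is realized
    (∀ m : ℕ → ℕ, IsListedType m →
      ∃ 𝒰 : Finset (Submodule (ZMod 2) (Fin 7 → ZMod 2)),
        IsTightIrreducibleAVSP 𝒰 ∧ avspType 𝒰 = m) ∧
    -- the minimum possible size is 8
    IsLeast {r : ℕ | ∃ 𝒰 : Finset (Submodule (ZMod 2) (Fin 7 → ZMod 2)),
      IsTightIrreducibleAVSP 𝒰 ∧ 𝒰.card = r} 8 ∧
    -- and it is attained only by type 4^8
    (∀ 𝒰 : Finset (Submodule (ZMod 2) (Fin 7 → ZMod 2)),
      IsTightIrreducibleAVSP 𝒰 → 𝒰.card = 8 → avspType 𝒰 = typeFiveToTwo 0 8 0 0) := by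
  refine ⟨fun 𝒰 h𝒰 => h𝒰.isListedType, fun m hm => exists_of_isListedType hm, ⟨?_, ?_⟩,
    fun 𝒰 h𝒰 => h𝒰.eight_le_card.2⟩
  · obtain ⟨𝒰, h𝒰, hm⟩ := exists_of_isListedType
      (IsListedType.no_five 8 0 le_rfl (by omega) (by omega) (by omega))
    exact ⟨𝒰, h𝒰, card_eq_sum_avspType hm⟩
  · rintro r ⟨𝒰, h𝒰, rfl⟩
    exact h𝒰.eight_le_card.1
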